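/- Let $n\ge 0$. Let $B^n$ be the set of crossingless matchings of $2n$ points on a horizontal line (by arcs below the line), let $W(b)$ be the mirror image of $b\in B^n$, let $W(b)a$ be the disjoint union of circles obtained by gluing $W(b)$ on top of $a$, and let $|W(b)a|$ be its number of circles. **The odd arc algebra.** For a disjoint union of circles $S$ let $V(S)$ be the free abelian group on its circles, placed in degree $2$, and let $OF(S)=\Lambda^*V(S)\{-|S|\}$, where $\{m\}$ raises degrees by $m$. The functor $OF$ sends a merge of two circles to the map induced by identifying the two generators, and a split of a circle $a$ into $b_1,b_2$ with arrow $b_1\to b_2$ to the map $x\mapsto (b_1-b_2)\wedge x$, where $a$ is replaced by $b_1$ (or, equivalently, by $b_2$) in $x$. For all $a,b,c\in B^n$ choose a chronological cobordism $C_{cba}:W(c)bW(b)a\to W(c)a$, that is, an order in which the arcs of $b$ are contracted with their mirror images by saddles, in which no arc is contracted before an arc surrounding it, together with an arrow for each saddle. For a choice $C=\{C_{cba}\}$ let $OH^n_C=\bigoplus_{a,b\in B^n}b(OH^n)a$ with $b(OH^n)a=OF(W(b)a)\{n\}$, and with the bilinear product that is zero on $d(OH^n)c\otimes b(OH^n)a$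 for $c\neq b$ and sends $x\otimes y\in c(OH^n)b\otimes b(OH^n)a$ to $OF(C_{cba})(x\wedge y)\in c(OH^n)a$. **The grading.** Let $\mathcal G^n\times\mathcal Z_2$ be the groupoid with set of objects $B^n$ whose morphisms $a\to b$ are the pairs $(W(b)a,k)$ with $k\in\mathbb Z$ even if $|W(b)a|\equiv n \bmod 2$ and odd otherwise, and whose composition is $(W(c)b,l)\circ(W(b)a,k)=(W(c)a,k+l)$. The part of $OH^n_C$ of degree $(W(b)a,k)$ is the part of $b(OH^n)a$ of (quantum) degree $k$. **Quasialgebras.** A quasialgebra over a commutative ring $R$, graded by a groupoid $\mathcal G$, is a unital, not necessarily associative $R$-algebra $A=\bigoplus_{g\in\mathrm{Hom}(\mathcal G)}A_g$ with $A_gA_h\subset A_{g\circ h}$ if $g\circ h$ is defined and $A_gA_h=0$ otherwise, together with a map $\phi$ (the associator) from composable triples of morphisms of $\mathcal G$ to $R^*$ such that $(xy)z=\phi(g,h,k)\,x(yz)$ for all $x\in A_g$, $y\in A_h$, $z\in A_k$ with $(g,h,k)$ composable, and such that $\phi$ is a normalised $3$-cocycle: $\phi(h,k,l)\phi(g,hk,l)\phi(g,h,k)=\phi(gh,k,l)\phi(g,h,kl)$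 for all composable $g,h,k,l$, and $\phi(h,\mathrm{id},l)=1$ for all composable $h,l$. **Theorem.** For every $n$ and every choice $C$ there is a map $\varphi^{ch}_C$ from composable triples of morphisms of $\mathcal G^n$, that is, triples $(W(d)c,W(c)b,W(b)a)$ with $a,b,c,d\in B^n$, to $\mathbb Z/2\mathbb Z$ with the following properties. 1. For all $a,b,c,d\in B^n$, $$OF\bigl(C_{dba}\circ C_{dcb}\,\mathrm{Id}_{W(b)a}\bigr)=(-1)^{\varphi^{ch}_C(W(d)c,W(c)b,W(b)a)}\,OF\bigl(C_{dca}\circ \mathrm{Id}_{W(d)c}\,C_{cba}\bigr),$$ and the value $\varphi^{ch}_C(W(d)c,W(c)b,W(b)a)$ is uniquely determined by this equation whenever the left-hand side is not zero. 2. Let $s(W(c)b,W(b)a)$ be the number of splits in $C_{cba}$ and put $$\varphi_C\bigl((W(d)c,k),(W(c)b,l),(W(b)a,m)\bigr)=\varphi_C^{ch}(W(d)c,W(c)b,W(b)a)+\frac{k-n+|W(d)c|}{2}\,s(W(c)b,W(b)a)\in\mathbb Z/2\mathbb Z .$$ Then $OH^n_C$, graded by $\mathcal G^n\times\mathcal Z_2$,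 is a quasialgebra over $\mathbb Z$ with associator $(-1)^{\varphi_C}$. -/

import Mathlib

/-- A crossingless matching of `2 * n` points on a line: a fixed-point-free involution `partner`
such that no two of the arcs `{i, partner i}` cross. -/
structure CrossinglessMatching (n : ℕ) where
  partner : Fin (2 * n) → Fin (2 * n)
  partner_partner : ∀ i, partner (partner i) = i
  partner_ne : ∀ i, partner i ≠ i
  noncrossing : ∀ i j, i < j → j < partner i → partner j < partner i

namespace CrossinglessMatching

theorem partner_injective {n : ℕ} (b : CrossinglessMatching n) : Function.Injective b.partner :=
  Function.LeftInverse.injective b.partner_partner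

@[ext]
theorem ext {n : ℕ} {a b : CrossinglessMatching n} (h : a.partner = b.partner) : a = b := by
  cases a; cases b; cases h; rfl

instance (n : ℕ) : DecidableEq (CrossinglessMatching n) := fun a b =>
  decidable_of_iff (a.partner = b.partner) ⟨ext, fun h => h ▸ rfl⟩

noncomputable instance (n : ℕ) : Fintype (CrossinglessMatching n) :=
  Fintype.ofInjective CrossinglessMatching.partner fun _ _ h => ext h

end CrossinglessMatching

/-- The relation "lies on the same circle" on the `2 * n` points of the diagram `W(b)a`. -/
def circleSetoid {n : ℕ} (b a : CrossinglessMatching n) : Setoid (Fin (2 * n)) :=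
  Relation.EqvGen.setoid fun i j => j = b.partner i ∨ j = a.partner i

/-- The number `|W(b)a|` of circles of `W(b)a`. -/
noncomputable def numCircles {n : ℕ} (b a : CrossinglessMatching n) : ℕ :=
  Nat.card (Quotient (circleSetoid b a))

namespace CrossinglessMatching

theorem even_partner {n : ℕ} (b : CrossinglessMatching n) (i : Fin (2 * n)) :
    Even (b.partner i).val ↔ ¬ Even i.val := by
  have key : ∀ i, i < b.partner i → (Even (b.partner i).val ↔ ¬ Even i.val) := by
    intro i hi
    have h0 : ∑ j ∈ Finset.Ioo i (b.partner i), (1 : ZMod 2) = 0 := by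
      refine Finset.sum_involution (fun j _ => b.partner j) ?_ ?_ ?_ ?_
      · intro j _; decide
      · intro j _ _; exact b.partner_ne j
      · intro j hj
        rw [Finset.mem_Ioo] at hj ⊢
        refine ⟨?_, b.noncrossing i j hj.1 hj.2⟩
        by_contra hlt
        have hne : b.partner j ≠ i := fun h => by
          have := b.partner_partner j
          rw [h] at this
          exact absurd hj.2 (by rw [this]; exact lt_irrefl _)
        have hlt' : b.partner j < i := lt_of_le_of_ne (not_lt.1 hlt) hne
        have := b.noncrossing (b.partner j) i hlt' (by rw [b.partner_partner]; exact hj.1)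
        rw [b.partner_partner] at this
        exact absurd hj.2 (not_lt.2 this.le)
      · intro j _; exact b.partner_partner j
    rw [Finset.sum_const, nsmul_eq_mul, mul_one, ZMod.natCast_eq_zero_iff, Fin.card_Ioo] at h0
    have hi' : i.val < (b.partner i).val := hi
    rw [Nat.even_iff, Nat.even_iff]
    omega
  rcases lt_or_gt_of_ne (b.partner_ne i) with h | h
  · have := key (b.partner i) (by rw [b.partner_partner]; exact h)
    rw [b.partner_partner] at this
    tauto
  · exact key i h

/-- The permutation `b ∘ a` of the even points. -/
def evenPerm {n : ℕ} (b a : CrossinglessMatching n) :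
    Equiv.Perm {i : Fin (2 * n) // Even i.val} where
  toFun x := ⟨b.partner (a.partner x), by rw [even_partner, even_partner, not_not]; exact x.2⟩
  invFun x := ⟨a.partner (b.partner x), by rw [even_partner, even_partner, not_not]; exact x.2⟩
  left_inv x := by ext; simp [partner_partner]
  right_inv x := by ext; simp [partner_partner]

theorem evenPerm_mul {n : ℕ} (c b a : CrossinglessMatching n) :
    evenPerm c b * evenPerm b a = evenPerm c a := by
  ext x; simp [evenPerm, partner_partner]

theorem sign_eq_card_orbits {α : Type*} [Fintype α] [DecidableEq α] (σ : Equiv.Perm α) :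
    Equiv.Perm.sign σ =
      (-1) ^ (Fintype.card α + Nat.card (Quotient (Equiv.Perm.SameCycle.setoid σ))) := by
  classical
  have hq : Nat.card (Quotient (Equiv.Perm.SameCycle.setoid σ))
      = σ.cycleType.card + (Fintype.card α - σ.support.card) := by
    let F : α → Equiv.Perm α × Option α := fun x => (σ.cycleOf x, if σ x = x then some x else none)
    have hF : ∀ x y, F x = F y ↔ σ.SameCycle x y := by
      intro x y
      constructor
      · intro h
        by_cases hx : σ x = x
        · have h2 := congrArg Prod.snd h
          simp only [F, hx, if_true] at h2
          split_ifs at h2 with hy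
          rw [Option.some.inj h2]
        · have h1 : σ.cycleOf x = σ.cycleOf y := congrArg Prod.fst h
          have : x ∈ (σ.cycleOf y).support := by
            rw [← h1]; simpa [Equiv.Perm.mem_support_cycleOf_iff] using hx
          rw [Equiv.Perm.mem_support_cycleOf_iff] at this
          exact this.1.symm
      · intro h
        by_cases hx : σ x = x
        · have : y = x := by
            obtain ⟨k, hk⟩ := h
            rw [← hk]; exact Function.IsFixedPt.perm_zpow hx k
          rw [this]
        · have hy : σ y ≠ y := fun hy => hx (by
            obtain ⟨k, hk⟩ := h.symm
            have : y = x := by rw [← hk]; exact (Function.IsFixedPt.perm_zpow hy k).symm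
            rw [← this]; exact hy)
          simp [F, hx, hy, h.cycleOf_eq]
    have e1 : Nat.card (Quotient (Equiv.Perm.SameCycle.setoid σ)) = (Finset.univ.image F).card := by
      have e0 : (Finset.univ.image F).card = Nat.card (Set.range F) := by
        rw [Nat.card_eq_card_toFinset, Set.toFinset_range]
      rw [e0]
      refine Nat.card_congr (Equiv.ofBijective
        (Quotient.lift (fun x => (⟨F x, x, rfl⟩ : Set.range F)) ?_) ⟨?_, ?_⟩)
      · intro x y h; exact Subtype.ext ((hF x y).2 h)
      · rintro ⟨x⟩ ⟨y⟩ h; exact Quotient.sound ((hF x y).1 (congrArg Subtype.val h))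
      · rintro ⟨_, x, rfl⟩; exact ⟨Quotient.mk _ x, rfl⟩
    have e2 : Finset.univ.image F = (σ.cycleFactorsFinset.image (fun c => (c, none)))
        ∪ (σ.supportᶜ.image (fun x => ((1 : Equiv.Perm α), some x))) := by
      ext ⟨c, o⟩
      simp only [Finset.mem_image, Finset.mem_univ, true_and, Finset.mem_union, Finset.mem_compl,
        Equiv.Perm.mem_support, not_not, F, Prod.mk.injEq]
      constructor
      · rintro ⟨x, rfl, rfl⟩
        by_cases hx : σ x = x
        · right; exact ⟨x, hx, by rw [eq_comm, Equiv.Perm.cycleOf_eq_one_iff]; exact hx, by simp [hx]⟩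
        · left
          exact ⟨_, Equiv.Perm.cycleOf_mem_cycleFactorsFinset_iff.2
            (Equiv.Perm.mem_support.2 hx), rfl, by simp [hx]⟩
      · rintro (⟨c', hc, rfl, rfl⟩ | ⟨x, hx, rfl, rfl⟩)
        · obtain ⟨x, hx⟩ := (Equiv.Perm.mem_cycleFactorsFinset_iff.1 hc).1.nonempty_support
          have hx' := Equiv.Perm.mem_support.1
            (Equiv.Perm.mem_cycleFactorsFinset_support_le hc hx)
          exact ⟨x, (Equiv.Perm.cycle_is_cycleOf hx hc).symm, by simp [hx']⟩
        · exact ⟨x, (Equiv.Perm.cycleOf_eq_one_iff σ).2 hx, by simp [hx]⟩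
    rw [e1, e2, Finset.card_union_of_disjoint, Finset.card_image_of_injective,
      Finset.card_image_of_injective, Finset.card_compl, Equiv.Perm.cycleType_def,
      Multiset.card_map]
    · rfl
    · intro x y h; simpa using h
    · intro x y h; simpa using h
    · rw [Finset.disjoint_left]
      rintro ⟨c, o⟩ h1 h2
      simp only [Finset.mem_image, Prod.mk.injEq] at h1 h2
      obtain ⟨_, _, _, h1⟩ := h1
      obtain ⟨_, _, _, h2⟩ := h2
      rw [← h1] at h2; cases h2
  rw [hq, Equiv.Perm.sign_of_cycleType, Equiv.Perm.sum_cycleType]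
  have hle : σ.support.card ≤ Fintype.card α := Finset.card_le_univ _
  have : Fintype.card α + (σ.cycleType.card + (Fintype.card α - σ.support.card))
      = (σ.support.card + σ.cycleType.card) + 2 * (Fintype.card α - σ.support.card) := by omega
  rw [this, pow_add _ _ (2 * _), pow_mul]
  simp

theorem card_evenPerm_orbits {n : ℕ} (b a : CrossinglessMatching n) :
    Nat.card (Quotient (Equiv.Perm.SameCycle.setoid (evenPerm b a))) = numCircles b a := by
  classical
  let g : Fin (2 * n) → {i : Fin (2 * n) // Even i.val} := fun x =>
    if h : Even x.val then ⟨x, h⟩ else ⟨a.partner x, (even_partner a x).2 h⟩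
  have hg : ∀ x y, Relation.EqvGen (fun i j => j = b.partner i ∨ j = a.partner i) x y →
      (evenPerm b a).SameCycle (g x) (g y) := by
    intro x y h
    induction h with
    | rel x y h =>
      by_cases hx : Even x.val
      · rcases h with rfl | rfl
        · have hb : ¬ Even (b.partner x).val := by rw [even_partner]; exact not_not.2 hx
          refine ⟨-1, ?_⟩
          simp only [g, hx, hb, dif_pos, dif_neg, not_false_eq_true, zpow_neg, zpow_one]
          rfl
        · have hb : ¬ Even (a.partner x).val := by rw [even_partner]; exact not_not.2 hx
          refine ⟨0, ?_⟩
          simp [g, hx, hb, partner_partner]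
      · rcases h with rfl | rfl
        · have hb : Even (b.partner x).val := by rw [even_partner]; exact hx
          refine ⟨1, ?_⟩
          simp [g, hx, hb, evenPerm, partner_partner]
        · have hb : Even (a.partner x).val := by rw [even_partner]; exact hx
          refine ⟨0, ?_⟩
          simp [g, hx, hb]
    | refl x => exact Equiv.Perm.SameCycle.refl _ _
    | symm x y _ ih => exact ih.symm
    | trans x y z _ _ h1 h2 => exact h1.trans h2
  have hgx : ∀ x : {i : Fin (2 * n) // Even i.val}, g x = x := fun x => by simp [g, x.2]
  have hstep : ∀ x : {i : Fin (2 * n) // Even i.val},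
      (circleSetoid b a) x (evenPerm b a x) := fun x =>
    Relation.EqvGen.trans _ (a.partner x) _ (Relation.EqvGen.rel _ _ (Or.inr rfl))
      (Relation.EqvGen.rel _ _ (Or.inl rfl))
  refine Nat.card_congr (Equiv.ofBijective
    (Quotient.map' (s₂ := circleSetoid b a) (fun x => x.val) ?_) ⟨?_, ?_⟩)
  · rintro x y ⟨k, rfl⟩
    induction k using Int.induction_on generalizing x with
    | zero => exact Setoid.refl' _ _
    | succ k ih =>
      rw [add_comm, zpow_add, zpow_one]
      exact Setoid.trans' _ (ih x) (hstep _)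
    | pred k ih =>
      refine Setoid.trans' _ (ih x) (Setoid.symm' _ ?_)
      have := hstep ((evenPerm b a ^ (-(k : ℤ) - 1)) x)
      rwa [← Equiv.Perm.mul_apply, ← zpow_one_add, add_sub_cancel] at this
  · rintro ⟨x⟩ ⟨y⟩ h
    have := hg x y (Quotient.exact h)
    rw [hgx, hgx] at this
    exact Quotient.sound this
  · rintro ⟨x⟩
    by_cases hx : Even x.val
    · exact ⟨Quotient.mk _ ⟨x, hx⟩, rfl⟩
    · refine ⟨Quotient.mk _ ⟨a.partner x, (even_partner a x).2 hx⟩, ?_⟩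
      exact Quotient.sound (Setoid.symm' _ (Relation.EqvGen.rel _ _ (Or.inr rfl)))

theorem card_even (n : ℕ) : Fintype.card {i : Fin (2 * n) // Even i.val} = n := by
  have : {i : Fin (2 * n) // Even i.val} ≃ Fin n :=
    { toFun := fun i => ⟨i.1.val / 2, by have := i.1.isLt; omega⟩
      invFun := fun k => ⟨⟨2 * k.val, by have := k.isLt; omega⟩, by simp⟩
      left_inv := fun i => by
        ext; have := Nat.even_iff.1 i.2; simp only; omega
      right_inv := fun k => by ext; simp }
  rw [Fintype.card_congr this, Fintype.card_fin]

/-- The parity fact that makes the hom-sets of `ArcQuantumGroupoid` closed under composition. -/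
theorem even_numCircles {n : ℕ} (c b a : CrossinglessMatching n) :
    Even ((n : ℤ) + numCircles c b + numCircles b a + numCircles c a) := by
  have h := congrArg Equiv.Perm.sign (evenPerm_mul c b a)
  rw [map_mul, sign_eq_card_orbits, sign_eq_card_orbits, sign_eq_card_orbits,
    card_evenPerm_orbits, card_evenPerm_orbits, card_evenPerm_orbits, card_even, ← pow_add] at h
  have h2 : (-1 : ℤˣ) ^ (n + numCircles c b + (n + numCircles b a) + (n + numCircles c a)) = 1 := by
    rw [pow_add, h, ← pow_add, ← two_mul, pow_mul]; simp
  have h3 := (neg_one_pow_eq_one_iff_even (R := ℤˣ) (by decide)).1 h2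
  have h4 : Even ((n + numCircles c b + (n + numCircles b a) + (n + numCircles c a) : ℕ) : ℤ) :=
    (Int.even_coe_nat _).2 h3
  push_cast at h4
  rw [Int.even_iff] at h4 ⊢
  omega

end CrossinglessMatching

/-! ### The odd functor on 1-manifolds and saddles -/

/-- `OF(S) = Λ V(S)`, where the closed 1-manifold `S` is presented by a set `P` of points on it
(meeting every circle) together with the relation `r` of lying on the same circle. So the circles
of `S` are the classes of `r`, and `V(S)` is the free abelian group on them. -/
abbrev OF {P : Type} (r : Setoid P) : Type := ExteriorAlgebra ℤ (Quotient r →₀ ℤ)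

namespace OF

/-- The generator of `OF(S)` given by the circle through the point `p`. -/
noncomputable def gen {P : Type} (r : Setoid P) (p : P) : OF r :=
  ExteriorAlgebra.ι ℤ (Finsupp.single (Quotient.mk r p) 1)

/-- The algebra map `OF(S) → OF(S')` which replaces each circle of `S` by the circle of `S'`
through the image under `f` of a point chosen on it. When `f` maps circles into circles (inclusions
and identifications of diagrams, merges), this is the map induced by the map of circles, and the
chosen points do not matter. When `f` is a split, they matter only for the circle that is split,
which is replaced by one of the two resulting circles. -/
noncomputable def relabel {P Q : Type} (r : Setoid P) (s : Setoid Q) (f : P → Q) :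
    OF r →ₐ[ℤ] OF s :=
  ExteriorAlgebra.map (Finsupp.lmapDomain ℤ ℤ fun q : Quotient r => Quotient.mk s (f q.out))

open scoped Classical in
/-- The odd functor on a saddle from `r` to `r'` whose arrow points from the strand through `tail`
to the strand through `head`. If these strands lie on one circle after the saddle, then the saddle
is a merge, and its value is induced by the projection that identifies the two merged circles.
Otherwise it is a split of a circle `a` into `b₁` (through `tail`) and `b₂` (through `head`), and
its value is `x ↦ (b₁ - b₂) ∧ x`, where `a` is replaced in `x` by `b₁` or by `b₂` (the result is
the same). -/
noncomputable def saddle {P : Type} (r r' : Setoid P) (tail head : P) : OF r →ₗ[ℤ] OF r' :=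
  if r' tail head then (relabel r r' id).toLinearMap
  else LinearMap.mulLeft ℤ (gen r' tail - gen r' head) ∘ₗ (relabel r r' id).toLinearMap

end OF

/-- The disjoint union of two 1-manifolds. -/
def disjointUnion {P Q : Type} (r : Setoid P) (s : Setoid Q) : Setoid (P ⊕ Q) :=
  Setoid.ker (Sum.map (Quotient.mk r) (Quotient.mk s))

/-! ### Chronological cobordisms made of saddles -/

/-- A family of saddles indexed by `E`: `state K` is the 1-manifold obtained when exactly the
saddles in `K` have been performed, and the arrow of the saddle `e` goes from the strand through
`tail e` to the strand through `head e`. -/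
structure SaddleFamily (E P : Type) where
  state : Finset E → Setoid P
  tail : E → P
  head : E → P

namespace SaddleFamily

/-- The saddles of `M` beside the identity cobordism of `u`. -/
def besideId {E P Q : Type} (M : SaddleFamily E P) (u : Setoid Q) : SaddleFamily E (P ⊕ Q) where
  state K := disjointUnion (M.state K) u
  tail e := Sum.inl (M.tail e)
  head e := Sum.inl (M.head e)

/-- The identity cobordism of `u` beside the saddles of `M`. -/
def idBeside {E P Q : Type} (u : Setoid Q) (M : SaddleFamily E P) : SaddleFamily E (Q ⊕ P) where
  state K := disjointUnion u (M.state K)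
  tail e := Sum.inr (M.tail e)
  head e := Sum.inr (M.head e)

open scoped Classical in
/-- The number of splits when, after the saddles in `K`, those of a list are performed in order. -/
noncomputable def numSplits {E P : Type} (M : SaddleFamily E P) : Finset E → List E → ℕ
  | _, [] => 0
  | K, e :: L =>
      (if M.state (insert e K) (M.tail e) (M.head e) then 0 else 1) + M.numSplits (insert e K) L

open scoped Classical in
/-- The odd functor on the cobordism which, after the saddles in `K`, performs those of a list in
order, and whose target is finally identified with `s` through `f`. -/
noncomputable def eval {E P Q : Type} (M : SaddleFamily E P) (s : Setoid Q) (f : P → Q) :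
    (K : Finset E) → List E → (OF (M.state K) →ₗ[ℤ] OF s)
  | K, [] => (OF.relabel (M.state K) s f).toLinearMap
  | K, e :: L => M.eval s f (insert e K) L ∘ₗ
      OF.saddle (M.state K) (M.state (insert e K)) (M.tail e) (M.head e)

end SaddleFamily

/-! ### Contraction cobordisms -/

namespace CrossinglessMatching

/-- The arcs of `b`, each given by its left end point. -/
abbrev Arc {n : ℕ} (b : CrossinglessMatching n) : Type := {i : Fin (2 * n) // i < b.partner i}

/-- The right end point of an arc. -/
def Arc.right {n : ℕ} {b : CrossinglessMatching n} (e : b.Arc) : Fin (2 * n) := b.partner e.1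

/-- The arc `e` surrounds the arc `e'`. -/
def Arc.Surrounds {n : ℕ} {b : CrossinglessMatching n} (e e' : b.Arc) : Prop :=
  e.1 < e'.1 ∧ e'.right < e.right

end CrossinglessMatching

/-- The pieces of the diagram obtained from `W(c)bW(b)a` by contracting with their mirror images the
arcs of `b` in `K`. Points of the upper line, between `W(c)` and `b`, are `Sum.inl i`, and points of
the lower line, between `W(b)` and `a`, are `Sum.inr i`. A contracted arc and its mirror image are
replaced by two vertical strands joining the lines. -/
inductive ContractionPiece {n : ℕ} (c b a : CrossinglessMatching n) (K : Finset b.Arc) :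
    Fin (2 * n) ⊕ Fin (2 * n) → Fin (2 * n) ⊕ Fin (2 * n) → Prop
  | top (i : Fin (2 * n)) : ContractionPiece c b a K (Sum.inl i) (Sum.inl (c.partner i))
  | bottom (i : Fin (2 * n)) : ContractionPiece c b a K (Sum.inr i) (Sum.inr (a.partner i))
  | arc (e : b.Arc) (he : e ∉ K) : ContractionPiece c b a K (Sum.inl e.1) (Sum.inl e.right)
  | mirrorArc (e : b.Arc) (he : e ∉ K) : ContractionPiece c b a K (Sum.inr e.1) (Sum.inr e.right)
  | leftStrand (e : b.Arc) (he : e ∈ K) : ContractionPiece c b a K (Sum.inl e.1) (Sum.inr e.1)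
  | rightStrand (e : b.Arc) (he : e ∈ K) :
      ContractionPiece c b a K (Sum.inl e.right) (Sum.inr e.right)

/-- A way to make the contraction of the arcs of `b` a chronological cobordism: the order in which
the arcs are contracted, where no arc is contracted before one surrounding it, and an orientation
of each saddle (it only matters for splits), which is `true` if the arrow goes from the strand
through the left end point of the arc to the strand through the right end point. -/
structure Chronology {n : ℕ} (b : CrossinglessMatching n) where
  order : List b.Arc
  nodup : order.Nodup
  mem_order : ∀ e, e ∈ order
  not_surrounds : order.Pairwise fun e e' => ¬ e'.Surrounds e
  leftToRight : b.Arc → Bool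

/-- The saddles contracting the arcs of `b` in `W(c)bW(b)a`, oriented as in `χ`. -/
def contraction {n : ℕ} (c a : CrossinglessMatching n) {b : CrossinglessMatching n}
    (χ : Chronology b) : SaddleFamily b.Arc (Fin (2 * n) ⊕ Fin (2 * n)) where
  state K := Relation.EqvGen.setoid (ContractionPiece c b a K)
  tail e := Sum.inl (if χ.leftToRight e then e.1 else e.right)
  head e := Sum.inl (if χ.leftToRight e then e.right else e.1)

/-- A choice, for every triple `c, b, a`, of a chronological cobordism
`C_{cba} : W(c)bW(b)a → W(c)a`. -/
def ChronologyChoice (n : ℕ) : Type := (_c b _a : CrossinglessMatching n) → Chronology b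

namespace ChronologyChoice

variable {n : ℕ} (C : ChronologyChoice n)

/-- The two lines of points are collapsed to one. -/
def collapse {n : ℕ} : Fin (2 * n) ⊕ Fin (2 * n) → Fin (2 * n) := Sum.elim id id

/-- The number of splits of `C_{cba}`. -/
noncomputable def splits (c b a : CrossinglessMatching n) : ℕ :=
  (contraction c a (C c b a)).numSplits ∅ (C c b a).order

/-- `OF(C_{cba})`, whose source `W(c)bW(b)a` is the disjoint union of `W(c)b` and `W(b)a`. -/
noncomputable def contract (c b a : CrossinglessMatching n) :
    OF (disjointUnion (circleSetoid c b) (circleSetoid b a)) →ₗ[ℤ] OF (circleSetoid c a) :=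
  (contraction c a (C c b a)).eval (circleSetoid c a) collapse ∅ (C c b a).order ∘ₗ
    (OF.relabel _ ((contraction c a (C c b a)).state ∅) id).toLinearMap

/-- `OF` of the cobordism `C_{dcb} Id_{W(b)a}` from `W(d)cW(c)bW(b)a` to `W(d)bW(b)a`. -/
noncomputable def contractId (d c b a : CrossinglessMatching n) :
    OF (disjointUnion (disjointUnion (circleSetoid d c) (circleSetoid c b)) (circleSetoid b a))
      →ₗ[ℤ] OF (disjointUnion (circleSetoid d b) (circleSetoid b a)) :=
  ((contraction d b (C d c b)).besideId (circleSetoid b a)).eval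
      (disjointUnion (circleSetoid d b) (circleSetoid b a)) (Sum.map collapse id)
      ∅ (C d c b).order ∘ₗ
    (OF.relabel _
      (((contraction d b (C d c b)).besideId (circleSetoid b a)).state ∅) id).toLinearMap

/-- `OF` of the cobordism `Id_{W(d)c} C_{cba}` from `W(d)cW(c)bW(b)a` to `W(d)cW(c)a`. -/
noncomputable def idContract (d c b a : CrossinglessMatching n) :
    OF (disjointUnion (disjointUnion (circleSetoid d c) (circleSetoid c b)) (circleSetoid b a))
      →ₗ[ℤ] OF (disjointUnion (circleSetoid d c) (circleSetoid c a)) :=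
  (SaddleFamily.idBeside (circleSetoid d c) (contraction c a (C c b a))).eval
      (disjointUnion (circleSetoid d c) (circleSetoid c a)) (Sum.map id collapse)
      ∅ (C c b a).order ∘ₗ
    (OF.relabel _
      ((SaddleFamily.idBeside (circleSetoid d c) (contraction c a (C c b a))).state ∅)
      (Equiv.sumAssoc _ _ _)).toLinearMap

end ChronologyChoice

/-! ### The odd arc algebra -/

/-- The abelian group `OH^n`, the direct sum of the groups `b(OH^n)a = OF(W(b)a)` over the finitely
many pairs `b, a`, with the multiplication given by the choice `C`. -/
def OddArcAlgebra {n : ℕ} (_C : ChronologyChoice n) : Type :=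
  (b a : CrossinglessMatching n) → OF (circleSetoid b a)

namespace OddArcAlgebra

variable {n : ℕ} {C : ChronologyChoice n}

noncomputable instance : AddCommGroup (OddArcAlgebra C) :=
  inferInstanceAs (AddCommGroup ((b a : CrossinglessMatching n) → OF (circleSetoid b a)))

variable (C) in
/-- The product `c(OH^n)b ⊗ b(OH^n)a → c(OH^n)a`, that is, `x ⊗ y ↦ OF(C_{cba})(x ∧ y)`. -/
noncomputable def blockMul (c b a : CrossinglessMatching n) (x : OF (circleSetoid c b))
    (y : OF (circleSetoid b a)) : OF (circleSetoid c a) :=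
  C.contract c b a (OF.relabel _ _ Sum.inl x * OF.relabel _ _ Sum.inr y)

noncomputable instance : Mul (OddArcAlgebra C) :=
  ⟨fun x y c a => ∑ b, blockMul C c b a (x c b) (y b a)⟩

theorem add_apply (x y : OddArcAlgebra C) (b a : CrossinglessMatching n) :
    (x + y) b a = x b a + y b a := rfl

theorem zero_apply (b a : CrossinglessMatching n) : (0 : OddArcAlgebra C) b a = 0 := rfl

theorem mul_apply (x y : OddArcAlgebra C) (c a : CrossinglessMatching n) :
    (x * y) c a = ∑ b, blockMul C c b a (x c b) (y b a) := rfl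

noncomputable instance : NonUnitalNonAssocRing (OddArcAlgebra C) where
  left_distrib x y z := by
    funext c a
    simp only [add_apply, mul_apply, blockMul, map_add, mul_add, Finset.sum_add_distrib]
  right_distrib x y z := by
    funext c a
    simp only [add_apply, mul_apply, blockMul, map_add, add_mul, Finset.sum_add_distrib]
  zero_mul x := by
    funext c a
    simp only [zero_apply, mul_apply, blockMul, map_zero, zero_mul, Finset.sum_const_zero]
  mul_zero x := by
    funext c a
    simp only [zero_apply, mul_apply, blockMul, map_zero, mul_zero, Finset.sum_const_zero]

end OddArcAlgebra

/-! ### The grading groupoid -/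

/-- The groupoid `𝒢^n × 𝒵₂`: its objects are the crossingless matchings, and the morphisms from `a`
to `b` are the pairs `(W(b)a, k)` where the integer `k` is even if `|W(b)a| ≡ n` modulo `2` and odd
otherwise. -/
def ArcQuantumGroupoid (n : ℕ) : Type := CrossinglessMatching n

namespace ArcQuantumGroupoid

variable {n : ℕ}

theorem numCircles_parity (c b a : CrossinglessMatching n) :
    (numCircles c b + numCircles b a + numCircles c a + n) % 2 = 0 := by
  have h := CrossinglessMatching.even_numCircles c b a
  rw [Int.even_iff] at h
  omega

/-- Composition and inversion respectively add and negate the integers. -/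
noncomputable instance : CategoryTheory.Groupoid (ArcQuantumGroupoid n) where
  Hom a b := {k : ℤ // Even k ↔ numCircles (n := n) b a ≡ n [MOD 2]}
  id a := ⟨0, by
    have := numCircles_parity (n := n) a a a
    simp only [Int.even_iff, Nat.ModEq]; omega⟩
  comp {a b c} h g := ⟨g.1 + h.1, by
    have := numCircles_parity (n := n) c b a
    have hh := h.2
    have hg := g.2
    simp only [Int.even_iff, Nat.ModEq] at hh hg ⊢; omega⟩
  inv {a b} g := ⟨-g.1, by
    have h1 := numCircles_parity (n := n) a b a
    have h2 := numCircles_parity (n := n) a a a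
    have hg := g.2
    simp only [Int.even_iff, Nat.ModEq] at hg ⊢; omega⟩
  id_comp g := Subtype.ext (add_zero _)
  comp_id g := Subtype.ext (zero_add _)
  assoc f g h := Subtype.ext (by simp only; ring)
  inv_comp g := Subtype.ext (add_neg_cancel _)
  comp_inv g := Subtype.ext (neg_add_cancel _)

/-- The integer `k` of a morphism `(W(b)a, k)`. -/
def quantumDegree {a b : ArcQuantumGroupoid n} (g : a ⟶ b) : ℤ := g.1

/-- The parity `(k - n + |W(b)a|) / 2` of a morphism `(W(b)a, k)`; the division is exact. -/
noncomputable def parity {a b : ArcQuantumGroupoid n} (g : a ⟶ b) : ℤ :=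
  (quantumDegree g - n + numCircles (n := n) b a) / 2

end ArcQuantumGroupoid

/-- The part of quantum degree `k` of `OF(S){n}`, where `OF(S) = Λ V(S){-|S|}` and the generators
of `V(S)` have degree `2`. -/
noncomputable def quantumPart (n : ℕ) {P : Type} (r : Setoid P) (k : ℤ) : Submodule ℤ (OF r) :=
  ⨆ (m : ℕ) (_ : 2 * (m : ℤ) - Nat.card (Quotient r) + n = k), ⋀[ℤ]^m (Quotient r →₀ ℤ)

/-- The bigrading of `OH^n_C` by arc degree and quantum degree: the part of degree `(W(b)a, k)` is
the part of `b(OH^n)a` of quantum degree `k`. -/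
noncomputable def OddArcAlgebra.grading {n : ℕ} (C : ChronologyChoice n)
    ⦃a b : ArcQuantumGroupoid n⦄ (g : a ⟶ b) : Submodule ℤ (OddArcAlgebra C) where
  carrier := {x | x b a ∈ quantumPart n (circleSetoid (n := n) b a)
      (ArcQuantumGroupoid.quantumDegree g) ∧
    ∀ b' a' : CrossinglessMatching n, ¬ (b' = b ∧ a' = a) → x b' a' = 0}
  add_mem' {x y} hx hy := ⟨add_mem hx.1 hy.1, fun b' a' h => by
    rw [OddArcAlgebra.add_apply, hx.2 b' a' h, hy.2 b' a' h, add_zero]⟩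
  zero_mem' := ⟨zero_mem _, fun _ _ _ => rfl⟩
  smul_mem' t x hx := ⟨Submodule.smul_mem _ t hx.1, fun b' a' h => by
    have : (t • x) b' a' = t • x b' a' := rfl
    rw [this, hx.2 b' a' h, smul_zero]⟩

/-! ### Quasialgebras graded by a groupoid -/

section

open CategoryTheory

open scoped Classical in
/-- A grading of a nonassociative `R`-algebra by a groupoid. Recall that `h ≫ g` denotes the
composition `g ∘ h`. -/
structure IsGroupoidGrading {R A 𝒢 : Type*} [CommRing R] [NonUnitalNonAssocRing A] [Module R A]
    [Groupoid 𝒢] (𝒜 : ∀ ⦃a b : 𝒢⦄, (a ⟶ b) → Submodule R A) : Prop where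
  isInternal : DirectSum.IsInternal fun g : (Σ a b : 𝒢, (a ⟶ b)) => 𝒜 g.2.2
  mul_mem : ∀ ⦃a b c : 𝒢⦄ (g : b ⟶ c) (h : a ⟶ b) (x y : A),
    x ∈ 𝒜 g → y ∈ 𝒜 h → x * y ∈ 𝒜 (h ≫ g)
  mul_eq_zero : ∀ ⦃a b b' c : 𝒢⦄ (g : b' ⟶ c) (h : a ⟶ b) (x y : A),
    b' ≠ b → x ∈ 𝒜 g → y ∈ 𝒜 h → x * y = 0

/-- A function assigning a unit of `R` to every composable triple `g, h, k` is a normalised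
3-cocycle. -/
structure IsNormalizedThreeCocycle {R 𝒢 : Type*} [CommRing R] [Groupoid 𝒢]
    (φ : ∀ ⦃a b c d : 𝒢⦄, (c ⟶ d) → (b ⟶ c) → (a ⟶ b) → Rˣ) : Prop where
  cocycle : ∀ ⦃a b c d e : 𝒢⦄ (g : d ⟶ e) (h : c ⟶ d) (k : b ⟶ c) (l : a ⟶ b),
    φ h k l * φ g (k ≫ h) l * φ g h k = φ (h ≫ g) k l * φ g h (l ≫ k)
  normalized : ∀ ⦃a b c : 𝒢⦄ (h : b ⟶ c) (l : a ⟶ b), φ h (𝟙 b) l = 1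

/-- A unital nonassociative `R`-algebra with a grading by a groupoid is a quasialgebra with
associator `φ`. -/
structure IsQuasialgebra {R A 𝒢 : Type*} [CommRing R] [NonUnitalNonAssocRing A] [Module R A]
    [IsScalarTower R A A] [SMulCommClass R A A] [Groupoid 𝒢]
    (𝒜 : ∀ ⦃a b : 𝒢⦄, (a ⟶ b) → Submodule R A)
    (φ : ∀ ⦃a b c d : 𝒢⦄, (c ⟶ d) → (b ⟶ c) → (a ⟶ b) → Rˣ) : Prop where
  exists_unit : ∃ u : A, ∀ x : A, u * x = x ∧ x * u = x
  grading : IsGroupoidGrading 𝒜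
  cocycle : IsNormalizedThreeCocycle φ
  assoc : ∀ ⦃a b c d : 𝒢⦄ (g : c ⟶ d) (h : b ⟶ c) (k : a ⟶ b) (x y z : A),
    x ∈ 𝒜 g → y ∈ 𝒜 h → z ∈ 𝒜 k → (x * y) * z = (φ g h k : R) • (x * (y * z))

end

/-! ### The associator -/

namespace ChronologyChoice

variable {n : ℕ} (C : ChronologyChoice n)

/-- `OF(C_{dba} ∘ C_{dcb} Id_{W(b)a})`. -/
noncomputable def leftComposite (d c b a : CrossinglessMatching n) :=
  C.contract d b a ∘ₗ C.contractId d c b a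

/-- `OF(C_{dca} ∘ Id_{W(d)c} C_{cba})`. -/
noncomputable def rightComposite (d c b a : CrossinglessMatching n) :=
  C.contract d c a ∘ₗ C.idContract d c b a

/-- `φch(d, c, b, a)`, regarded as a function of `(W(d)c, W(c)b, W(b)a)`, is a sign exponent for the
change of chronology and orientations between the two composites. -/
def IsChronologyChangeSign (φch : (d c b a : CrossinglessMatching n) → ZMod 2) : Prop :=
  ∀ d c b a, C.leftComposite d c b a =
    (((-1 : ℤˣ) ^ φch d c b a : ℤˣ) : ℤ) • C.rightComposite d c b a

/-- The commutation term, `p(x) s(W(c)b, W(b)a)` modulo `2`. -/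
noncomputable def commutationTerm ⦃a b c d : ArcQuantumGroupoid n⦄ (g : c ⟶ d) (_h : b ⟶ c)
    (_k : a ⟶ b) : ZMod 2 :=
  ((ArcQuantumGroupoid.parity g * C.splits c b a : ℤ) : ZMod 2)

/-- The sign `(-1) ^ φ_C`, where `φ_C` is the sum of a chronology-change sign exponent and the
commutation term. -/
noncomputable def associator (φch : (d c b a : CrossinglessMatching n) → ZMod 2)
    ⦃a b c d : ArcQuantumGroupoid n⦄ (g : c ⟶ d) (h : b ⟶ c) (k : a ⟶ b) : ℤˣ :=
  (-1) ^ (φch d c b a + C.commutationTerm g h k)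

end ChronologyChoice

/-! Multiplication. The exterior algebra on all points of a diagram maps onto `OF` of the diagram.
Lifted to it, a merge is multiplication by `1` and a split is multiplication by `tail - head`
(`OF.saddle_proj`), so a chronological cobordism is multiplication by a single element
(`SaddleFamily.eval_proj`). Both composites in part 1 send all lines of points to one line and
multiply by a product of two such elements. What has to be compared is thus the product of the same
saddle factors, for the arcs of `c` and `b` in `W(d)cW(c)bW(b)a`, taken in two orders.

Signs. It is not enough that some sign exists for each quadruple: where a composite vanishes the
sign is undetermined, but the associator must still be a cocycle. An explicit exponent `tau` is
therefore attached to every saddle. Colour the regions of the planar diagram black and white. A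
saddle in a black region contributes one odd piece, its place in a list of the black saddles. A
saddle that changes the number of white regions contributes another odd piece, `theta`, which
compares top forms on the sets of white regions before and after; a Koszul sign accounts for the
order of the two kinds of pieces. By planarity a black saddle changes the number of white regions
exactly when it is a merge, and a white saddle exactly when it is a split. So a split carries one
odd piece and a merge none or two. Hence signed splits, which anticommute as factors, become
interchangeable, and merges stay interchangeable with everything. In the square where two circles
are merged and split again by either order of two saddles, the two factors differ by the sign that
compares their arrows, and `tau` accounts for it (`total_merges_splits`). A split followed by a
merge in both orders gives zero twice. Any two admissible orders are related by such squares, which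
gives `signed_eq_of_perm`.

Planarity enters in two ways. Orientability of the circles is a statement about a permutation
multiplied by transpositions (`isSurgery_mul_swap`, `not_sameCycle_mul_swap_mul_swap`). The Jordan
curve property is a count, modulo `2`, of the points of a circle to the left of an interval
(`orbitSetoid_of_whiteSetoid`, `strip_isStrip`).

Cocycle. Let `w` be the number of white regions of a diagram `W(b)a` and `y` the number of black
arcs of a matching. Passing from the diagrams on two lines to those on four lines changes the
exponents only by such counts, so the sign `changeSign` of the change of chronology is a coboundary
plus an explicit polynomial in the `w` and `y`. Modulo `2`, the number of splits of `C_{cba}` is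
`y(b)` plus the coboundary of `w`, and the coboundary of `changeSign` turns out to be the product of
the numbers of splits of `C_{edc}` and `C_{cba}` (`changeSign_coboundary`). In `x(yz)` the element
`x` has to be moved past the factor of `C_{cba}`, whose degree is its number of splits; this
produces the commutation term. Exterior degrees add up under multiplication except for the number of
splits (`parity_comp`), and the number of splits is itself a cocycle because it is determined by
numbers of circles. So the coboundary of the commutation term is the same product, and the two
cancel. -/

/-! ### Gluing two classes of an equivalence relation -/

section Glue

variable {P : Type*}

/-- The equivalence relation obtained from `w` by uniting the classes of `p` and `t`. -/
def Setoid.glue (w : Setoid P) (p t : P) : Setoid P where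
  r x y := w x y ∨ (w x p ∧ w t y) ∨ (w x t ∧ w p y)
  iseqv := by
    refine ⟨fun x => Or.inl (w.refl' x), ?_, ?_⟩
    · rintro x y (h | ⟨h, h'⟩ | ⟨h, h'⟩)
      · exact Or.inl (w.symm' h)
      · exact Or.inr (Or.inr ⟨w.symm' h', w.symm' h⟩)
      · exact Or.inr (Or.inl ⟨w.symm' h', w.symm' h⟩)
    · rintro x y z (h | ⟨h, h'⟩ | ⟨h, h'⟩) (k | ⟨k, k'⟩ | ⟨k, k'⟩)
      · exact Or.inl (w.trans' h k)
      · exact Or.inr (Or.inl ⟨w.trans' h k, k'⟩)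
      · exact Or.inr (Or.inr ⟨w.trans' h k, k'⟩)
      · exact Or.inr (Or.inl ⟨h, w.trans' h' k⟩)
      · exact Or.inr (Or.inl ⟨h, k'⟩)
      · exact Or.inl (w.trans' h k')
      · exact Or.inr (Or.inr ⟨h, w.trans' h' k⟩)
      · exact Or.inl (w.trans' h k')
      · exact Or.inr (Or.inr ⟨h, k'⟩)

namespace Setoid

theorem le_glue (w : Setoid P) (p t : P) : w ≤ w.glue p t := fun _ _ h => Or.inl h

theorem glue_rel (w : Setoid P) (p t : P) : w.glue p t p t :=
  Or.inr (Or.inl ⟨w.refl' p, w.refl' t⟩)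

theorem glue_le {w s : Setoid P} {p t : P} (h : w ≤ s) (hs : s p t) : w.glue p t ≤ s := by
  rintro x y (k | ⟨k, k'⟩ | ⟨k, k'⟩)
  · exact h k
  · exact s.trans' (h k) (s.trans' hs (h k'))
  · exact s.trans' (h k) (s.trans' (s.symm' hs) (h k'))

theorem glue_mono {w s : Setoid P} (h : w ≤ s) (p t : P) : w.glue p t ≤ s.glue p t :=
  glue_le (h.trans (le_glue _ _ _)) (glue_rel _ _ _)

theorem glue_eq_self {w : Setoid P} {p t : P} (h : w p t) : w.glue p t = w :=
  le_antisymm (glue_le le_rfl h) (le_glue _ _ _)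

theorem glue_congr {w : Setoid P} {p t p' t' : P} (hp : w p p') (ht : w t t') :
    w.glue p t = w.glue p' t' :=
  le_antisymm
    (glue_le (le_glue _ _ _) (Or.inr (Or.inl ⟨hp, w.symm' ht⟩)))
    (glue_le (le_glue _ _ _) (Or.inr (Or.inl ⟨w.symm' hp, ht⟩)))

theorem glue_swap (w : Setoid P) (p t : P) : w.glue p t = w.glue t p :=
  le_antisymm (glue_le (le_glue _ _ _) (Setoid.symm' _ (glue_rel _ _ _)))
    (glue_le (le_glue _ _ _) (Setoid.symm' _ (glue_rel _ _ _)))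

/-- Every class of the glued relation contains exactly one class of `w` other than that of `t`. -/
theorem card_quotient_glue [Finite P] {w : Setoid P} {p t : P} (h : ¬ w p t) :
    Nat.card (Quotient (w.glue p t)) + 1 = Nat.card (Quotient w) := by
  classical
  have := Fintype.ofFinite (Quotient w)
  let f : {c : Quotient w // c ≠ Quotient.mk w t} → Quotient (w.glue p t) :=
    fun c => Quotient.map' (s₁ := w) (s₂ := w.glue p t) id (fun _ _ h => Or.inl h) c.1
  have hf : Function.Bijective f := by
    constructor
    · rintro ⟨⟨x⟩, hx⟩ ⟨⟨y⟩, hy⟩ hxy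
      have hx' : ¬ w x t := fun hx' => hx (Quotient.sound hx')
      have hy' : ¬ w y t := fun hy' => hy (Quotient.sound hy')
      rcases (Quotient.exact hxy : w.glue p t x y) with k | ⟨k, k'⟩ | ⟨k, k'⟩
      · exact Subtype.ext (Quotient.sound k)
      · exact absurd (w.symm' k') hy'
      · exact absurd k hx'
    · rintro ⟨x⟩
      by_cases hx : w x t
      · exact ⟨⟨Quotient.mk w p, fun hp => h (Quotient.exact hp)⟩,
          Quotient.sound (Or.inr (Or.inl ⟨w.refl' p, w.symm' hx⟩))⟩
      · exact ⟨⟨Quotient.mk w x, fun hp => hx (Quotient.exact hp)⟩, rfl⟩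
  rw [← Nat.card_congr (Equiv.ofBijective f hf), Nat.card_eq_fintype_card,
    Nat.card_eq_fintype_card, Fintype.card_subtype_compl, Fintype.card_subtype_eq]
  have : 0 < Fintype.card (Quotient w) := Fintype.card_pos_iff.2 ⟨Quotient.mk w t⟩
  omega

/-- Each of `w` and `w'` is contained in the other one up to uniting the classes of `p` and `t`,
and exactly one of them relates `p` and `t`. -/
structure IsSurgery (w w' : Setoid P) (p t : P) : Prop where
  le : w ≤ w'.glue p t
  ge : w' ≤ w.glue p t
  rel_iff : w p t ↔ ¬ w' p t

namespace IsSurgery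

variable {w w' : Setoid P} {p t : P}

theorem symm (h : IsSurgery w w' p t) : IsSurgery w' w p t :=
  ⟨h.ge, h.le, by have := h.rel_iff; tauto⟩

/-- Gluing does nothing to the side that already relates `p` and `t`, so the two inclusions become
an equality. Thus a surgery is either a merge or a split. -/
theorem eq_glue (h : IsSurgery w w' p t) (hw : ¬ w p t) : w' = w.glue p t :=
  le_antisymm h.ge (glue_le
    (h.le.trans_eq (glue_eq_self (by have := h.rel_iff; tauto))) (by have := h.rel_iff; tauto))

theorem eq_glue' (h : IsSurgery w w' p t) (hw : w p t) : w = w'.glue p t :=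
  h.symm.eq_glue (h.rel_iff.1 hw)

/-- Needed for white regions: the union of regions is first seen inside the strips, and `s` then
adds the connections outside them. After adding `s`, the points `p` and `t` may already be related,
and gluing them is then harmless. -/
theorem sup (h : IsSurgery w w' p t) (hw : ¬ w p t) (s : Setoid P) :
    w' ⊔ s = (w ⊔ s).glue p t := by
  rw [h.eq_glue hw]
  apply le_antisymm
  · exact sup_le (glue_mono le_sup_left _ _) (le_sup_right.trans (le_glue _ _ _))
  · refine glue_le (sup_le_sup_right (le_glue _ _ _) _) ?_
    exact (le_sup_left : w.glue p t ≤ w.glue p t ⊔ s) (glue_rel _ _ _)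

end IsSurgery

end Setoid

end Glue

/-! ### Cycles of a permutation multiplied by a transposition -/

namespace Equiv.Perm

variable {α : Type*}

theorem sameCycle_setoid_le {σ : Perm α} {s : Setoid α} (h : ∀ a, s a (σ a)) :
    SameCycle.setoid σ ≤ s := by
  rintro x y ⟨k, rfl⟩
  induction k using Int.induction_on with
  | zero => exact s.refl' _
  | succ k ih =>
    rw [add_comm, zpow_add, zpow_one]
    exact s.trans' ih (h _)
  | pred k ih =>
    refine s.trans' ih (s.symm' ?_)
    have := h ((σ ^ (-(k : ℤ) - 1)) x)
    rwa [← mul_apply, ← zpow_one_add, add_sub_cancel] at this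

/-- A step of `σ` from `a` is a step of `σ * swap x y` from `swap x y a`, and the swap only moves
points between the two glued classes. -/
theorem sameCycle_le_glue_mul_swap [DecidableEq α] (σ : Perm α) (x y : α) :
    SameCycle.setoid σ ≤ (SameCycle.setoid (σ * swap x y)).glue x y := by
  refine sameCycle_setoid_le fun a => ?_
  have key : ∀ b, (SameCycle.setoid (σ * swap x y)).glue x y b (σ (swap x y b)) := fun b =>
    Or.inl ⟨1, by simp⟩
  by_cases hx : a = x
  · subst hx
    exact Setoid.trans' _ (Setoid.glue_rel _ _ _) (by simpa using key y)
  · by_cases hy : a = y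
    · subst hy
      exact Setoid.trans' _ (Setoid.symm' _ (Setoid.glue_rel _ _ _)) (by simpa using key x)
    · have := key a
      rwa [swap_apply_of_ne_of_ne hx hy] at this

/-- Both cycle relations become equal after gluing `x` and `y`. If both or neither related `x` and
`y`, the numbers of cycles would coincide; but the sign of the permutation changes, and with it the
parity of the number of cycles. -/
theorem isSurgery_mul_swap [Fintype α] [DecidableEq α] (σ : Perm α) {x y : α} (hxy : x ≠ y) :
    (SameCycle.setoid σ).IsSurgery (SameCycle.setoid (σ * swap x y)) x y := by
  have h1 := sameCycle_le_glue_mul_swap σ x y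
  have h2 := sameCycle_le_glue_mul_swap (σ * swap x y) x y
  rw [mul_assoc, swap_mul_self, mul_one] at h2
  refine ⟨h1, h2, ?_⟩
  have hg : (SameCycle.setoid σ).glue x y = (SameCycle.setoid (σ * swap x y)).glue x y :=
    le_antisymm (Setoid.glue_le h1 (Setoid.glue_rel _ _ _))
      (Setoid.glue_le h2 (Setoid.glue_rel _ _ _))
  have hs : sign (σ * swap x y) = - sign σ := by rw [sign_mul, sign_swap hxy, mul_neg_one]
  rw [CrossinglessMatching.sign_eq_card_orbits, CrossinglessMatching.sign_eq_card_orbits] at hs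
  have hne : Nat.card (Quotient (SameCycle.setoid σ)) ≠
      Nat.card (Quotient (SameCycle.setoid (σ * swap x y))) := fun h => by
    rw [h] at hs
    have := (Int.isUnit_iff.1 ((-1 : ℤˣ) ^ (Fintype.card α + Nat.card (Quotient
      (SameCycle.setoid (σ * swap x y))))).isUnit)
    have h3 := congrArg Units.val hs
    rw [Units.val_neg] at h3
    omega
  constructor
  · intro h h'
    apply hne
    rw [← Setoid.glue_eq_self h, hg, Setoid.glue_eq_self h']
  · intro h'
    by_contra h
    apply hne
    rw [← Setoid.card_quotient_glue h, hg, Setoid.card_quotient_glue h']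

/-- If `x, x'` lie on one cycle and `y, y'` on another one, then `x` and `x'` are separated by
multiplication by the two transpositions. -/
theorem not_sameCycle_mul_swap_mul_swap [Fintype α] [DecidableEq α] {σ : Perm α} {x y x' y' : α}
    (hx : σ.SameCycle x x') (hy : σ.SameCycle y y') (hxy : ¬ σ.SameCycle x y) (hxx : x ≠ x') :
    ¬ (σ * swap x y * swap x' y').SameCycle x x' := by
  intro h
  have hxy' : ¬ σ.SameCycle x y' := fun k => hxy (k.trans hy.symm)
  have hx'y : ¬ σ.SameCycle x' y := fun k => hxy (hx.trans k)
  have hx'y' : ¬ σ.SameCycle x' y' := fun k => hxy' (hx.trans k)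
  have n1 : x ≠ y := fun k => hxy (k ▸ SameCycle.refl _ _)
  have n2 : x ≠ y' := fun k => hxy' (k ▸ SameCycle.refl _ _)
  have n3 : x' ≠ y := fun k => hx'y (k ▸ SameCycle.refl _ _)
  have n4 : x' ≠ y' := fun k => hx'y' (k ▸ SameCycle.refl _ _)
  -- After one more transposition the product can be rewritten so that it first separates `x` from
  -- `x'`, then attaches the piece of `x'` to the cycle of `y` and `y'`, and finally attaches the
  -- piece of `x` there too. So `x` and `x'` end up together, and by `s4` they were apart before the
  -- additional transposition.
  have e : σ * swap x y * swap x' y' * swap x x' = σ * swap x x' * swap x' y * swap x y' := by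
    have a1 : swap x' y' * swap x x' = swap x x' * swap x y' := by
      rw [swap_mul_eq_mul_swap, swap_inv, swap_apply_right, swap_apply_of_ne_of_ne n2.symm n4.symm]
    have a2 : swap x y * swap x x' = swap x x' * swap x' y := by
      rw [swap_mul_eq_mul_swap, swap_inv, swap_apply_left, swap_apply_of_ne_of_ne n1.symm n3.symm]
    rw [mul_assoc _ (swap x' y'), a1, ← mul_assoc, mul_assoc σ, a2, ← mul_assoc]
  have s1 := isSurgery_mul_swap σ hxx
  have s2 := isSurgery_mul_swap (σ * swap x x') n3
  have s3 := isSurgery_mul_swap (σ * swap x x' * swap x' y) n2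
  have s4 := isSurgery_mul_swap (σ * swap x y * swap x' y') hxx
  rw [e] at s4
  generalize SameCycle.setoid (σ * swap x x' * swap x' y * swap x y') = w3 at *
  generalize SameCycle.setoid (σ * swap x x' * swap x' y) = w2 at *
  generalize SameCycle.setoid (σ * swap x x') = w1 at *
  have e0 := s1.eq_glue' hx
  have le10 : ∀ {a b}, w1 a b → σ.SameCycle a b := fun {a b} k => by
    have : w1.glue x x' a b := Or.inl k
    rw [← e0] at this; exact this
  have hyy : w1 y y' := by
    have : w1.glue x x' y y' := by rw [← e0]; exact hy
    rcases this with k | ⟨k, _⟩ | ⟨k, _⟩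
    · exact k
    · exact absurd (le10 k).symm hxy
    · exact absurd (le10 k).symm hx'y
  have e2 := s2.eq_glue fun k => hx'y (le10 k)
  have h2 : ¬ w2 x y' := by
    rw [e2]
    rintro (k | ⟨k, _⟩ | ⟨k, _⟩)
    · exact hxy' (le10 k)
    · exact s1.rel_iff.1 hx k
    · exact hxy (le10 k)
  have e3 := s3.eq_glue h2
  refine s4.rel_iff.1 h ?_
  rw [e3]
  refine Or.inr (Or.inl ⟨w2.refl' _, ?_⟩)
  rw [e2]
  exact Setoid.trans' _ (Or.inl (w1.symm' hyy)) (Setoid.symm' _ (Setoid.glue_rel _ _ _))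

end Equiv.Perm


/-! ### Circles of a pair of matchings -/

section Involutions

variable {P : Type*}

/-- The equivalence relation generated by two maps; for two matchings its classes are circles. -/
def orbitSetoid (M O : P → P) : Setoid P :=
  Relation.EqvGen.setoid fun i j => j = M i ∨ j = O i

theorem orbitSetoid_left (M O : P → P) (x : P) : orbitSetoid M O x (M x) :=
  Relation.EqvGen.rel _ _ (Or.inl rfl)

theorem orbitSetoid_right (M O : P → P) (x : P) : orbitSetoid M O x (O x) :=
  Relation.EqvGen.rel _ _ (Or.inr rfl)

theorem orbitSetoid_le {M O : P → P} {s : Setoid P} (hM : ∀ x, s x (M x)) (hO : ∀ x, s x (O x)) :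
    orbitSetoid M O ≤ s :=
  Setoid.eqvGen_le (by rintro x y (rfl | rfl); exacts [hM x, hO x])

/-- A fixed-point-free involution that exchanges the two colours of the points. -/
structure IsParityMatching (ε : P → Bool) (M : P → P) : Prop where
  invol : ∀ x, M (M x) = x
  flip : ∀ x, ε (M x) = !ε x

/-- The permutation of the points of one colour whose cycles are the circles. -/
def circlePerm {ε : P → Bool} {M O : P → P} (hM : IsParityMatching ε M)
    (hO : IsParityMatching ε O) : Equiv.Perm {x // ε x = true} where
  toFun x := ⟨O (M x), by rw [hO.flip, hM.flip, x.2]; rfl⟩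
  invFun x := ⟨M (O x), by rw [hM.flip, hO.flip, x.2]; rfl⟩
  left_inv x := by ext; simp [hM.invol, hO.invol]
  right_inv x := by ext; simp [hM.invol, hO.invol]

/-- Colours alternate along a circle, so two steps along it return to the same colour; following the
circle from a point of colour `true` is iterating `circlePerm`. -/
theorem orbitSetoid_iff_sameCycle {ε : P → Bool} {M O : P → P} (hM : IsParityMatching ε M)
    (hO : IsParityMatching ε O) (x y : {x // ε x = true}) :
    orbitSetoid M O x y ↔ (circlePerm hM hO).SameCycle x y := by
  constructor
  · intro h
    -- Points of the other colour are represented by their partners under `M`.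
    let g : P → {x // ε x = true} := fun x =>
      if hx : ε x = true then ⟨x, hx⟩ else ⟨M x, by rw [hM.flip]; simpa using hx⟩
    have hg : ∀ x : {x // ε x = true}, g x = x := fun x => by simp [g, x.2]
    have key : orbitSetoid M O ≤ (Equiv.Perm.SameCycle.setoid (circlePerm hM hO)).comap g := by
      refine orbitSetoid_le (fun x => ?_) (fun x => ?_)
      · change (circlePerm hM hO).SameCycle (g x) (g (M x))
        refine ⟨0, ?_⟩
        rcases hx : ε x <;> simp [g, hx, hM.flip, hM.invol]
      · change (circlePerm hM hO).SameCycle (g x) (g (O x))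
        rcases hx : ε x
        · refine ⟨1, ?_⟩
          simp [g, hx, hO.flip, circlePerm, hM.invol]
        · refine ⟨-1, ?_⟩
          simp only [g, hx, hO.flip, dif_pos, zpow_neg, zpow_one, Bool.not_true]
          rfl
    have := key h
    change (circlePerm hM hO).SameCycle (g x) (g y) at this
    rwa [hg, hg] at this
  · intro h
    have : Equiv.Perm.SameCycle.setoid (circlePerm hM hO) ≤
        (orbitSetoid M O).comap Subtype.val :=
      Equiv.Perm.sameCycle_setoid_le fun a => Setoid.trans' (orbitSetoid M O)
        (orbitSetoid_left M O a) (orbitSetoid_right M O (M a))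
    exact this h

/-- The matching `M'` arises from `M` by replacing the pairs `{p, M p}` and `{t, M t}` by
`{p, M t}` and `{t, M p}`. -/
structure IsExchange (M M' : P → P) (p t : P) : Prop where
  left : M' p = M t
  right : M' t = M p
  other : ∀ x, x ≠ p → x ≠ t → x ≠ M p → x ≠ M t → M' x = M x

theorem IsExchange.symm {M M' : P → P} {p t : P} (h : IsExchange M M' p t) : IsExchange M' M p t :=
  ⟨h.right.symm, h.left.symm, fun x h1 h2 h3 h4 =>
    (h.other x h1 h2 (fun k => h4 (k.trans h.right.symm))
      (fun k => h3 (k.trans h.left.symm))).symm⟩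

/-- `M'` joins `p` to `M t` and `t` to `M p`, so once `p` and `t` are glued all four ends lie in one
class. -/
theorem IsExchange.le_glue {ε : P → Bool} {M M' O : P → P} {p t : P} (hM : IsParityMatching ε M)
    (h : IsExchange M M' p t) :
    orbitSetoid M O ≤ (orbitSetoid M' O).glue p t := by
  have hp : (orbitSetoid M' O).glue p t p (M p) :=
    Setoid.trans' _ (Setoid.glue_rel _ _ _) (Or.inl (h.right ▸ orbitSetoid_left M' O t))
  have ht : (orbitSetoid M' O).glue p t t (M t) :=
    Setoid.trans' _ (Setoid.symm' _ (Setoid.glue_rel _ _ _))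
      (Or.inl (h.left ▸ orbitSetoid_left M' O p))
  refine orbitSetoid_le (fun x => ?_) (fun x => Or.inl (orbitSetoid_right _ _ _))
  by_cases h1 : x = p
  · rw [h1]; exact hp
  by_cases h2 : x = t
  · rw [h2]; exact ht
  by_cases h3 : x = M p
  · rw [h3, hM.invol]; exact Setoid.symm' _ hp
  by_cases h4 : x = M t
  · rw [h4, hM.invol]; exact Setoid.symm' _ ht
  rw [← h.other x h1 h2 h3 h4]
  exact Or.inl (orbitSetoid_left _ _ _)

/-- The exchange interchanges the partners of `p` and `t`. The other two affected points, `M p` and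
`M t`, have the opposite colour and are invisible to the permutation. -/
theorem IsExchange.circlePerm_eq [DecidableEq P] {ε : P → Bool} {M M' O : P → P}
    {p t : {x // ε x = true}} (hM : IsParityMatching ε M) (hM' : IsParityMatching ε M')
    (hO : IsParityMatching ε O) (h : IsExchange M M' p t) :
    circlePerm hM' hO = circlePerm hM hO * Equiv.swap p t := by
  ext x
  change O (M' x) = O (M (Equiv.swap p t x))
  congr 1
  by_cases h1 : x = p
  · rw [h1, Equiv.swap_apply_left, h.left]
  by_cases h2 : x = t
  · rw [h2, Equiv.swap_apply_right, h.right]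
  rw [Equiv.swap_apply_of_ne_of_ne h1 h2]
  have key : ∀ y : {x // ε x = true}, (x : P) ≠ M y := fun y k => by
    have := hM.flip y
    rw [← k, x.2, y.2] at this
    simp at this
  exact h.other x (fun k => h1 (Subtype.ext k)) (fun k => h2 (Subtype.ext k)) (key p) (key t)

theorem IsExchange.isSurgery [Finite P] {ε : P → Bool} {M M' O : P → P} {p t : P}
    (hM : IsParityMatching ε M) (hM' : IsParityMatching ε M') (hO : IsParityMatching ε O)
    (h : IsExchange M M' p t) (hpt : p ≠ t) (hp : ε p = true) (ht : ε t = true) :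
    (orbitSetoid M O).IsSurgery (orbitSetoid M' O) p t := by
  classical
  have := Fintype.ofFinite P
  refine ⟨h.le_glue hM, h.symm.le_glue hM', ?_⟩
  rw [orbitSetoid_iff_sameCycle hM hO ⟨p, hp⟩ ⟨t, ht⟩,
    orbitSetoid_iff_sameCycle hM' hO ⟨p, hp⟩ ⟨t, ht⟩,
    IsExchange.circlePerm_eq (p := ⟨p, hp⟩) (t := ⟨t, ht⟩) hM hM' hO h]
  exact (Equiv.Perm.isSurgery_mul_swap _ (by simpa using hpt)).rel_iff

/-- This is the orientability needed for two saddles between the same two circles: the first merges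
them, and the second splits the result so that the ends on one of the old circles are separated. -/
theorem IsExchange.not_orbitSetoid [Finite P] {ε : P → Bool} {M M' M'' O : P → P}
    {p t p' t' : P} (hM : IsParityMatching ε M) (hM' : IsParityMatching ε M')
    (hM'' : IsParityMatching ε M'') (hO : IsParityMatching ε O)
    (h : IsExchange M M' p t) (h' : IsExchange M' M'' p' t')
    (hp : ε p = true) (ht : ε t = true) (hp' : ε p' = true) (ht' : ε t' = true)
    (hpp : orbitSetoid M O p p') (htt : orbitSetoid M O t t') (hpt : ¬ orbitSetoid M O p t)
    (hne : p ≠ p') : ¬ orbitSetoid M'' O p p' := by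
  classical
  have := Fintype.ofFinite P
  rw [orbitSetoid_iff_sameCycle hM hO ⟨p, hp⟩ ⟨p', hp'⟩] at hpp
  rw [orbitSetoid_iff_sameCycle hM hO ⟨p, hp⟩ ⟨t, ht⟩] at hpt
  rw [orbitSetoid_iff_sameCycle hM hO ⟨t, ht⟩ ⟨t', ht'⟩] at htt
  rw [orbitSetoid_iff_sameCycle hM'' hO ⟨p, hp⟩ ⟨p', hp'⟩,
    IsExchange.circlePerm_eq (p := ⟨p', hp'⟩) (t := ⟨t', ht'⟩) hM' hM'' hO h',
    IsExchange.circlePerm_eq (p := ⟨p, hp⟩) (t := ⟨t, ht⟩) hM hM' hO h]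
  exact Equiv.Perm.not_sameCycle_mul_swap_mul_swap hpp htt hpt (by simpa using hne)

end Involutions


/-! ### Signs of unions of classes -/

section Theta

variable {P : Type*}

/-- The least rank of the points of the class of `x`. -/
noncomputable def minRank (rk : P → ℕ) (w : Setoid P) (x : P) : ℕ := sInf (rk '' {y | w x y})

theorem exists_minRank (rk : P → ℕ) (w : Setoid P) (x : P) : ∃ y, w x y ∧ rk y = minRank rk w x :=
  Nat.sInf_mem (s := rk '' {y | w x y}) ⟨_, x, w.refl' x, rfl⟩

theorem minRank_le {rk : P → ℕ} {w : Setoid P} {x y : P} (h : w x y) : minRank rk w x ≤ rk y :=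
  Nat.sInf_le ⟨y, h, rfl⟩

theorem minRank_eq {rk : P → ℕ} {w : Setoid P} {x y : P} (h : w x y)
    (hy : ∀ z, w x z → rk y ≤ rk z) : minRank rk w x = rk y := by
  obtain ⟨z, hz, e⟩ := exists_minRank rk w x
  exact le_antisymm (minRank_le h) (e ▸ hy z hz)

theorem minRank_congr {rk : P → ℕ} {w : Setoid P} {x y : P} (h : w x y) :
    minRank rk w x = minRank rk w y := by
  unfold minRank
  congr 2
  ext z
  exact ⟨fun k => w.trans' (w.symm' h) k, fun k => w.trans' h k⟩

theorem minRank_eq_iff {rk : P → ℕ} (hrk : Function.Injective rk) {w : Setoid P} {x y : P} :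
    minRank rk w x = minRank rk w y ↔ w x y := by
  refine ⟨fun h => ?_, minRank_congr⟩
  obtain ⟨x', hx, ex⟩ := exists_minRank rk w x
  obtain ⟨y', hy, ey⟩ := exists_minRank rk w y
  have : x' = y' := hrk (by rw [ex, ey, h])
  exact w.trans' hx (w.symm' (this ▸ hy))

open scoped Classical in
theorem minRank_glue {rk : P → ℕ} (hrk : Function.Injective rk) (w : Setoid P) (p t x : P) :
    minRank rk (w.glue p t) x =
      if minRank rk w x = minRank rk w p ∨ minRank rk w x = minRank rk w t then
        min (minRank rk w p) (minRank rk w t) else minRank rk w x := by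
  have key : minRank rk (w.glue p t) p = min (minRank rk w p) (minRank rk w t) := by
    obtain ⟨p', hp, ep⟩ := exists_minRank rk w p
    obtain ⟨t', ht, et⟩ := exists_minRank rk w t
    rw [← ep, ← et]
    rcases le_total (rk p') (rk t') with h | h
    · rw [min_eq_left h]
      refine minRank_eq (Or.inl hp) ?_
      rintro z (k | ⟨_, k⟩ | ⟨_, k⟩)
      · exact ep ▸ minRank_le k
      · exact h.trans (et ▸ minRank_le k)
      · exact ep ▸ minRank_le k
    · rw [min_eq_right h]
      refine minRank_eq (Or.inr (Or.inl ⟨w.refl' _, ht⟩)) ?_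
      rintro z (k | ⟨_, k⟩ | ⟨_, k⟩)
      · exact h.trans (ep ▸ minRank_le k)
      · exact et ▸ minRank_le k
      · exact h.trans (ep ▸ minRank_le k)
  split_ifs with h
  · rw [← key]
    refine minRank_congr ?_
    rcases h with h | h
    · exact Or.inl ((minRank_eq_iff hrk).1 h)
    · exact Setoid.trans' _ (Or.inl ((minRank_eq_iff hrk).1 h))
        (Setoid.symm' _ (Setoid.glue_rel _ _ _))
  · rw [not_or, minRank_eq_iff hrk, minRank_eq_iff hrk] at h
    obtain ⟨x', hx, ex⟩ := exists_minRank rk w x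
    rw [← ex]
    refine minRank_eq (Or.inl hx) ?_
    rintro z (k | ⟨k, _⟩ | ⟨k, _⟩)
    · exact ex ▸ minRank_le k
    · exact absurd k h.1
    · exact absurd k h.2

/-- The set of the least ranks of the classes. -/
def minRanks (rk : P → ℕ) (w : Setoid P) : Set ℕ := Set.range (minRank rk w)

open scoped Classical in
/-- The number, modulo `2`, of classes whose least rank is less than `k`. -/
noncomputable def countBelow (rk : P → ℕ) (w : Setoid P) (k : ℕ) : ZMod 2 :=
  ((Finset.range k).filter (· ∈ minRanks rk w)).card

theorem mem_minRanks_glue {rk : P → ℕ} (hrk : Function.Injective rk) {w : Setoid P} {p t : P}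
    (h : ¬ w p t) (v : ℕ) :
    v ∈ minRanks rk (w.glue p t) ↔
      v ∈ minRanks rk w ∧ v ≠ max (minRank rk w p) (minRank rk w t) := by
  have hne : minRank rk w p ≠ minRank rk w t := fun k => h ((minRank_eq_iff hrk).1 k)
  constructor
  · rintro ⟨x, rfl⟩
    rw [minRank_glue hrk]
    split_ifs with hx
    · refine ⟨?_, fun k => hne (by omega)⟩
      rcases min_choice (minRank rk w p) (minRank rk w t) with k | k <;> rw [k]
      exacts [⟨p, rfl⟩, ⟨t, rfl⟩]
    · refine ⟨⟨x, rfl⟩, fun k => hx ?_⟩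
      rcases max_choice (minRank rk w p) (minRank rk w t) with k' | k' <;> rw [k'] at k
      exacts [Or.inl k, Or.inr k]
  · rintro ⟨⟨x, rfl⟩, hx⟩
    refine ⟨x, ?_⟩
    rw [minRank_glue hrk]
    split_ifs with k
    · omega
    · rfl

open scoped Classical in
theorem countBelow_glue {rk : P → ℕ} (hrk : Function.Injective rk) {w : Setoid P} {p t : P}
    (h : ¬ w p t) (k : ℕ) :
    countBelow rk (w.glue p t) k =
      countBelow rk w k + if max (minRank rk w p) (minRank rk w t) < k then 1 else 0 := by
  unfold countBelow
  have e : (Finset.range k).filter (· ∈ minRanks rk (w.glue p t)) =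
      ((Finset.range k).filter (· ∈ minRanks rk w)).erase
        (max (minRank rk w p) (minRank rk w t)) := by
    ext v
    simp only [Finset.mem_filter, Finset.mem_erase, mem_minRanks_glue hrk h]
    tauto
  rw [e]
  split_ifs with hk
  · have hm : max (minRank rk w p) (minRank rk w t) ∈
        (Finset.range k).filter (· ∈ minRanks rk w) := by
      rw [Finset.mem_filter, Finset.mem_range]
      refine ⟨hk, ?_⟩
      rcases max_choice (minRank rk w p) (minRank rk w t) with k' | k' <;> rw [k']
      exacts [⟨p, rfl⟩, ⟨t, rfl⟩]
    rw [← Finset.card_erase_add_one hm]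
    push_cast
    rw [add_assoc, CharTwo.add_self_eq_zero, add_zero]
  · rw [Finset.erase_eq_of_notMem (fun hm => hk (by simpa using (Finset.mem_filter.1 hm).1)),
      add_zero]

open scoped Classical in
/-- The sign exponent of the union of the classes of `p` and `t`, oriented from `p` to `t`. -/
noncomputable def theta (rk : P → ℕ) (w : Setoid P) (p t : P) : ZMod 2 :=
  countBelow rk w (max (minRank rk w p) (minRank rk w t)) +
    if minRank rk w t < minRank rk w p then 1 else 0

theorem theta_congr {rk : P → ℕ} {w : Setoid P} {p t p' t' : P} (hp : w p p') (ht : w t t') :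
    theta rk w p t = theta rk w p' t' := by
  rw [theta, theta, minRank_congr hp, minRank_congr ht]

theorem theta_swap {rk : P → ℕ} (hrk : Function.Injective rk) {w : Setoid P} {p t : P}
    (h : ¬ w p t) : theta rk w t p = theta rk w p t + 1 := by
  have hne : minRank rk w p ≠ minRank rk w t := fun k => h ((minRank_eq_iff hrk).1 k)
  rw [theta, theta, max_comm, add_assoc]
  congr 1
  rcases lt_or_gt_of_ne hne with k | k
  · rw [if_pos k, if_neg k.not_gt, zero_add]
  · rw [if_pos k, if_neg k.not_gt, CharTwo.add_self_eq_zero]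

/-- Order the classes by least rank and wedge them together. Then `(-1) ^ theta` is the sign
relating `(t - p) ∧` (top form of the glued relation) to the top form of `w`: the glued relation
lacks the class with the larger least rank, and the sign records its position and the direction of
the arrow. The summand `1` is the anticommutation of `t - p` and `t' - p'`. -/
theorem theta_add_theta_glue {rk : P → ℕ} (hrk : Function.Injective rk) {w : Setoid P}
    {p t p' t' : P} (h : ¬ w p t) (h' : ¬ w.glue p t p' t') :
    theta rk w p t + theta rk (w.glue p t) p' t' =
      theta rk w p' t' + theta rk (w.glue p' t') p t + 1 := by
  have h2 : ¬ w p' t' := fun k => h' (Or.inl k)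
  have h3 : ¬ w.glue p' t' p t := fun k => h' <| by
    rcases k with k | ⟨k, k'⟩ | ⟨k, k'⟩
    · exact absurd k h
    · exact Or.inr (Or.inl ⟨w.symm' k, w.symm' k'⟩)
    · exact Or.inr (Or.inr ⟨k', k⟩)
  -- Reversing an arrow adds `1` to one term on each side, so both arrows may be taken to point to
  -- the class of larger least rank.
  wlog hlt : minRank rk w p < minRank rk w t generalizing p t
  · have hne : minRank rk w p ≠ minRank rk w t := fun k => h ((minRank_eq_iff hrk).1 k)
    have := this (p := t) (t := p) (fun k => h (w.symm' k))
      (by rwa [Setoid.glue_swap]) (fun k => h3 (Setoid.symm' _ k)) (by omega)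
    rw [theta_swap hrk h, theta_swap hrk h3, Setoid.glue_swap w t p] at this
    linear_combination this
  wlog hlt' : minRank rk w p' < minRank rk w t' generalizing p' t'
  · have hne : minRank rk w p' ≠ minRank rk w t' := fun k => h2 ((minRank_eq_iff hrk).1 k)
    have := this (p' := t') (t' := p') (fun k => h2 (w.symm' k))
      (fun k => h' (Setoid.symm' _ k)) (by rwa [Setoid.glue_swap])  (by omega)
    rw [theta_swap hrk h2, theta_swap hrk h', Setoid.glue_swap w t' p'] at this
    linear_combination this
  have e1 : ¬ minRank rk (w.glue p t) p' = minRank rk (w.glue p t) t' :=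
    fun k => h' ((minRank_eq_iff hrk).1 k)
  have e2 : ¬ minRank rk (w.glue p' t') p = minRank rk (w.glue p' t') t :=
    fun k => h3 ((minRank_eq_iff hrk).1 k)
  simp only [theta, countBelow_glue hrk h, countBelow_glue hrk h2]
  rw [minRank_glue hrk, minRank_glue hrk] at e1 e2
  simp only [minRank_glue hrk]
  generalize minRank rk w p = a at *
  generalize minRank rk w t = b at *
  generalize minRank rk w p' = a' at *
  generalize minRank rk w t' = b' at *
  generalize countBelow rk w = c at *
  have two : (1 : ZMod 2) + 1 = 0 := by decide
  rw [max_eq_right hlt.le, max_eq_right hlt'.le]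
  rw [min_eq_left hlt.le] at *
  rw [min_eq_left hlt'.le] at *
  rw [if_neg hlt.not_gt, if_neg hlt'.not_gt]
  -- Only the relative order of four least ranks is left; `e1` and `e2` exclude the coincidences in
  -- which the second gluing would be trivial.
  grind

end Theta


/-! ### The exterior algebra on the points of a diagram -/

/-- The exterior algebra of the free abelian group on a set of points; it is mapped onto `OF(S)`
by sending each point to its circle. -/
abbrev PointAlgebra (P : Type) : Type := ExteriorAlgebra ℤ (P →₀ ℤ)

namespace PointAlgebra

variable {P Q R : Type}

/-- The generator given by a point. -/
noncomputable def pt (p : P) : PointAlgebra P := ExteriorAlgebra.ι ℤ (Finsupp.single p 1)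

/-- The algebra map induced by a map of points. -/
noncomputable def map (f : P → Q) : PointAlgebra P →ₐ[ℤ] PointAlgebra Q :=
  ExteriorAlgebra.map (Finsupp.lmapDomain ℤ ℤ f)

/-- The algebra map which replaces each point by its circle. -/
noncomputable def proj (r : Setoid P) : PointAlgebra P →ₐ[ℤ] OF r :=
  ExteriorAlgebra.map (Finsupp.lmapDomain ℤ ℤ (Quotient.mk r))

@[simp] theorem map_pt (f : P → Q) (p : P) : map f (pt p) = pt (f p) := by
  simp [map, pt]

@[simp] theorem proj_pt (r : Setoid P) (p : P) : proj r (pt p) = OF.gen r p := by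
  simp [proj, pt, OF.gen]

theorem hom_ext {N : Type*} [AddCommGroup N] {f g : PointAlgebra P →ₐ[ℤ] ExteriorAlgebra ℤ N}
    (h : ∀ p, f (pt p) = g (pt p)) : f = g := by
  refine ExteriorAlgebra.hom_ext (LinearMap.ext fun m => ?_)
  change f (ExteriorAlgebra.ι ℤ m) = g (ExteriorAlgebra.ι ℤ m)
  induction m using Finsupp.induction_linear with
  | zero => simp
  | add a b ha hb => rw [map_add, map_add, map_add, ha, hb]
  | single p c =>
    have hs : Finsupp.single p c = c • Finsupp.single p (1 : ℤ) := by simp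
    rw [hs, map_zsmul, map_zsmul, map_zsmul]
    exact congrArg (c • ·) (h p)

theorem map_map (f : P → Q) (g : Q → R) (x : PointAlgebra P) :
    map g (map f x) = map (g ∘ f) x := by
  have : (map g).comp (map f) = map (g ∘ f) := hom_ext fun p => by simp
  exact DFunLike.congr_fun this x

@[simp] theorem map_id (x : PointAlgebra P) : map id x = x := by
  have : map (id : P → P) = AlgHom.id ℤ _ := hom_ext fun p => by simp
  rw [this]; rfl

theorem proj_surjective (r : Setoid P) : Function.Surjective (proj r) := by
  have h : Function.Surjective (Finsupp.lmapDomain ℤ ℤ (Quotient.mk r)) :=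
    Finsupp.mapDomain_surjective Quotient.mk_surjective
  exact ExteriorAlgebra.map_surjective_iff.2 h

theorem relabel_proj {r : Setoid P} {s : Setoid Q} {f : P → Q} (h : r ≤ s.comap f)
    (x : PointAlgebra P) : OF.relabel r s f (proj r x) = proj s (map f x) := by
  have : (OF.relabel r s f).comp (proj r) = (proj s).comp (map f) := hom_ext fun p => by
    have e : Quotient.mk s (f (Quotient.mk r p).out) = Quotient.mk s (f p) :=
      Quotient.sound (h (Quotient.mk_out p))
    simp [OF.relabel, OF.gen, e]
  exact DFunLike.congr_fun this x

theorem proj_map_eq {r : Setoid P} {s : Setoid Q} {f : P → Q} (h : r ≤ s.comap f)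
    {x y : PointAlgebra P} (hxy : proj r x = proj r y) : proj s (map f x) = proj s (map f y) := by
  rw [← relabel_proj h, ← relabel_proj h, hxy]

theorem gen_eq {r : Setoid P} {p t : P} (h : r p t) : OF.gen r p = OF.gen r t := by
  have e : Quotient.mk r p = Quotient.mk r t := Quotient.sound h
  rw [OF.gen, OF.gen, e]

end PointAlgebra

/-- The factor `ι v` can be moved next to each generator in turn by anticommutation, so agreement on
generators after multiplication by `ι v` suffices. This makes a split independent of which new
circle replaces the old one. -/
theorem ExteriorAlgebra.ι_mul_map_eq {R M N : Type*} [CommRing R] [AddCommGroup M] [Module R M]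
    [AddCommGroup N] [Module R N] {f g : M →ₗ[R] N} {v : N}
    (h : ∀ m, ExteriorAlgebra.ι R v * ExteriorAlgebra.ι R (f m) =
      ExteriorAlgebra.ι R v * ExteriorAlgebra.ι R (g m)) (x : ExteriorAlgebra R M) :
    ExteriorAlgebra.ι R v * ExteriorAlgebra.map f x =
      ExteriorAlgebra.ι R v * ExteriorAlgebra.map g x := by
  have anti : ∀ a b : N, ExteriorAlgebra.ι R a * ExteriorAlgebra.ι R b =
      - (ExteriorAlgebra.ι R b * ExteriorAlgebra.ι R a) := fun a b =>
    eq_neg_of_add_eq_zero_left (ExteriorAlgebra.ι_add_mul_swap a b)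
  induction x using CliffordAlgebra.left_induction with
  | algebraMap r => simp
  | add x y hx hy => rw [map_add, map_add, mul_add, mul_add, hx, hy]
  | ι_mul x m hx =>
    change _ * ExteriorAlgebra.map f (ExteriorAlgebra.ι R m * x) =
      _ * ExteriorAlgebra.map g (ExteriorAlgebra.ι R m * x)
    rw [map_mul, map_mul, ExteriorAlgebra.map_apply_ι, ExteriorAlgebra.map_apply_ι, ← mul_assoc,
      anti, neg_mul, mul_assoc, hx, ← mul_assoc, ← neg_mul, ← anti, h, mul_assoc]

/-! ### Saddles and sequences of saddles as multiplications in the point algebra -/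

namespace OF

open PointAlgebra

variable {P Q : Type}

open scoped Classical in
/-- The factor by which a saddle multiplies. -/
noncomputable def saddleFactor (r' : Setoid P) (tail head : P) : PointAlgebra P :=
  if r' tail head then 1 else pt tail - pt head

/-- For a split, the point chosen on the old circle by `relabel` may lie on either new circle. The
possible error is `tail - head` up to sign, and it is killed by the factor `tail - head` because
squares vanish. -/
theorem saddle_proj {r r' : Setoid P} {tail head : P} (h : r ≤ r'.glue tail head)
    (x : PointAlgebra P) :
    saddle r r' tail head (proj r x) = proj r' (saddleFactor r' tail head * x) := by
  unfold saddle saddleFactor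
  split_ifs with hth
  · rw [Setoid.glue_eq_self hth] at h
    rw [one_mul, AlgHom.toLinearMap_apply, relabel_proj (f := id) h, PointAlgebra.map_id]
  · rw [LinearMap.comp_apply, LinearMap.mulLeft_apply, AlgHom.toLinearMap_apply, map_mul, map_sub,
      proj_pt, proj_pt]
    have e : gen r' tail - gen r' head = ExteriorAlgebra.ι ℤ
        (Finsupp.single (Quotient.mk r' tail) 1 - Finsupp.single (Quotient.mk r' head) 1) := by
      rw [map_sub]; rfl
    have e2 : relabel r r' id (proj r x) = ExteriorAlgebra.map
        ((Finsupp.lmapDomain ℤ ℤ fun q : Quotient r => Quotient.mk r' q.out) ∘ₗ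
          (Finsupp.lmapDomain ℤ ℤ (Quotient.mk r))) x := by
      rw [← ExteriorAlgebra.map_comp_map]; rfl
    rw [e2, e]
    refine ExteriorAlgebra.ι_mul_map_eq (fun m => ?_) x
    induction m using Finsupp.induction_linear with
    | zero => simp
    | add a b ha hb => simp only [map_add, mul_add, ha, hb]
    | single p c =>
      have hsq : ∀ m : Quotient r' →₀ ℤ, ExteriorAlgebra.ι ℤ m * ExteriorAlgebra.ι ℤ m = 0 :=
        ExteriorAlgebra.ι_sq_zero
      have key : ExteriorAlgebra.ι ℤ
          (Finsupp.single (Quotient.mk r' tail) (1 : ℤ) - Finsupp.single (Quotient.mk r' head) 1) *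
          (gen r' (Quotient.mk r p).out - gen r' p) = 0 := by
        rcases h (Quotient.mk_out p : r _ p) with k | ⟨k, k'⟩ | ⟨k, k'⟩
        · rw [gen_eq k, sub_self, mul_zero]
        · rw [gen_eq k, ← gen_eq k', e, hsq]
        · rw [gen_eq k, ← gen_eq k', ← neg_sub (gen r' tail), e, mul_neg, hsq, neg_zero]
      rw [mul_sub, sub_eq_zero] at key
      have hs : ∀ q : Quotient r', Finsupp.single q c = c • Finsupp.single q (1 : ℤ) := by simp
      simp only [LinearMap.comp_apply, Finsupp.lmapDomain_apply, Finsupp.mapDomain_single]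
      rw [hs, hs (Quotient.mk r' p), map_zsmul, map_zsmul, mul_smul_comm, mul_smul_comm]
      exact congrArg (c • ·) key

end OF

namespace SaddleFamily

open PointAlgebra

variable {E P Q : Type}

open scoped Classical in
/-- The product of the factors of the saddles performed along a list, the last one first. -/
noncomputable def factor (M : SaddleFamily E P) : Finset E → List E → PointAlgebra P
  | _, [] => 1
  | K, e :: L => M.factor (insert e K) L *
      OF.saddleFactor (M.state (insert e K)) (M.tail e) (M.head e)

open scoped Classical in
/-- Each of the saddles performed along a list changes the state by gluing at most. -/
def IsGluing (M : SaddleFamily E P) : Finset E → List E → Prop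
  | _, [] => True
  | K, e :: L => M.state K ≤ (M.state (insert e K)).glue (M.tail e) (M.head e) ∧
      M.IsGluing (insert e K) L

open scoped Classical in
/-- The set of saddles performed after a list. -/
noncomputable def after : Finset E → List E → Finset E
  | K, [] => K
  | K, e :: L => after (insert e K) L

open scoped Classical in
theorem mem_after {K : Finset E} {L : List E} {e : E} : e ∈ after K L ↔ e ∈ K ∨ e ∈ L := by
  induction L generalizing K with
  | nil => simp [after]
  | cons a L ih => rw [after, ih, Finset.mem_insert, List.mem_cons]; tauto

/-- All signs of a sequence of saddles are hereby contained in one element, `factor`, which does not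
depend on the argument of the map. -/
theorem eval_proj {M : SaddleFamily E P} {s : Setoid Q} {f : P → Q} {K : Finset E} {L : List E}
    (hM : M.IsGluing K L) (hs : M.state (after K L) ≤ s.comap f) (x : PointAlgebra P) :
    M.eval s f K L (proj _ x) = proj s (PointAlgebra.map f (M.factor K L * x)) := by
  induction L generalizing K x with
  | nil => rw [eval, factor, one_mul, AlgHom.toLinearMap_apply]; exact relabel_proj hs x
  | cons e L ih =>
    rw [eval, factor, LinearMap.comp_apply, OF.saddle_proj hM.1, ih hM.2 hs, mul_assoc]

end SaddleFamily


/-! ### Signs along sequences of saddles -/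

/-- The sign `(-1) ^ a`, as an integer. -/
def signOf (a : ZMod 2) : ℤ := (((-1 : ℤˣ) ^ a : ℤˣ) : ℤ)

theorem signOf_zero : signOf 0 = 1 := by simp [signOf]

theorem signOf_one : signOf 1 = -1 := by decide

theorem signOf_add (a b : ZMod 2) : signOf (a + b) = signOf a * signOf b := by
  revert a b; decide

/-- A family of saddles together with the regions of one colour of the planar diagrams, the colour
of the region in which each saddle takes place, and enumerations of the points and the saddles. -/
structure ColouredFamily (E P : Type) extends SaddleFamily E P where
  white : Finset E → Setoid P
  black : E → Prop
  rank : P → ℕ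
  index : E → ℕ

namespace ColouredFamily

variable {E P : Type} (M : ColouredFamily E P)

open scoped Classical

/-- The saddle `e`, performed after those in `K`, is a split. -/
def Splits (K : Finset E) (e : E) : Prop := ¬ M.state (insert e K) (M.tail e) (M.head e)

/-- The finer of the relations on white regions before and after a saddle. -/
noncomputable def cover (K : Finset E) (e : E) : Setoid P :=
  if M.black e then M.white K else M.white (insert e K)

/-- The saddle `e`, performed after those in `K`, changes the number of white regions. -/
def Changes (K : Finset E) (e : E) : Prop := ¬ M.cover K e (M.tail e) (M.head e)

noncomputable def blackCount (K : Finset E) : ZMod 2 := (K.filter M.black).card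

noncomputable def blackBefore (K : Finset E) (e : E) : ZMod 2 :=
  (K.filter fun y => M.black y ∧ M.index y < M.index e).card

/-- The sign exponent of a saddle. -/
noncomputable def tau (K : Finset E) (e : E) : ZMod 2 :=
  (if M.black e then M.blackBefore K e else 0) +
    if M.Changes K e then
      M.blackCount K + theta M.rank (M.cover K e) (M.tail e) (M.head e) else 0

/-- The sign exponent of a sequence of saddles. -/
noncomputable def tauList : Finset E → List E → ZMod 2
  | _, [] => 0
  | K, e :: L => M.tau K e + tauList (insert e K) L

/-- The properties of the diagrams that hold by planarity. -/
structure IsPlanar (adm : Finset E → Prop) : Prop where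
  union : ∀ {K K'}, adm K → adm K' → adm (K ∪ K')
  rank_injective : Function.Injective M.rank
  index_injective : Function.Injective M.index
  state_le_white : ∀ K, M.state K ≤ M.white K
  surgery : ∀ {K e}, e ∉ K → adm K → adm (insert e K) →
    (M.state K).IsSurgery (M.state (insert e K)) (M.tail e) (M.head e)
  white_of_black : ∀ {K e}, e ∉ K → adm K → adm (insert e K) → M.black e →
    M.white (insert e K) = (M.white K).glue (M.tail e) (M.head e)
  white_of_not_black : ∀ {K e}, e ∉ K → adm K → adm (insert e K) → ¬ M.black e →
    M.white K = (M.white (insert e K)).glue (M.tail e) (M.head e)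
  rel_of_black : ∀ {K e}, e ∉ K → adm K → adm (insert e K) → M.black e →
    M.white K (M.tail e) (M.head e) → M.state K (M.tail e) (M.head e)
  rel_of_not_black : ∀ {K e}, e ∉ K → adm K → adm (insert e K) → ¬ M.black e →
    M.white (insert e K) (M.tail e) (M.head e) → M.state (insert e K) (M.tail e) (M.head e)
  cross : ∀ {K e f}, e ∉ K → f ∉ K → e ≠ f → ¬ M.state K (M.tail e) (M.head e) →
    M.state K (M.tail e) (M.tail f) → M.state K (M.head e) (M.head f) →
    ¬ M.state (insert f (insert e K)) (M.tail e) (M.tail f)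
  cross' : ∀ {K e f}, e ∉ K → f ∉ K → e ≠ f → ¬ M.state K (M.tail e) (M.head e) →
    M.state K (M.tail e) (M.head f) → M.state K (M.head e) (M.tail f) →
    ¬ M.state (insert f (insert e K)) (M.tail e) (M.head f)

variable {M} {adm : Finset E → Prop} {K : Finset E} {e f : E}

theorem blackCount_insert (he : e ∉ K) :
    M.blackCount (insert e K) = M.blackCount K + if M.black e then 1 else 0 := by
  unfold blackCount
  rw [Finset.filter_insert]
  split_ifs with h
  · rw [Finset.card_insert_of_notMem (by simp [he])]; push_cast; rfl
  · rw [add_zero]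

theorem blackBefore_insert (he : e ∉ K) (f : E) : M.blackBefore (insert e K) f =
    M.blackBefore K f + if M.black e ∧ M.index e < M.index f then 1 else 0 := by
  unfold blackBefore
  rw [Finset.filter_insert]
  split_ifs with h
  · rw [Finset.card_insert_of_notMem (by simp [he])]; push_cast; rfl
  · rw [add_zero]

/-- A black saddle unites the white regions on its two sides. By the Jordan curve property these
were already the same region exactly when the strands lie on one circle, that is, when the saddle is
a split. For white saddles the roles of merges and splits are reversed. -/
theorem tau_eq_of_black (hM : M.IsPlanar adm) (he : e ∉ K) (h1 : adm K) (h2 : adm (insert e K))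
    (hb : M.black e) : M.tau K e = M.blackBefore K e + if M.Splits K e then 0 else
      M.blackCount K + theta M.rank (M.white K) (M.tail e) (M.head e) := by
  have : M.Changes K e ↔ ¬ M.Splits K e := by
    unfold Changes Splits cover
    rw [if_pos hb, not_not]
    have := (hM.surgery he h1 h2).rel_iff
    have a := hM.rel_of_black he h1 h2 hb
    have b := fun k : M.state K (M.tail e) (M.head e) => hM.state_le_white K k
    tauto
  unfold tau
  simp only [this, if_pos hb, ite_not, cover]

theorem tau_eq_of_not_black (hM : M.IsPlanar adm) (he : e ∉ K) (h1 : adm K)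
    (h2 : adm (insert e K)) (hb : ¬ M.black e) : M.tau K e = if M.Splits K e then
      M.blackCount K + theta M.rank (M.white (insert e K)) (M.tail e) (M.head e) else 0 := by
  have : M.Changes K e ↔ M.Splits K e := by
    unfold Changes Splits cover
    rw [if_neg hb]
    have a := hM.rel_of_not_black he h1 h2 hb
    have b := fun k : M.state (insert e K) (M.tail e) (M.head e) =>
      hM.state_le_white _ k
    tauto
  unfold tau
  simp only [this, if_neg hb, cover, zero_add]

theorem splits_iff_of_black (hM : M.IsPlanar adm) (he : e ∉ K) (h1 : adm K)
    (h2 : adm (insert e K)) (hb : M.black e) :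
    M.Splits K e ↔ M.white K (M.tail e) (M.head e) := by
  unfold Splits
  have := (hM.surgery he h1 h2).rel_iff
  have a := hM.rel_of_black he h1 h2 hb
  have b := fun k : M.state K (M.tail e) (M.head e) => hM.state_le_white K k
  tauto

theorem splits_iff_of_not_black (hM : M.IsPlanar adm) (he : e ∉ K) (h1 : adm K)
    (h2 : adm (insert e K)) (hb : ¬ M.black e) :
    M.Splits K e ↔ ¬ M.white (insert e K) (M.tail e) (M.head e) := by
  unfold Splits
  have a := hM.rel_of_not_black he h1 h2 hb
  have b := fun k : M.state (insert e K) (M.tail e) (M.head e) =>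
      hM.state_le_white _ k
  tauto

/-- The hypotheses under which two saddles may be exchanged. -/
structure IsSquare (M : ColouredFamily E P) (adm : Finset E → Prop) (K : Finset E) (e f : E) :
    Prop where
  planar : M.IsPlanar adm
  e_notMem : e ∉ K
  f_notMem : f ∉ K
  ne : e ≠ f
  adm_K : adm K
  adm_e : adm (insert e K)
  adm_f : adm (insert f K)

namespace IsSquare

theorem swap (h : M.IsSquare adm K e f) : M.IsSquare adm K f e :=
  ⟨h.planar, h.f_notMem, h.e_notMem, h.ne.symm, h.adm_K, h.adm_f, h.adm_e⟩

theorem f_notMem' (h : M.IsSquare adm K e f) : f ∉ insert e K := by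
  rw [Finset.mem_insert, not_or]; exact ⟨h.ne.symm, h.f_notMem⟩

theorem adm_ef (h : M.IsSquare adm K e f) : adm (insert f (insert e K)) := by
  have := h.planar.union h.adm_e h.adm_f
  rwa [show insert e K ∪ insert f K = insert f (insert e K) by ext; simp] at this

theorem insert_comm (K : Finset E) (e f : E) : insert e (insert f K) = insert f (insert e K) :=
  Finset.insert_comm _ _ _

theorem surgery_e (h : M.IsSquare adm K e f) :
    (M.state K).IsSurgery (M.state (insert e K)) (M.tail e) (M.head e) :=
  h.planar.surgery h.e_notMem h.adm_K h.adm_e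

theorem surgery_ef (h : M.IsSquare adm K e f) :
    (M.state (insert e K)).IsSurgery (M.state (insert f (insert e K))) (M.tail f) (M.head f) :=
  h.planar.surgery h.f_notMem' h.adm_e h.adm_ef

theorem splits_fe : M.Splits (insert f K) e ↔
    ¬ M.state (insert f (insert e K)) (M.tail e) (M.head e) := by
  rw [Splits, insert_comm]

/-- Two splits in one order are two splits in the other order. -/
theorem splits_splits (h : M.IsSquare adm K e f) (h1 : M.Splits K e)
    (h2 : M.Splits (insert e K) f) : M.Splits K f ∧ M.Splits (insert f K) e := by
  have a1 := h.surgery_e.rel_iff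
  have b1 := h.surgery_ef.rel_iff
  have c1 := h.swap.surgery_e.rel_iff
  unfold Splits at h1 h2
  have e1 := h.surgery_e.eq_glue' (by tauto)
  have e2 := h.surgery_ef.eq_glue' (by tauto)
  rw [splits_fe]
  refine ⟨?_, fun k => h1 ?_⟩
  · rw [Splits, ← c1, e1]
    exact Or.inl (b1.2 h2)
  · rw [e2]; exact Or.inl k

/-- Two merges in one order are two merges in the other order. -/
theorem merges_merges (h : M.IsSquare adm K e f) (h1 : ¬ M.Splits K e)
    (h2 : ¬ M.Splits (insert e K) f) : ¬ M.Splits K f ∧ ¬ M.Splits (insert f K) e := by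
  have a1 := h.surgery_e.rel_iff
  have b1 := h.surgery_ef.rel_iff
  have c1 := h.swap.surgery_e.rel_iff
  unfold Splits at h1 h2
  have e1 := h.surgery_e.eq_glue (by tauto)
  have e2 := h.surgery_ef.eq_glue (by tauto)
  rw [splits_fe]
  refine ⟨?_, fun k => k ?_⟩
  · rw [Splits, ← c1]
    intro k
    refine (b1.1 ?_) (not_not.1 h2)
    rw [e1]
    exact Or.inl k
  · rw [e2]; exact Or.inl (not_not.1 h1)

/-- Of two black saddles exactly one has the smaller index; it is counted only in the order in which
it comes first. -/
theorem blackBefore (h : M.IsSquare adm K e f) (he : M.black e) (hf : M.black f) :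
    M.blackBefore (insert e K) f + M.blackBefore (insert f K) e =
      M.blackBefore K e + M.blackBefore K f + 1 := by
  rw [blackBefore_insert h.e_notMem, blackBefore_insert h.f_notMem]
  have := h.planar.index_injective.ne h.ne
  simp only [he, hf, true_and]
  rcases lt_or_gt_of_ne this with k | k
  · rw [if_pos k, if_neg k.not_gt]; abel
  · rw [if_pos k, if_neg k.not_gt]; abel

/-- The sum of the sign exponents around a square. -/
noncomputable def total (M : ColouredFamily E P) (K : Finset E) (e f : E) : ZMod 2 :=
  M.tau K e + M.tau (insert e K) f + (M.tau K f + M.tau (insert f K) e)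

theorem total_swap (M : ColouredFamily E P) (K : Finset E) (e f : E) :
    total M K f e = total M K e f := by
  unfold total; ring

end IsSquare

end ColouredFamily


/-! ### The sum of the sign exponents around a square of saddles -/

namespace ColouredFamily

open scoped Classical

namespace IsSquare

variable {E P : Type} {M : ColouredFamily E P} {adm : Finset E → Prop} {K : Finset E} {e f : E}

/-- The first `1` is the anticommutation of the two places in the list of black saddles. Each second
saddle sees `blackCount` raised by one by the first. -/
theorem total_eq_of_black_black (h : M.IsSquare adm K e f) (he : M.black e) (hf : M.black f) :
    total M K e f = 1 +
      (if M.Splits K e then 0 else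
        M.blackCount K + theta M.rank (M.white K) (M.tail e) (M.head e)) +
      (if M.Splits (insert e K) f then 0 else
        M.blackCount K + 1 + theta M.rank (M.white (insert e K)) (M.tail f) (M.head f)) +
      (if M.Splits K f then 0 else
        M.blackCount K + theta M.rank (M.white K) (M.tail f) (M.head f)) +
      (if M.Splits (insert f K) e then 0 else
        M.blackCount K + 1 + theta M.rank (M.white (insert f K)) (M.tail e) (M.head e)) := by
  have hb := h.blackBefore he hf
  unfold total
  rw [tau_eq_of_black h.planar h.e_notMem h.adm_K h.adm_e he,
    tau_eq_of_black h.planar h.f_notMem h.adm_K h.adm_f hf,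
    tau_eq_of_black h.planar h.f_notMem' h.adm_e h.adm_ef hf,
    tau_eq_of_black h.planar h.swap.f_notMem' h.adm_f h.swap.adm_ef he,
    blackCount_insert h.e_notMem, blackCount_insert h.f_notMem, if_pos he, if_pos hf]
  linear_combination hb + (M.blackBefore K e + M.blackBefore K f) * CharTwo.two_eq_zero (R := ZMod 2)

theorem total_eq_of_white_white (h : M.IsSquare adm K e f) (he : ¬ M.black e) (hf : ¬ M.black f) :
    total M K e f =
      (if M.Splits K e then
        M.blackCount K + theta M.rank (M.white (insert e K)) (M.tail e) (M.head e) else 0) +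
      (if M.Splits (insert e K) f then M.blackCount K +
        theta M.rank (M.white (insert f (insert e K))) (M.tail f) (M.head f) else 0) +
      (if M.Splits K f then
        M.blackCount K + theta M.rank (M.white (insert f K)) (M.tail f) (M.head f) else 0) +
      (if M.Splits (insert f K) e then M.blackCount K +
        theta M.rank (M.white (insert f (insert e K))) (M.tail e) (M.head e) else 0) := by
  unfold total
  rw [tau_eq_of_not_black h.planar h.e_notMem h.adm_K h.adm_e he,
    tau_eq_of_not_black h.planar h.f_notMem h.adm_K h.adm_f hf,
    tau_eq_of_not_black h.planar h.f_notMem' h.adm_e h.adm_ef hf,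
    tau_eq_of_not_black h.planar h.swap.f_notMem' h.adm_f h.swap.adm_ef he,
    blackCount_insert h.e_notMem, blackCount_insert h.f_notMem, if_neg he, if_neg hf, insert_comm]
  abel_nf

theorem total_eq_of_black_white (h : M.IsSquare adm K e f) (he : M.black e) (hf : ¬ M.black f) :
    total M K e f =
      (if M.Splits K e then 0 else
        M.blackCount K + theta M.rank (M.white K) (M.tail e) (M.head e)) +
      (if M.Splits (insert e K) f then M.blackCount K + 1 +
        theta M.rank (M.white (insert f (insert e K))) (M.tail f) (M.head f) else 0) +
      (if M.Splits K f then
        M.blackCount K + theta M.rank (M.white (insert f K)) (M.tail f) (M.head f) else 0) +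
      (if M.Splits (insert f K) e then 0 else
        M.blackCount K + theta M.rank (M.white (insert f K)) (M.tail e) (M.head e)) := by
  unfold total
  rw [tau_eq_of_black h.planar h.e_notMem h.adm_K h.adm_e he,
    tau_eq_of_not_black h.planar h.f_notMem h.adm_K h.adm_f hf,
    tau_eq_of_not_black h.planar h.f_notMem' h.adm_e h.adm_ef hf,
    tau_eq_of_black h.planar h.swap.f_notMem' h.adm_f h.swap.adm_ef he,
    blackCount_insert h.e_notMem, blackCount_insert h.f_notMem, blackBefore_insert h.f_notMem,
    if_pos he, if_neg hf, if_neg (fun k : M.black f ∧ _ => hf k.1)]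
  by_cases hs : M.Splits (insert f K) e <;> simp only [hs, if_true, if_false] <;>
    linear_combination M.blackBefore K e * CharTwo.two_eq_zero (R := ZMod 2)

section Relations

variable (h : M.IsSquare adm K e f)

include h

theorem white_e (he : M.black e) :
    M.white (insert e K) = (M.white K).glue (M.tail e) (M.head e) :=
  h.planar.white_of_black h.e_notMem h.adm_K h.adm_e he

theorem white_e' (he : ¬ M.black e) :
    M.white K = (M.white (insert e K)).glue (M.tail e) (M.head e) :=
  h.planar.white_of_not_black h.e_notMem h.adm_K h.adm_e he

theorem white_ef (hf : M.black f) : M.white (insert f (insert e K)) =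
    (M.white (insert e K)).glue (M.tail f) (M.head f) :=
  h.planar.white_of_black h.f_notMem' h.adm_e h.adm_ef hf

theorem white_ef' (hf : ¬ M.black f) : M.white (insert e K) =
    (M.white (insert f (insert e K))).glue (M.tail f) (M.head f) :=
  h.planar.white_of_not_black h.f_notMem' h.adm_e h.adm_ef hf

theorem splits_e (he : M.black e) : M.Splits K e ↔ M.white K (M.tail e) (M.head e) :=
  splits_iff_of_black h.planar h.e_notMem h.adm_K h.adm_e he

theorem splits_e' (he : ¬ M.black e) :
    M.Splits K e ↔ ¬ M.white (insert e K) (M.tail e) (M.head e) :=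
  splits_iff_of_not_black h.planar h.e_notMem h.adm_K h.adm_e he

theorem splits_ef (hf : M.black f) :
    M.Splits (insert e K) f ↔ M.white (insert e K) (M.tail f) (M.head f) :=
  splits_iff_of_black h.planar h.f_notMem' h.adm_e h.adm_ef hf

theorem splits_ef' (hf : ¬ M.black f) : M.Splits (insert e K) f ↔
    ¬ M.white (insert f (insert e K)) (M.tail f) (M.head f) :=
  splits_iff_of_not_black h.planar h.f_notMem' h.adm_e h.adm_ef hf

/-- A split carries one odd piece: its place in the list if it is black, a change of white regions
if it is white. Two odd pieces of any kinds anticommute. -/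
theorem total_splits_splits (h1 : M.Splits K e) (h2 : M.Splits (insert e K) f) :
    total M K e f = 1 := by
  -- The sum around the square is symmetric in the two saddles, so of the two mixed cases only the
  -- one with `e` black is needed.
  wlog hc : M.black e ∨ ¬ M.black f generalizing e f
  · obtain ⟨h3, h4⟩ := h.splits_splits h1 h2
    rw [← total_swap]
    exact this h.swap h3 h4 (by tauto)
  obtain ⟨h3, h4⟩ := h.splits_splits h1 h2
  by_cases he : M.black e <;> by_cases hf : M.black f
  · rw [h.total_eq_of_black_black he hf]
    simp only [h1, h2, h3, h4, if_true, add_zero]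
  · rw [h.total_eq_of_black_white he hf]
    simp only [h1, h2, h3, h4, if_true]
    have e1 := h.swap.white_ef he
    rw [insert_comm K e f, Setoid.glue_eq_self ((h.swap.splits_ef he).1 h4)] at e1
    rw [e1]
    linear_combination (M.blackCount K + theta M.rank (M.white (insert f K)) (M.tail f) (M.head f))
      * CharTwo.two_eq_zero (R := ZMod 2)
  · tauto
  · rw [h.total_eq_of_white_white he hf]
    simp only [h1, h2, h3, h4, if_true]
    have e1 := h.white_ef' hf
    have e2 := h.swap.white_ef' he
    have a1 := (h.splits_ef' hf).1 h2
    have a2 := (h.splits_e' he).1 h1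
    rw [insert_comm K e f] at e2
    have := theta_add_theta_glue h.planar.rank_injective a1 (e1 ▸ a2)
    rw [← e1, ← e2] at this
    linear_combination this + (2 * M.blackCount K +
      theta M.rank (M.white (insert f (insert e K))) (M.tail e) (M.head e) +
      theta M.rank (M.white (insert f K)) (M.tail f) (M.head f))
      * CharTwo.two_eq_zero (R := ZMod 2)

/-- A black merge carries two odd pieces and a white merge carries none, so merges are even. -/
theorem total_merges_merges (h1 : ¬ M.Splits K e) (h2 : ¬ M.Splits (insert e K) f) :
    total M K e f = 0 := by
  wlog hc : M.black e ∨ ¬ M.black f generalizing e f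
  · obtain ⟨h3, h4⟩ := h.merges_merges h1 h2
    rw [← total_swap]
    exact this h.swap h3 h4 (by tauto)
  obtain ⟨h3, h4⟩ := h.merges_merges h1 h2
  by_cases he : M.black e <;> by_cases hf : M.black f
  · rw [h.total_eq_of_black_black he hf]
    simp only [h1, h2, h3, h4, if_false]
    have e1 := h.white_e he
    have e2 := h.swap.white_e hf
    have a1 := mt (h.splits_e he).2 h1
    have a2 := mt (h.splits_ef hf).2 h2
    have := theta_add_theta_glue h.planar.rank_injective a1 (e1 ▸ a2)
    rw [← e1, ← e2] at this
    linear_combination this + (2 * M.blackCount K + 2 +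
      theta M.rank (M.white K) (M.tail f) (M.head f) +
      theta M.rank (M.white (insert f K)) (M.tail e) (M.head e))
      * CharTwo.two_eq_zero (R := ZMod 2)
  · rw [h.total_eq_of_black_white he hf]
    simp only [h1, h2, h3, h4, if_false]
    have e1 := h.swap.white_e' hf
    rw [Setoid.glue_eq_self (not_not.1 (mt (h.swap.splits_e' hf).2 h3))] at e1
    rw [e1]
    linear_combination (M.blackCount K + theta M.rank (M.white (insert f K)) (M.tail e) (M.head e))
      * CharTwo.two_eq_zero (R := ZMod 2)
  · tauto
  · rw [h.total_eq_of_white_white he hf]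
    simp only [h1, h2, h3, h4, if_false, add_zero]

/-- One odd saddle passes one even saddle. -/
theorem total_splits_merges (h1 : M.Splits K e) (h2 : ¬ M.Splits (insert e K) f)
    (h3 : ¬ M.Splits K f) (h4 : M.Splits (insert f K) e) : total M K e f = 0 := by
  by_cases he : M.black e <;> by_cases hf : M.black f
  · rw [h.total_eq_of_black_black he hf]
    simp only [h1, h2, h3, h4, if_false, if_true]
    have e1 := h.white_e he
    rw [Setoid.glue_eq_self ((h.splits_e he).1 h1)] at e1
    rw [e1]
    linear_combination (1 + M.blackCount K + theta M.rank (M.white K) (M.tail f) (M.head f))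
      * CharTwo.two_eq_zero (R := ZMod 2)
  · rw [h.total_eq_of_black_white he hf]
    simp only [h1, h2, h3, h4, if_false, if_true, add_zero]
  · rw [← total_swap, h.swap.total_eq_of_black_white hf he]
    simp only [h1, h2, h3, h4, if_false, if_true]
    have e1 := h.white_e' he
    have e2 := h.white_ef hf
    have a1 := (h.splits_e' he).1 h1
    have a2 := mt (h.swap.splits_e hf).2 h3
    have := theta_add_theta_glue h.planar.rank_injective a1 (e1 ▸ a2)
    rw [← e1, ← e2] at this
    rw [insert_comm K e f]
    linear_combination this + (1 + 2 * M.blackCount K +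
      theta M.rank (M.white (insert e K)) (M.tail f) (M.head f) +
      theta M.rank (M.white (insert f (insert e K))) (M.tail e) (M.head e))
      * CharTwo.two_eq_zero (R := ZMod 2)
  · rw [h.total_eq_of_white_white he hf]
    simp only [h1, h2, h3, h4, if_false, if_true]
    have e1 := h.white_ef' hf
    rw [Setoid.glue_eq_self (not_not.1 (mt (h.splits_ef' hf).2 h2))] at e1
    rw [e1]
    linear_combination (M.blackCount K +
      theta M.rank (M.white (insert f (insert e K))) (M.tail e) (M.head e))
      * CharTwo.two_eq_zero (R := ZMod 2)

open PointAlgebra in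
-- Two circles are joined by both saddles. In either order the first saddle contributes `1` and the
-- second its arrow, so the required sign compares the arrows on the final circles. For two white
-- saddles `theta` compares them on the final diagram. For two black saddles it compares them on the
-- initial one, where the answer is the opposite; the `1` from the order of black saddles makes up
-- for this.
theorem total_merges_splits (h1 : ¬ M.Splits K e) (h2 : M.Splits (insert e K) f)
    (h3 : ¬ M.Splits K f) (h4 : M.Splits (insert f K) e) :
    proj (M.state (insert f (insert e K))) (pt (M.tail f) - pt (M.head f)) =
      signOf (total M K e f) •
        proj (M.state (insert f (insert e K))) (pt (M.tail e) - pt (M.head e)) := by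
  have hs : M.state (insert f (insert e K)) (M.tail e) (M.tail f) ∧
        M.state (insert f (insert e K)) (M.head e) (M.head f) ∨
      M.state (insert f (insert e K)) (M.tail e) (M.head f) ∧
        M.state (insert f (insert e K)) (M.head e) (M.tail f) := by
    have e1 := h.surgery_ef.eq_glue' (h.surgery_ef.rel_iff.2 h2)
    have : M.state (insert e K) (M.tail e) (M.head e) := not_not.1 h1
    rw [e1] at this
    rcases this with k | ⟨k, k'⟩ | ⟨k, k'⟩
    · exact absurd k (splits_fe.1 h4)
    · exact Or.inl ⟨k, Setoid.symm' _ k'⟩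
    · exact Or.inr ⟨k, Setoid.symm' _ k'⟩
  have eq_of : M.state (insert f (insert e K)) (M.tail e) (M.tail f) ∧
      M.state (insert f (insert e K)) (M.head e) (M.head f) → total M K e f = 0 →
      proj (M.state (insert f (insert e K))) (pt (M.tail f) - pt (M.head f)) =
      signOf (total M K e f) •
        proj (M.state (insert f (insert e K))) (pt (M.tail e) - pt (M.head e)) := fun k k' => by
    rw [k', signOf_zero, one_smul, map_sub, map_sub, proj_pt, proj_pt, proj_pt, proj_pt,
      gen_eq k.1, gen_eq k.2]
  have neg_of : M.state (insert f (insert e K)) (M.tail e) (M.head f) ∧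
      M.state (insert f (insert e K)) (M.head e) (M.tail f) → total M K e f = 1 →
      proj (M.state (insert f (insert e K))) (pt (M.tail f) - pt (M.head f)) =
      signOf (total M K e f) •
        proj (M.state (insert f (insert e K))) (pt (M.tail e) - pt (M.head e)) := fun k k' => by
    rw [k', signOf_one, neg_smul, one_smul, map_sub, map_sub, proj_pt, proj_pt, proj_pt, proj_pt,
      gen_eq k.1, gen_eq k.2, neg_sub]
  by_cases he : M.black e <;> by_cases hf : M.black f
  · have ht := h.total_eq_of_black_black he hf
    simp only [h1, h2, h3, h4, if_false, if_true, add_zero] at ht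
    have hK : M.state K (M.tail e) (M.tail f) ∧ M.state K (M.head e) (M.head f) ∨
        M.state K (M.tail e) (M.head f) ∧ M.state K (M.head e) (M.tail f) := by
      have e1 := h.surgery_e.eq_glue (mt h.surgery_e.rel_iff.1 (not_not.2 (not_not.1 h1)))
      have : M.state (insert e K) (M.tail f) (M.head f) := h.surgery_ef.rel_iff.2 h2
      rw [e1] at this
      rcases this with k | ⟨k, k'⟩ | ⟨k, k'⟩
      · exact absurd k (mt h.swap.surgery_e.rel_iff.1 (not_not.2 (not_not.1 h3)))
      · exact Or.inl ⟨Setoid.symm' _ k, k'⟩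
      · exact Or.inr ⟨k', Setoid.symm' _ k⟩
    have hn : ¬ M.state K (M.tail e) (M.head e) :=
      mt h.surgery_e.rel_iff.1 (not_not.2 (not_not.1 h1))
    -- By `cross` and `cross'`, arrows that are parallel on the initial circles are antiparallel on
    -- the final ones, and conversely.
    rcases hK with k | k
    · have c := h.planar.cross h.e_notMem h.f_notMem h.ne hn k.1 k.2
      refine neg_of (hs.resolve_left fun k => c k.1) ?_
      rw [ht, theta_congr (h.planar.state_le_white _ k.1) (h.planar.state_le_white _ k.2)]
      linear_combination (M.blackCount K + theta M.rank (M.white K) (M.tail f) (M.head f))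
        * CharTwo.two_eq_zero (R := ZMod 2)
    · have c := h.planar.cross' h.e_notMem h.f_notMem h.ne hn k.1 k.2
      refine eq_of (hs.resolve_right fun k => c k.1) ?_
      rw [ht, theta_congr (h.planar.state_le_white _ k.1) (h.planar.state_le_white _ k.2),
        theta_swap h.planar.rank_injective (mt (h.swap.splits_e hf).2 h3)]
      linear_combination (1 + M.blackCount K + theta M.rank (M.white K) (M.tail f) (M.head f))
        * CharTwo.two_eq_zero (R := ZMod 2)
  -- Undoing a white saddle only makes the white relation coarser, so a black saddle that splits
  -- after a white one splits before it too.
  · exfalso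
    apply mt (h.splits_e he).2 h1
    rw [h.swap.white_e' hf]
    exact Or.inl ((h.swap.splits_ef he).1 h4)
  · exfalso
    apply mt (h.swap.splits_e hf).2 h3
    rw [h.white_e' he]
    exact Or.inl ((h.splits_ef hf).1 h2)
  · have ht := h.total_eq_of_white_white he hf
    simp only [h1, h2, h3, h4, if_false, if_true, zero_add] at ht
    rcases hs with k | k
    · refine eq_of k ?_
      rw [ht, theta_congr (h.planar.state_le_white _ k.1) (h.planar.state_le_white _ k.2)]
      linear_combination (M.blackCount K +
        theta M.rank (M.white (insert f (insert e K))) (M.tail f) (M.head f))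
        * CharTwo.two_eq_zero (R := ZMod 2)
    · refine neg_of k ?_
      rw [ht, theta_congr (h.planar.state_le_white _ k.1) (h.planar.state_le_white _ k.2),
        theta_swap h.planar.rank_injective ((h.splits_ef' hf).1 h2)]
      linear_combination (M.blackCount K +
        theta M.rank (M.white (insert f (insert e K))) (M.tail f) (M.head f))
        * CharTwo.two_eq_zero (R := ZMod 2)

end Relations

end IsSquare

end ColouredFamily


/-! ### Independence of the signed product of the order of the saddles -/

namespace ColouredFamily

open scoped Classical
open PointAlgebra SaddleFamily

variable {E P : Type} {M : ColouredFamily E P} {adm : Finset E → Prop}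

/-- The saddles of a list may be performed in order after those in `K`. -/
def IsPath (adm : Finset E → Prop) : Finset E → List E → Prop
  | K, [] => adm K
  | K, e :: L => adm K ∧ e ∉ K ∧ IsPath adm (insert e K) L

theorem IsPath.adm_left {K : Finset E} {L : List E} (h : IsPath adm K L) : adm K := by
  cases L with
  | nil => exact h
  | cons e L => exact h.1

theorem IsPath.isGluing (hM : M.IsPlanar adm) {K : Finset E} {L : List E} (h : IsPath adm K L) :
    M.toSaddleFamily.IsGluing K L := by
  induction L generalizing K with
  | nil => trivial
  | cons e L ih =>
    exact ⟨(hM.surgery h.2.1 h.1 h.2.2.adm_left).le, ih h.2.2⟩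

theorem IsPath.append {K : Finset E} {L L' : List E} (h : IsPath adm K L)
    (h' : IsPath adm (after K L) L') : IsPath adm K (L ++ L') := by
  induction L generalizing K with
  | nil => exact h'
  | cons e L ih => exact ⟨h.1, h.2.1, ih h.2.2 h'⟩

theorem after_append (K : Finset E) (L L' : List E) : after K (L ++ L') = after (after K L) L' := by
  induction L generalizing K with
  | nil => rfl
  | cons e L ih => exact ih _

theorem tauList_append (K : Finset E) (L L' : List E) :
    M.tauList K (L ++ L') = M.tauList K L + M.tauList (after K L) L' := by
  induction L generalizing K with
  | nil => exact (zero_add _).symm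
  | cons e L ih => rw [List.cons_append, tauList, ih, tauList, after, add_assoc]

theorem factor_append (N : SaddleFamily E P) (K : Finset E) (L L' : List E) :
    N.factor K (L ++ L') = N.factor (after K L) L' * N.factor K L := by
  induction L generalizing K with
  | nil => exact (mul_one _).symm
  | cons e L ih => rw [List.cons_append, factor, ih, factor, after, mul_assoc]

/-- Multiplication by the factor of a path induces the evaluation map on `OF`, so it respects
equalities in the initial diagram although it is defined on points. -/
theorem proj_factor_mul (hM : M.IsPlanar adm) {K : Finset E} {L : List E} (h : IsPath adm K L)
    {x y : PointAlgebra P} (hxy : proj (M.state K) x = proj (M.state K) y) :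
    proj (M.state (after K L)) (M.factor K L * x) =
      proj (M.state (after K L)) (M.factor K L * y) := by
  have hg := h.isGluing hM
  have e := fun z => eval_proj (s := M.state (after K L)) (f := id) hg (fun _ _ k => k) z
  have := (e x).symm.trans ((congrArg _ hxy).trans (e y))
  rwa [PointAlgebra.map_id, PointAlgebra.map_id] at this

/-- Each pattern of merges and splits around the square is matched with the value of `total` for it:
`1` for two splits, `0` when a merge is interchanged with a merge or a split, and the comparison of
arrows when both orders merge and then split. -/
theorem IsSquare.proj_eq {K : Finset E} {e f : E} (h : M.IsSquare adm K e f) :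
    signOf (M.tau K e + M.tau (insert e K) f) • proj (M.state (insert f (insert e K)))
        (OF.saddleFactor (M.state (insert f (insert e K))) (M.tail f) (M.head f) *
          OF.saddleFactor (M.state (insert e K)) (M.tail e) (M.head e)) =
      signOf (M.tau K f + M.tau (insert f K) e) • proj (M.state (insert f (insert e K)))
        (OF.saddleFactor (M.state (insert f (insert e K))) (M.tail e) (M.head e) *
          OF.saddleFactor (M.state (insert f K)) (M.tail f) (M.head f)) := by
  have key : ∀ x y : OF (M.state (insert f (insert e K))),
      x = signOf (total M K e f) • y →
      signOf (M.tau K e + M.tau (insert e K) f) • x =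
        signOf (M.tau K f + M.tau (insert f K) e) • y := by
    rintro _ y rfl
    rw [smul_smul, total, ← signOf_add, ← add_assoc, CharTwo.add_self_eq_zero, zero_add]
  apply key
  have f1 : ∀ K' (e : E), M.Splits K' e →
      OF.saddleFactor (M.state (insert e K')) (M.tail e) (M.head e) =
        pt (M.tail e) - pt (M.head e) := fun K' e k => if_neg k
  have f2 : ∀ K' (e : E), ¬ M.Splits K' e →
      OF.saddleFactor (M.state (insert e K')) (M.tail e) (M.head e) = 1 :=
    fun K' e k => if_pos (not_not.1 k)
  have c := insert_comm K e f
  by_cases h1 : M.Splits K e <;> by_cases h2 : M.Splits (insert e K) f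
  · obtain ⟨h3, h4⟩ := h.splits_splits h1 h2
    rw [f1 _ _ h1, f1 _ _ h2, ← c, f1 _ _ h3, f1 _ _ h4, h.total_splits_splits h1 h2, signOf_one,
      neg_smul, one_smul]
    have e1 : ∀ e : E, pt (M.tail e) - pt (M.head e) = ExteriorAlgebra.ι ℤ
        (Finsupp.single (M.tail e) 1 - Finsupp.single (M.head e) 1) := fun e => by
      rw [map_sub]; rfl
    rw [← map_neg]
    congr 1
    rw [e1, e1]
    exact eq_neg_of_add_eq_zero_left (ExteriorAlgebra.ι_add_mul_swap _ _)
  · by_cases h3 : M.Splits K f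
    -- Both orders split and then merge. The merge identifies the two circles just created, so both
    -- sides vanish and no sign is required.
    · have h4 : ¬ M.Splits (insert f K) e := fun h4 => h2 (h.swap.splits_splits h3 h4).2
      rw [f1 _ _ h1, f2 _ _ h2, ← c, f1 _ _ h3, f2 _ _ h4, one_mul, one_mul, map_sub, map_sub,
        proj_pt, proj_pt, proj_pt, proj_pt, gen_eq (not_not.1 h4), c, gen_eq (not_not.1 h2),
        sub_self, sub_self, smul_zero]
    · have h4 : M.Splits (insert f K) e := by
        by_contra h4
        exact (h.swap.merges_merges h3 h4).1 h1
      rw [f1 _ _ h1, f2 _ _ h2, ← c, f2 _ _ h3, f1 _ _ h4, one_mul, mul_one,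
        h.total_splits_merges h1 h2 h3 h4, signOf_zero, one_smul]
  · by_cases h3 : M.Splits K f
    · have h4 : ¬ M.Splits (insert f K) e := fun h4 => h1 (h.swap.splits_splits h3 h4).1
      rw [f2 _ _ h1, f1 _ _ h2, ← c, f1 _ _ h3, f2 _ _ h4, one_mul, mul_one,
        ← total_swap, h.swap.total_splits_merges h3 h4 h1 h2, signOf_zero, one_smul]
    · have h4 : M.Splits (insert f K) e := by
        by_contra h4
        exact (h.swap.merges_merges h3 h4).2 h2
      have := h.total_merges_splits h1 h2 h3 h4
      rw [f2 _ _ h1, f1 _ _ h2, ← c, f2 _ _ h3, f1 _ _ h4, mul_one, mul_one, c]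
      exact this
  · obtain ⟨h3, h4⟩ := h.merges_merges h1 h2
    rw [f2 _ _ h1, f2 _ _ h2, ← c, f2 _ _ h3, f2 _ _ h4, h.total_merges_merges h1 h2, signOf_zero,
      one_smul]

theorem proj_factor_cons {K F : Finset E} {e : E} {L L' : List E}
    (heq : signOf (M.tauList (insert e K) L) • proj (M.state F) (M.factor (insert e K) L) =
      signOf (M.tauList (insert e K) L') • proj (M.state F) (M.factor (insert e K) L')) :
    signOf (M.tauList K (e :: L)) • proj (M.state F) (M.factor K (e :: L)) =
      signOf (M.tauList K (e :: L')) • proj (M.state F) (M.factor K (e :: L')) := by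
  have := congrArg (fun x => signOf (M.tau K e) • (x * proj (M.state F)
    (OF.saddleFactor (M.state (insert e K)) (M.tail e) (M.head e)))) heq
  simp only [smul_mul_assoc] at this
  rw [tauList, tauList, signOf_add, signOf_add, mul_smul, mul_smul, factor, factor, map_mul,
    map_mul]
  exact this

theorem after_eq_of_mem_iff {K : Finset E} {L L' : List E} (h : ∀ e, e ∈ L ↔ e ∈ L') :
    after K L = after K L' := by
  ext e; rw [mem_after, mem_after, h]

/-- Admissible sets are closed under unions, so performing `e` early keeps every intermediate set
admissible. -/
theorem isPath_cons_of_mem (hM : M.IsPlanar adm) {K : Finset E} {e : E} {A B : List E}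
    (h : IsPath adm K (A ++ e :: B)) (he : adm (insert e K)) :
    e ∉ K ∧ IsPath adm (insert e K) (A ++ B) := by
  induction A generalizing K with
  | nil => exact ⟨h.2.1, h.2.2⟩
  | cons a A ih =>
    have ha := h.2.2.adm_left
    have hu : insert e (insert a K) = insert e K ∪ insert a K := by
      ext x; simp only [Finset.mem_insert, Finset.mem_union]; tauto
    have := ih h.2.2 (hu ▸ hM.union he ha)
    rw [Finset.mem_insert, not_or] at this
    refine ⟨this.1.2, he, ?_, ?_⟩
    · rw [Finset.mem_insert, not_or]
      exact ⟨fun k => this.1.1 k.symm, h.2.1⟩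
    · rw [Finset.insert_comm]; exact this.2

/-- The saddle `e` moves to the front past one saddle of `A` at a time, each time through one
square. -/
theorem signed_move (hM : M.IsPlanar adm) {K F : Finset E} {e : E} {A B : List E}
    (h : IsPath adm K (A ++ e :: B)) (he : adm (insert e K)) (hF : after K (A ++ e :: B) = F) :
    signOf (M.tauList K (A ++ e :: B)) • proj (M.state F) (M.factor K (A ++ e :: B)) =
      signOf (M.tauList K (e :: (A ++ B))) • proj (M.state F) (M.factor K (e :: (A ++ B))) := by
  induction A generalizing K with
  | nil => rfl
  | cons a A ih =>
    have ha := h.2.2.adm_left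
    have hu : insert e (insert a K) = insert e K ∪ insert a K := by
      ext x; simp only [Finset.mem_insert, Finset.mem_union]; tauto
    have hea : adm (insert e (insert a K)) := hu ▸ hM.union he ha
    have h1 := isPath_cons_of_mem hM h.2.2 hea
    have hae : a ≠ e := fun k => h1.1 (k ▸ Finset.mem_insert_self a K)
    have heK : e ∉ K := fun k => h1.1 (Finset.mem_insert_of_mem k)
    have hsq : M.IsSquare adm K a e := ⟨hM, h.2.1, heK, hae, h.1, ha, he⟩
    have hF2 : after (insert a K) (e :: (A ++ B)) = F := by
      rw [← hF]
      exact after_eq_of_mem_iff (L' := A ++ e :: B) (by simp; tauto)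
    refine (proj_factor_cons (L := A ++ e :: B) (ih h.2.2 hea hF)).trans ?_
    have hF3 : after (insert e (insert a K)) (A ++ B) = F := hF2
    have sq := hsq.proj_eq
    rw [← map_zsmul, ← map_zsmul] at sq
    -- The square gives an equality in the diagram after its two saddles; the remaining saddles `A
    -- ++ B` carry it to the final diagram.
    have := proj_factor_mul hM h1.2 sq
    rw [mul_smul_comm, mul_smul_comm, map_zsmul, map_zsmul, hF3] at this
    have c := Finset.insert_comm a e K
    simp only [List.cons_append, tauList, factor, mul_assoc]
    rw [c, ← add_assoc, ← add_assoc, add_comm _ (tauList _ _ _), add_comm _ (tauList _ _ _),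
      signOf_add (tauList _ _ _), signOf_add (tauList _ _ _), mul_smul, mul_smul, this]

/-- The signed value of a sequence of saddles does not depend on their order. -/
theorem signed_eq_of_perm (hM : M.IsPlanar adm) {K F : Finset E} {L L' : List E}
    (h : IsPath adm K L) (h' : IsPath adm K L') (hp : L.Perm L') (hF : after K L = F) :
    signOf (M.tauList K L) • proj (M.state F) (M.factor K L) =
      signOf (M.tauList K L') • proj (M.state F) (M.factor K L') := by
  induction L generalizing K L' with
  | nil => rw [List.nil_perm.1 hp]
  | cons e L ih =>
    obtain ⟨A, B, rfl⟩ := List.append_of_mem (hp.subset (List.mem_cons_self))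
    have he := h.2.2.adm_left
    have hp' : L.Perm (A ++ B) := List.perm_cons e |>.1 (hp.trans List.perm_middle)
    have h1 := isPath_cons_of_mem hM h' he
    have hF' : after K (A ++ e :: B) = F := by
      rw [← hF]; exact after_eq_of_mem_iff fun x => (hp.mem_iff).symm
    have hF1 : after (insert e K) (A ++ B) = F := by
      rw [← hF]; exact after_eq_of_mem_iff (K := insert e K) fun x => (hp'.mem_iff).symm
    rw [signed_move hM h' he hF']
    exact proj_factor_cons (ih h.2.2 h1.2 hp' hF)

end ColouredFamily


/-! ### Families of saddles in the plane -/

/-- `K'` arises from `K` by adding the new element `e`. -/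
def Finset.Adds {E : Type*} (K : Finset E) (e : E) (K' : Finset E) : Prop :=
  e ∉ K ∧ ∀ x, x ∈ K' ↔ x = e ∨ x ∈ K

/-- The inner parts of a family of planar diagrams: a matching `inner K` of the points for each set
`K` of saddles, and the matching `pairing` of the points which bound a common white interval.
`sideWhite c x` and `sideBlack c x` are the numbers, modulo `2`, of points, weighted by `c`, to the
left of the white or black interval adjacent to `x`. -/
structure StripSystem (E P : Type) where
  inner : Finset E → P → P
  pairing : P → P
  parity : P → Bool
  tail : E → P
  head : E → P
  black : E → Prop
  adm : Finset E → Prop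
  sideWhite : (P → ZMod 2) → P → ZMod 2
  sideBlack : (P → ZMod 2) → P → ZMod 2

namespace StripSystem

variable {E E' P P' : Type}

/-- The properties of strips. -/
structure IsStrip (S : StripSystem E P) : Prop where
  inner_matching : ∀ K, IsParityMatching S.parity (S.inner K)
  pairing_matching : IsParityMatching S.parity S.pairing
  parity_tail : ∀ e, S.parity (S.tail e) = true
  parity_head : ∀ e, S.parity (S.head e) = true
  tail_ne_head : ∀ e f, S.tail e ≠ S.head f
  tail_injective : Function.Injective S.tail
  exchange : ∀ {K e K'}, Finset.Adds K e K' →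
    IsExchange (S.inner K) (S.inner K') (S.tail e) (S.head e)
  adm_union : ∀ {K K' L}, S.adm K → S.adm K' → (∀ x, x ∈ L ↔ x ∈ K ∨ x ∈ K') → S.adm L
  separated_of_black : ∀ {K e K'}, Finset.Adds K e K' → S.adm K → S.adm K' → S.black e →
    ∃ Z : P → Prop, (∀ x, Z x → Z (S.inner K x)) ∧ (∀ x, Z x → Z (S.pairing x)) ∧
      Z (S.tail e) ∧ ¬ Z (S.head e)
  separated_of_not_black : ∀ {K e K'}, Finset.Adds K e K' → S.adm K → S.adm K' → ¬ S.black e →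
    ∃ Z : P → Prop, (∀ x, Z x → Z (S.inner K' x)) ∧ (∀ x, Z x → Z (S.pairing x)) ∧
      Z (S.head e) ∧ ¬ Z (S.tail e)
  sideWhite_eq : ∀ c x, S.sideWhite c x = S.sideBlack c x + c x
  sideWhite_pairing : ∀ c x, S.sideWhite c (S.pairing x) = S.sideWhite c x
  sideWhite_inner : ∀ {K c}, S.adm K → (∀ x, c (S.inner K x) = c x) →
    ∀ x, S.sideWhite c (S.inner K x) = S.sideWhite c x
  sideBlack_of_black : ∀ {K e K' c}, Finset.Adds K e K' → S.adm K → S.adm K' → S.black e →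
    (∀ x, c (S.inner K x) = c x) → S.sideBlack c (S.tail e) = S.sideBlack c (S.head e)
  sideBlack_of_not_black : ∀ {K e K' c}, Finset.Adds K e K' → S.adm K → S.adm K' → ¬ S.black e →
    (∀ x, c (S.inner K' x) = c x) → S.sideBlack c (S.tail e) = S.sideBlack c (S.head e)

/-- A matching of the points in the complement of the strips. -/
structure IsOuter (S : StripSystem E P) (O : P → P) : Prop where
  matching : IsParityMatching S.parity O
  side : ∀ c, (∀ x, c (O x) = c x) → ∀ x, S.sideWhite c (O x) = S.sideWhite c x

/-- The relation of lying in one white region. -/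
def whiteSetoid (S : StripSystem E P) (O : P → P) (K : Finset E) : Setoid P :=
  orbitSetoid (S.inner K) S.pairing ⊔ orbitSetoid O O

/-- The family of saddles in the diagrams completed by an outer matching. -/
def toFamily (S : StripSystem E P) (O : P → P) (rank : P → ℕ) (index : E → ℕ) :
    ColouredFamily E P where
  state K := orbitSetoid (S.inner K) O
  tail := S.tail
  head := S.head
  white := S.whiteSetoid O
  black := S.black
  rank := rank
  index := index

section

variable {S : StripSystem E P} {O : P → P}

theorem whiteSetoid_inner (K : Finset E) (x : P) : S.whiteSetoid O K x (S.inner K x) :=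
  (le_sup_left : _ ≤ S.whiteSetoid O K) (orbitSetoid_left _ _ _)

theorem whiteSetoid_pairing (K : Finset E) (x : P) : S.whiteSetoid O K x (S.pairing x) :=
  (le_sup_left : _ ≤ S.whiteSetoid O K) (orbitSetoid_right _ _ _)

theorem whiteSetoid_outer (K : Finset E) (x : P) : S.whiteSetoid O K x (O x) :=
  (le_sup_right : _ ≤ S.whiteSetoid O K) (orbitSetoid_left _ _ _)

theorem whiteSetoid_le {K : Finset E} {s : Setoid P} (h1 : ∀ x, s x (S.inner K x))
    (h2 : ∀ x, s x (S.pairing x)) (h3 : ∀ x, s x (O x)) : S.whiteSetoid O K ≤ s :=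
  sup_le (orbitSetoid_le h1 h2) (orbitSetoid_le h3 h3)

theorem orbitSetoid_le_whiteSetoid (K : Finset E) :
    orbitSetoid (S.inner K) O ≤ S.whiteSetoid O K :=
  orbitSetoid_le (whiteSetoid_inner K) (whiteSetoid_outer K)

/-- Two points which bound the same white region and whose black intervals lie on the same side of
each circle lie on the same circle. -/
theorem orbitSetoid_of_whiteSetoid (hS : S.IsStrip) (hO : S.IsOuter O) {K : Finset E}
    (hK : S.adm K) {x y : P} (h : S.whiteSetoid O K x y)
    (hb : ∀ c : P → ZMod 2, (∀ x, c (S.inner K x) = c x) → S.sideBlack c x = S.sideBlack c y) :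
    orbitSetoid (S.inner K) O x y := by
  classical
  -- The indicator function of the circle through `x`.
  let c : P → ZMod 2 := fun z => if orbitSetoid (S.inner K) O x z then 1 else 0
  have hc : ∀ {z z'}, orbitSetoid (S.inner K) O z z' → c z' = c z := fun {z z'} k => by
    have : orbitSetoid (S.inner K) O x z' ↔ orbitSetoid (S.inner K) O x z :=
      ⟨fun k' => Setoid.trans' _ k' (Setoid.symm' _ k), fun k' => Setoid.trans' _ k' k⟩
    simp only [c, this]
  have h1 : ∀ z, c (S.inner K z) = c z := fun z => hc (orbitSetoid_left _ _ z)
  have h2 : ∀ z, c (O z) = c z := fun z => hc (orbitSetoid_right _ _ z)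
  -- `sideWhite c` tells on which side of this circle a white interval lies. It is constant on every
  -- white region, which is the Jordan curve property in the form used here.
  have hle : S.whiteSetoid O K ≤ Setoid.ker (S.sideWhite c) :=
    whiteSetoid_le (fun z => (hS.sideWhite_inner hK h1 z).symm)
      (fun z => (hS.sideWhite_pairing c z).symm) (fun z => (hO.side c h2 z).symm)
  have e : S.sideWhite c x = S.sideWhite c y := hle h
  rw [hS.sideWhite_eq, hS.sideWhite_eq, hb c h1] at e
  have e2 : c x = c y := add_left_cancel e
  by_contra hn
  simp only [c, hn, if_false, if_pos (Setoid.refl' (orbitSetoid (S.inner K) O) x)] at e2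
  exact one_ne_zero e2

theorem not_orbitSetoid_of_closed {M Q : P → P} {x y : P} {Z : P → Prop}
    (h1 : ∀ z, Z z → Z (M z)) (h2 : ∀ z, Z z → Z (Q z)) (hM : ∀ z, M (M z) = z)
    (hQ : ∀ z, Q (Q z) = z) (hx : Z x) (hy : ¬ Z y) : ¬ orbitSetoid M Q x y := fun h => by
  have : orbitSetoid M Q ≤ Setoid.ker Z := orbitSetoid_le
    (fun z => propext ⟨h1 z, fun k => hM z ▸ h1 _ k⟩)
    (fun z => propext ⟨h2 z, fun k => hQ z ▸ h2 _ k⟩)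
  exact hy ((this h : Z x = Z y) ▸ hx)

open scoped Classical in
theorem adds_insert {K : Finset E} {e : E} (h : e ∉ K) : Finset.Adds K e (insert e K) :=
  ⟨h, fun _ => Finset.mem_insert⟩

open scoped Classical in
-- White regions inside the strips are the circles of the inner matching closed up by `pairing`, so
-- they undergo surgery for the same reason as the circles of the diagram. A set separating `tail`
-- from `head` decides which side of this surgery is the finer one, and the outer arcs are joined
-- afterwards.
theorem toFamily_isPlanar [Finite P] (hS : S.IsStrip) (hO : S.IsOuter O) {rank : P → ℕ}
    {index : E → ℕ} (hr : Function.Injective rank) (hi : Function.Injective index) :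
    (S.toFamily O rank index).IsPlanar S.adm := by
  -- The closing matching `Q` is the outer matching for circles and the pairing for white regions.
  have surgery : ∀ {K e}, e ∉ K → ∀ Q, IsParityMatching S.parity Q →
      (orbitSetoid (S.inner K) Q).IsSurgery (orbitSetoid (S.inner (insert e K)) Q)
        (S.tail e) (S.head e) := fun {K e} he Q hQ =>
    (hS.exchange (adds_insert he)).isSurgery (hS.inner_matching _) (hS.inner_matching _) hQ
      (hS.tail_ne_head e e) (hS.parity_tail e) (hS.parity_head e)
  refine ⟨fun h h' => hS.adm_union h h' fun _ => Finset.mem_union, hr, hi,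
    orbitSetoid_le_whiteSetoid, ?_, ?_, ?_, ?_, ?_, ?_, ?_⟩
  · intro K e he _ _
    exact surgery he O hO.matching
  · intro K e he h1 h2 hb
    obtain ⟨Z, z1, z2, z3, z4⟩ := hS.separated_of_black (adds_insert he) h1 h2 hb
    exact (surgery he _ hS.pairing_matching).sup (not_orbitSetoid_of_closed z1 z2
      (hS.inner_matching _).invol hS.pairing_matching.invol z3 z4) _
  · intro K e he h1 h2 hb
    obtain ⟨Z, z1, z2, z3, z4⟩ := hS.separated_of_not_black (adds_insert he) h1 h2 hb
    exact (surgery he _ hS.pairing_matching).symm.sup (fun k => not_orbitSetoid_of_closed z1 z2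
      (hS.inner_matching _).invol hS.pairing_matching.invol z3 z4 (Setoid.symm' _ k)) _
  · intro K e he h1 h2 hb h
    exact orbitSetoid_of_whiteSetoid hS hO h1 h fun c hc =>
      hS.sideBlack_of_black (adds_insert he) h1 h2 hb hc
  · intro K e he h1 h2 hb h
    exact orbitSetoid_of_whiteSetoid hS hO h2 h fun c hc =>
      hS.sideBlack_of_not_black (adds_insert he) h1 h2 hb hc
  · intro K e f he hf hne h1 h2 h3
    have hf' : f ∉ insert e K := by rw [Finset.mem_insert, not_or]; exact ⟨hne.symm, hf⟩
    exact (hS.exchange (adds_insert he)).not_orbitSetoid (hS.inner_matching _)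
      (hS.inner_matching _) (hS.inner_matching _) hO.matching (hS.exchange (adds_insert hf'))
      (hS.parity_tail e) (hS.parity_head e) (hS.parity_tail f) (hS.parity_head f) h2 h3 h1
      (fun k => hne (hS.tail_injective k))
  · intro K e f he hf hne h1 h2 h3
    have hf' : f ∉ insert e K := by rw [Finset.mem_insert, not_or]; exact ⟨hne.symm, hf⟩
    have hx := hS.exchange (adds_insert hf')
    exact (hS.exchange (adds_insert he)).not_orbitSetoid (hS.inner_matching _)
      (hS.inner_matching _) (hS.inner_matching _) hO.matching
      -- An exchange is symmetric in its two points, so `cross'` is `cross` with the ends of `f`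
      -- interchanged.
      ⟨hx.right, hx.left, fun x a b c d => hx.other x b a d c⟩
      (hS.parity_tail e) (hS.parity_head e) (hS.parity_head f) (hS.parity_tail f) h2 h3 h1
      (hS.tail_ne_head e f)

end

/-- Two systems of strips side by side. -/
def sum (S : StripSystem E P) (S' : StripSystem E' P') : StripSystem (E ⊕ E') (P ⊕ P') where
  inner K := Sum.map (S.inner K.toLeft) (S'.inner K.toRight)
  pairing := Sum.map S.pairing S'.pairing
  parity := Sum.elim S.parity S'.parity
  tail := Sum.map S.tail S'.tail
  head := Sum.map S.head S'.head
  black := Sum.elim S.black S'.black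
  adm K := S.adm K.toLeft ∧ S'.adm K.toRight
  sideWhite c := Sum.elim (S.sideWhite (c ∘ Sum.inl)) (S'.sideWhite (c ∘ Sum.inr))
  sideBlack c := Sum.elim (S.sideBlack (c ∘ Sum.inl)) (S'.sideBlack (c ∘ Sum.inr))

theorem adds_inl {K K' : Finset (E ⊕ E')} {e : E} (h : Finset.Adds K (Sum.inl e) K') :
    Finset.Adds K.toLeft e K'.toLeft ∧ K'.toRight = K.toRight := by
  refine ⟨⟨by simpa using h.1, fun x => by simp [h.2]⟩, ?_⟩
  ext x; simp [h.2]

theorem adds_inr {K K' : Finset (E ⊕ E')} {e : E'} (h : Finset.Adds K (Sum.inr e) K') :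
    Finset.Adds K.toRight e K'.toRight ∧ K'.toLeft = K.toLeft := by
  refine ⟨⟨by simpa using h.1, fun x => by simp [h.2]⟩, ?_⟩
  ext x; simp [h.2]

theorem IsStrip.sum {S : StripSystem E P} {S' : StripSystem E' P'} (h : S.IsStrip)
    (h' : S'.IsStrip) : (S.sum S').IsStrip where
  inner_matching K := by
    constructor <;> rintro (x | x)
    · exact congrArg Sum.inl ((h.inner_matching _).invol x)
    · exact congrArg Sum.inr ((h'.inner_matching _).invol x)
    · exact (h.inner_matching _).flip x
    · exact (h'.inner_matching _).flip x
  pairing_matching := by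
    constructor <;> rintro (x | x)
    · exact congrArg Sum.inl (h.pairing_matching.invol x)
    · exact congrArg Sum.inr (h'.pairing_matching.invol x)
    · exact h.pairing_matching.flip x
    · exact h'.pairing_matching.flip x
  parity_tail := by rintro (e | e); exacts [h.parity_tail e, h'.parity_tail e]
  parity_head := by rintro (e | e); exacts [h.parity_head e, h'.parity_head e]
  tail_ne_head := by
    rintro (e | e) (f | f)
    · exact fun k => h.tail_ne_head e f (Sum.inl_injective k)
    · exact fun k => nomatch k
    · exact fun k => nomatch k
    · exact fun k => h'.tail_ne_head e f (Sum.inr_injective k)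
  tail_injective := Function.Injective.sumMap h.tail_injective h'.tail_injective
  exchange := by
    rintro K (e | e) K' hK
    · obtain ⟨a, b⟩ := adds_inl hK
      have x := h.exchange a
      refine ⟨congrArg Sum.inl x.left, congrArg Sum.inl x.right, ?_⟩
      rintro (y | y) h1 h2 h3 h4
      · exact congrArg Sum.inl (x.other y (fun k => h1 (congrArg Sum.inl k))
          (fun k => h2 (congrArg Sum.inl k)) (fun k => h3 (congrArg Sum.inl k))
          (fun k => h4 (congrArg Sum.inl k)))
      · simp only [StripSystem.sum, Sum.map_inr, b]
    · obtain ⟨a, b⟩ := adds_inr hK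
      have x := h'.exchange a
      refine ⟨congrArg Sum.inr x.left, congrArg Sum.inr x.right, ?_⟩
      rintro (y | y) h1 h2 h3 h4
      · simp only [StripSystem.sum, Sum.map_inl, b]
      · exact congrArg Sum.inr (x.other y (fun k => h1 (congrArg Sum.inr k))
          (fun k => h2 (congrArg Sum.inr k)) (fun k => h3 (congrArg Sum.inr k))
          (fun k => h4 (congrArg Sum.inr k)))
  adm_union h1 h2 h3 := ⟨h.adm_union h1.1 h2.1 fun x => by simp [h3],
    h'.adm_union h1.2 h2.2 fun x => by simp [h3]⟩
  separated_of_black := by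
    rintro K (e | e) K' hK h1 h2 hb
    · obtain ⟨Z, z1, z2, z3, z4⟩ := h.separated_of_black (adds_inl hK).1 h1.1 h2.1 hb
      exact ⟨Sum.elim Z fun _ => False, by rintro (x | x) k; exacts [z1 x k, k],
        by rintro (x | x) k; exacts [z2 x k, k], z3, z4⟩
    · obtain ⟨Z, z1, z2, z3, z4⟩ := h'.separated_of_black (adds_inr hK).1 h1.2 h2.2 hb
      exact ⟨Sum.elim (fun _ => False) Z, by rintro (x | x) k; exacts [k, z1 x k],
        by rintro (x | x) k; exacts [k, z2 x k], z3, z4⟩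
  separated_of_not_black := by
    rintro K (e | e) K' hK h1 h2 hb
    · obtain ⟨Z, z1, z2, z3, z4⟩ := h.separated_of_not_black (adds_inl hK).1 h1.1 h2.1 hb
      exact ⟨Sum.elim Z fun _ => False, by rintro (x | x) k; exacts [z1 x k, k],
        by rintro (x | x) k; exacts [z2 x k, k], z3, z4⟩
    · obtain ⟨Z, z1, z2, z3, z4⟩ := h'.separated_of_not_black (adds_inr hK).1 h1.2 h2.2 hb
      exact ⟨Sum.elim (fun _ => False) Z, by rintro (x | x) k; exacts [k, z1 x k],
        by rintro (x | x) k; exacts [k, z2 x k], z3, z4⟩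
  sideWhite_eq c := by
    rintro (x | x); exacts [h.sideWhite_eq _ x, h'.sideWhite_eq _ x]
  sideWhite_pairing c := by
    rintro (x | x); exacts [h.sideWhite_pairing _ x, h'.sideWhite_pairing _ x]
  sideWhite_inner {K c} hK hc := by
    rintro (x | x)
    · exact h.sideWhite_inner hK.1 (fun y => hc (Sum.inl y)) x
    · exact h'.sideWhite_inner hK.2 (fun y => hc (Sum.inr y)) x
  sideBlack_of_black := by
    rintro K (e | e) K' c hK h1 h2 hb hc
    · exact h.sideBlack_of_black (adds_inl hK).1 h1.1 h2.1 hb (fun y => hc (Sum.inl y))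
    · exact h'.sideBlack_of_black (adds_inr hK).1 h1.2 h2.2 hb (fun y => hc (Sum.inr y))
  sideBlack_of_not_black := by
    rintro K (e | e) K' c hK h1 h2 hb hc
    · exact h.sideBlack_of_not_black (adds_inl hK).1 h1.1 h2.1 hb (fun y => hc (Sum.inl y))
    · exact h'.sideBlack_of_not_black (adds_inr hK).1 h1.2 h2.2 hb (fun y => hc (Sum.inr y))

end StripSystem


/-! ### The strip of a crossingless matching -/

namespace CrossinglessMatching

variable {n : ℕ} (b : CrossinglessMatching n)

/-- The arc with a given end point. -/
def arcOf (i : Fin (2 * n)) : b.Arc :=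
  if h : i < b.partner i then ⟨i, h⟩
  else ⟨b.partner i, by
    rw [b.partner_partner]; exact lt_of_le_of_ne (not_lt.1 h) (b.partner_ne i)⟩

variable {b}

theorem arcOf_left (e : b.Arc) : b.arcOf e.1 = e := by simp [arcOf, e.2]

@[simp] theorem arcOf_partner (i : Fin (2 * n)) : b.arcOf (b.partner i) = b.arcOf i := by
  unfold arcOf
  rcases lt_or_gt_of_ne (b.partner_ne i) with h | h
  · simp [b.partner_partner, h, h.not_gt]
  · simp [b.partner_partner, h, h.not_gt]

theorem arcOf_right (e : b.Arc) : b.arcOf e.right = e := by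
  rw [Arc.right, arcOf_partner, arcOf_left]

theorem partner_right (e : b.Arc) : b.partner e.right = e.1 := b.partner_partner _

theorem arcOf_eq_iff {i : Fin (2 * n)} {e : b.Arc} : b.arcOf i = e ↔ i = e.1 ∨ i = e.right := by
  constructor
  · rintro rfl
    unfold arcOf
    split_ifs
    · exact Or.inl rfl
    · exact Or.inr (by simp [Arc.right, b.partner_partner])
  · rintro (rfl | rfl)
    exacts [arcOf_left e, arcOf_right e]

theorem left_lt_right (e : b.Arc) : e.1 < e.right := e.2

/-- The arc of a point between the end points of an arc lies inside this arc. -/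
theorem arcOf_between {e : b.Arc} {i : Fin (2 * n)} (h1 : e.1 < i) (h2 : i < e.right) :
    e.Surrounds (b.arcOf i) := by
  have key : ∀ j, e.1 < j → j < e.right → e.1 < b.partner j ∧ b.partner j < e.right := by
    intro j h1 h2
    have h3 := b.noncrossing e.1 j h1 h2
    refine ⟨?_, h3⟩
    by_contra hlt
    have hne : b.partner j ≠ e.1 := fun k => h2.ne (by
      rw [Arc.right, ← k, b.partner_partner])
    have := b.noncrossing (b.partner j) e.1 (lt_of_le_of_ne (not_lt.1 hlt) hne)
      (by rwa [b.partner_partner])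
    rw [b.partner_partner] at this
    exact this.not_gt h2
  obtain ⟨h3, h4⟩ := key i h1 h2
  unfold Arc.Surrounds arcOf
  split_ifs with h
  · exact ⟨h1, h4⟩
  · exact ⟨h3, by simpa [Arc.right, b.partner_partner] using h2⟩

theorem even_right (e : b.Arc) : Even e.right.val ↔ ¬ Even e.1.val := even_partner b e.1

/-- A set of arcs is admissible if it contains each arc surrounding one of its arcs. -/
def Admissible (K : Finset b.Arc) : Prop := ∀ e ∈ K, ∀ f : b.Arc, f.Surrounds e → f ∈ K

/-- The end point at an even position. -/
def evenEnd (e : b.Arc) : Fin (2 * n) := if Even e.1.val then e.1 else e.right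

/-- The end point at an odd position. -/
def oddEnd (e : b.Arc) : Fin (2 * n) := if Even e.1.val then e.right else e.1

theorem even_evenEnd (e : b.Arc) : Even (evenEnd e).val := by
  unfold evenEnd; split_ifs with h
  · exact h
  · exact (even_right e).2 h

theorem partner_evenEnd (e : b.Arc) : b.partner (evenEnd e) = oddEnd e := by
  unfold evenEnd oddEnd; split_ifs
  exacts [rfl, partner_right e]

theorem partner_oddEnd (e : b.Arc) : b.partner (oddEnd e) = evenEnd e := by
  rw [← partner_evenEnd, b.partner_partner]

theorem arcOf_evenEnd (e : b.Arc) : b.arcOf (evenEnd e) = e := by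
  unfold evenEnd; split_ifs
  exacts [arcOf_left e, arcOf_right e]

theorem arcOf_oddEnd (e : b.Arc) : b.arcOf (oddEnd e) = e := by
  rw [← partner_evenEnd, arcOf_partner, arcOf_evenEnd]

theorem arcOf_eq_iff' {i : Fin (2 * n)} {e : b.Arc} :
    b.arcOf i = e ↔ i = evenEnd e ∨ i = oddEnd e := by
  rw [arcOf_eq_iff]; unfold evenEnd oddEnd; split_ifs <;> tauto

end CrossinglessMatching

/-- The other end of the white interval at a point. -/
def mate {n : ℕ} (i : Fin (2 * n)) : Fin (2 * n) :=
  if Even i.val then ⟨2 * (i.val / 2) + 1, by have := i.2; omega⟩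
  else ⟨2 * (i.val / 2), by have := i.2; omega⟩

theorem mate_mate {n : ℕ} (i : Fin (2 * n)) : mate (mate i) = i := by
  by_cases h : Even i.val
  · have h' : ¬ Even (2 * (i.val / 2) + 1) := by rw [Nat.even_iff]; omega
    rw [Nat.even_iff] at h
    ext
    simp only [mate, Nat.even_iff.2 h, if_true, h', if_false]
    omega
  · have h' : Even (2 * (i.val / 2)) := by rw [Nat.even_iff]; omega
    ext
    simp only [mate, h, if_true, h', if_false]
    rw [Nat.even_iff] at h
    omega

theorem mate_div {n : ℕ} (i : Fin (2 * n)) : (mate i).val / 2 = i.val / 2 := by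
  unfold mate
  split_ifs
  · change (2 * (i.val / 2) + 1) / 2 = _; omega
  · change 2 * (i.val / 2) / 2 = _; omega

theorem even_mate {n : ℕ} (i : Fin (2 * n)) : Even (mate i).val ↔ ¬ Even i.val := by
  unfold mate; split_ifs with h <;> simp only [Nat.even_iff] at * <;> omega

/-! Sums over the points of a line to the left of a position -/

section Prefix

variable {n : ℕ} {u v : Fin (2 * n) → ZMod 2} {b : CrossinglessMatching n}

/-- The sum of `u` over the points before position `k`. -/
def prefixSum (u : Fin (2 * n) → ZMod 2) (k : ℕ) : ZMod 2 :=
  ∑ z ∈ Finset.univ.filter (fun z : Fin (2 * n) => z.val < k), u z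

theorem sum_eq_zero_of_partner {T : Finset (Fin (2 * n))} (h1 : ∀ z ∈ T, b.partner z ∈ T)
    (h2 : ∀ z ∈ T, u (b.partner z) = u z) : ∑ z ∈ T, u z = 0 :=
  Finset.sum_involution (fun z _ => b.partner z)
    (fun z hz => by rw [h2 z hz, CharTwo.add_self_eq_zero]) (fun z _ _ => b.partner_ne z)
    h1 (fun z _ => b.partner_partner z)

theorem prefixSum_add {k k' : ℕ} (h : k ≤ k') : prefixSum u k' = prefixSum u k +
    ∑ z ∈ Finset.univ.filter (fun z : Fin (2 * n) => k ≤ z.val ∧ z.val < k'), u z := by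
  unfold prefixSum
  rw [← Finset.sum_union]
  · congr 1
    ext z
    simp only [Finset.mem_filter, Finset.mem_univ, true_and, Finset.mem_union]
    omega
  · rw [Finset.disjoint_left]
    intro z
    simp only [Finset.mem_filter, Finset.mem_univ, true_and]
    omega

theorem prefixSum_succ (i : Fin (2 * n)) : prefixSum u (i.val + 1) = prefixSum u i.val + u i := by
  rw [prefixSum_add (Nat.le_succ _)]
  congr 1
  rw [← Finset.sum_singleton u i]
  congr 1
  ext z
  simp only [Finset.mem_filter, Finset.mem_univ, true_and, Finset.mem_singleton, Fin.ext_iff]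
  omega

/-- An arc together with all points under it is closed under `partner`, so these points cancel in
pairs modulo `2`. -/
theorem prefixSum_closed {e : b.Arc} (h : ∀ z, e.1 ≤ z → z ≤ e.right → u (b.partner z) = u z) :
    prefixSum u (e.right.val + 1) = prefixSum u e.1.val := by
  have hlt : e.1.val < e.right.val := CrossinglessMatching.left_lt_right e
  rw [prefixSum_add (k := e.1.val) (by omega),
    sum_eq_zero_of_partner (b := b), add_zero]
  · intro z hz
    simp only [Finset.mem_filter, Finset.mem_univ, true_and, Nat.lt_succ_iff] at hz ⊢
    by_cases h1 : z = e.1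
    · rw [h1]; change _ ∧ e.right.val ≤ e.right.val; exact ⟨hlt.le, le_rfl⟩
    by_cases h2 : z = e.right
    · rw [h2, CrossinglessMatching.partner_right]; exact ⟨le_rfl, hlt.le⟩
    have h3 := CrossinglessMatching.arcOf_between (e := e) (i := z)
      (lt_of_le_of_ne hz.1 (Ne.symm h1)) (lt_of_le_of_ne hz.2 h2)
    obtain h4 | h4 := CrossinglessMatching.arcOf_eq_iff.1 (rfl : b.arcOf z = b.arcOf z)
    · have : b.partner z = (b.arcOf z).right := congrArg b.partner h4
      rw [this]
      exact ⟨(h3.1.trans (CrossinglessMatching.left_lt_right _)).le, h3.2.le⟩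
    · have : b.partner z = (b.arcOf z).1 :=
        (congrArg b.partner h4).trans (CrossinglessMatching.partner_right _)
      rw [this]
      exact ⟨h3.1.le, ((CrossinglessMatching.left_lt_right _).trans h3.2).le⟩
  · intro z hz
    simp only [Finset.mem_filter, Finset.mem_univ, true_and, Nat.lt_succ_iff] at hz
    exact h z hz.1 hz.2

theorem prefixSum_open {e : b.Arc} (h : ∀ z, e.1 < z → z < e.right → u (b.partner z) = u z) :
    prefixSum u e.right.val = prefixSum u (e.1.val + 1) := by
  classical
  -- Nothing is assumed of `u` at the ends of `e`, so these values are replaced by zero to reach the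
  -- closed case.
  let v : Fin (2 * n) → ZMod 2 := fun z => if b.arcOf z = e then 0 else u z
  have hlt : e.1.val < e.right.val := CrossinglessMatching.left_lt_right e
  have hv := prefixSum_closed (u := v) (e := e) fun z h1 h2 => by
    simp only [v, CrossinglessMatching.arcOf_partner]
    split_ifs with h3
    · rfl
    · rw [CrossinglessMatching.arcOf_eq_iff, not_or] at h3
      exact h z (lt_of_le_of_ne h1 (Ne.symm h3.1)) (lt_of_le_of_ne h2 h3.2)
  have e1 : v e.right = 0 := by simp [v, CrossinglessMatching.arcOf_right]
  have e2 : v e.1 = 0 := by simp [v, CrossinglessMatching.arcOf_left]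
  rw [prefixSum_succ, e1, add_zero] at hv
  have hv2 : prefixSum v (e.1.val + 1) = prefixSum v e.1.val := by
    rw [prefixSum_succ, e2, add_zero]
  rw [← hv2, prefixSum_add (k := e.1.val + 1) hlt] at hv
  rw [prefixSum_add (k := e.1.val + 1) hlt]
  rw [add_eq_left] at hv ⊢
  rw [← hv]
  refine Finset.sum_congr rfl fun z hz => ?_
  simp only [Finset.mem_filter, Finset.mem_univ, true_and] at hz
  have : b.arcOf z ≠ e := fun k => by
    rcases CrossinglessMatching.arcOf_eq_iff.1 k with rfl | rfl <;> omega
  simp only [v, if_neg this]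

/-- Two functions have the same sum before `k` if no arc on which they may differ straddles `k`. -/
theorem prefixSum_eq {k : ℕ} {K : Finset b.Arc} (hK : ∀ z, b.arcOf z ∈ K → u z = v z)
    (hu : ∀ z, b.arcOf z ∉ K → u (b.partner z) = u z)
    (hv : ∀ z, b.arcOf z ∉ K → v (b.partner z) = v z)
    (h : ∀ e : b.Arc, e ∉ K → e.1.val < k → e.right.val < k) : prefixSum u k = prefixSum v k := by
  classical
  have key : prefixSum u k + prefixSum v k = 0 := by
    unfold prefixSum
    rw [← Finset.sum_add_distrib, ← Finset.sum_filter_add_sum_filter_not _ (b.arcOf · ∈ K),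
      Finset.sum_eq_zero, sum_eq_zero_of_partner (b := b), add_zero]
    · intro z hz
      simp only [Finset.mem_filter, Finset.mem_univ, true_and,
        CrossinglessMatching.arcOf_partner] at hz ⊢
      refine ⟨?_, hz.2⟩
      have hh := h _ hz.2
      obtain h4 | h4 := CrossinglessMatching.arcOf_eq_iff.1 (rfl : b.arcOf z = b.arcOf z)
      · have : b.partner z = (b.arcOf z).right := congrArg b.partner h4
        rw [this]; exact hh (h4 ▸ hz.1)
      · have : b.partner z = (b.arcOf z).1 :=
          (congrArg b.partner h4).trans (CrossinglessMatching.partner_right _)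
        rw [this]
        have h5 : (b.arcOf z).1.val < (b.arcOf z).right.val :=
          CrossinglessMatching.left_lt_right _
        have h6 : z.val = (b.arcOf z).right.val := congrArg Fin.val h4
        omega
    · intro z hz
      simp only [Finset.mem_filter] at hz
      rw [hu z hz.2, hv z hz.2]
    · intro z hz
      simp only [Finset.mem_filter] at hz
      rw [hK z hz.2, CharTwo.add_self_eq_zero]
  rwa [CharTwo.add_eq_zero] at key

/-- The sum over the points to the left of the white interval at a point. -/
def leftOfWhite (u : Fin (2 * n) → ZMod 2) (i : Fin (2 * n)) : ZMod 2 :=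
  prefixSum u (2 * (i.val / 2) + 1)

/-- The sum over the points to the left of the black interval at a point. -/
def leftOfBlack (u : Fin (2 * n) → ZMod 2) (i : Fin (2 * n)) : ZMod 2 :=
  prefixSum u (2 * ((i.val + 1) / 2))

theorem leftOfWhite_of_even {i : Fin (2 * n)} (h : Even i.val) :
    leftOfWhite u i = prefixSum u (i.val + 1) := by
  rw [Nat.even_iff] at h; unfold leftOfWhite; congr 1; omega

theorem leftOfWhite_of_odd {i : Fin (2 * n)} (h : ¬ Even i.val) :
    leftOfWhite u i = prefixSum u i.val := by
  rw [Nat.even_iff] at h; unfold leftOfWhite; congr 1; omega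

theorem leftOfBlack_of_even {i : Fin (2 * n)} (h : Even i.val) :
    leftOfBlack u i = prefixSum u i.val := by
  rw [Nat.even_iff] at h; unfold leftOfBlack; congr 1; omega

theorem leftOfBlack_of_odd {i : Fin (2 * n)} (h : ¬ Even i.val) :
    leftOfBlack u i = prefixSum u (i.val + 1) := by
  rw [Nat.even_iff] at h; unfold leftOfBlack; congr 1; omega

theorem leftOfWhite_eq (u : Fin (2 * n) → ZMod 2) (i : Fin (2 * n)) :
    leftOfWhite u i = leftOfBlack u i + u i := by
  by_cases h : Even i.val
  · rw [leftOfWhite_of_even h, leftOfBlack_of_even h, prefixSum_succ]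
  · rw [leftOfWhite_of_odd h, leftOfBlack_of_odd h, prefixSum_succ, add_assoc,
      CharTwo.add_self_eq_zero, add_zero]

theorem leftOfWhite_mate (i : Fin (2 * n)) : leftOfWhite u (mate i) = leftOfWhite u i := by
  unfold leftOfWhite; rw [mate_div]

/-- If the left end is even, the white intervals at both ends lie under the arc and only the points
strictly under it count; otherwise they lie outside and the ends count too. -/
theorem leftOfWhite_right {e : b.Arc}
    (h : ∀ z, e.1 ≤ z → z ≤ e.right → u (b.partner z) = u z) :
    leftOfWhite u e.right = leftOfWhite u e.1 := by
  by_cases he : Even e.1.val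
  · rw [leftOfWhite_of_even he, leftOfWhite_of_odd (by
      rw [CrossinglessMatching.even_right]; exact not_not.2 he)]
    exact prefixSum_open fun z h1 h2 => h z h1.le h2.le
  · rw [leftOfWhite_of_odd he, leftOfWhite_of_even
      ((CrossinglessMatching.even_right e).2 he)]
    exact prefixSum_closed h

theorem leftOfWhite_partner {i : Fin (2 * n)} (h : ∀ z, (b.arcOf i).1 ≤ z →
    z ≤ (b.arcOf i).right → u (b.partner z) = u z) :
    leftOfWhite u (b.partner i) = leftOfWhite u i := by
  have := leftOfWhite_right h
  obtain h4 | h4 := CrossinglessMatching.arcOf_eq_iff.1 (rfl : b.arcOf i = b.arcOf i)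
  · have h5 : b.partner i = (b.arcOf i).right := congrArg b.partner h4
    rw [h5, this, ← h4]
  · have h5 : b.partner i = (b.arcOf i).1 :=
      (congrArg b.partner h4).trans (CrossinglessMatching.partner_right _)
    rw [h5, ← this, ← h4]

end Prefix

/-! ### Planarity of the strip in which the arcs of a matching are contracted -/

namespace CrossinglessMatching

variable {n : ℕ} (b : CrossinglessMatching n)

open scoped Classical in
/-- The matching of the points of the two lines by the parts between them of the diagram in which
the arcs in `K` are contracted. -/
noncomputable def stripMatch (K : Finset b.Arc) :
    Fin (2 * n) ⊕ Fin (2 * n) → Fin (2 * n) ⊕ Fin (2 * n) :=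
  Sum.elim (fun i => if b.arcOf i ∈ K then Sum.inr i else Sum.inl (b.partner i))
    (fun i => if b.arcOf i ∈ K then Sum.inl i else Sum.inr (b.partner i))

/-- The strip between the two lines of points in `W(c)bW(b)a`. -/
noncomputable def strip : StripSystem b.Arc (Fin (2 * n) ⊕ Fin (2 * n)) where
  inner := b.stripMatch
  pairing := Sum.map mate mate
  parity := Sum.elim (fun i => decide (Even i.val)) (fun i => !decide (Even i.val))
  tail e := Sum.inl (evenEnd e)
  head e := Sum.inr (oddEnd e)
  black e := Even e.1.val
  adm := Admissible
  sideWhite c := Sum.elim (leftOfWhite (c ∘ Sum.inl)) (leftOfWhite (c ∘ Sum.inr))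
  sideBlack c := Sum.elim (leftOfBlack (c ∘ Sum.inl)) (leftOfBlack (c ∘ Sum.inr))

variable {b} {K K' : Finset b.Arc} {e : b.Arc}

theorem stripMatch_inl_of_mem {i : Fin (2 * n)} (h : b.arcOf i ∈ K) :
    b.stripMatch K (Sum.inl i) = Sum.inr i := by simp [stripMatch, h]

theorem stripMatch_inr_of_mem {i : Fin (2 * n)} (h : b.arcOf i ∈ K) :
    b.stripMatch K (Sum.inr i) = Sum.inl i := by simp [stripMatch, h]

theorem stripMatch_inl_of_notMem {i : Fin (2 * n)} (h : b.arcOf i ∉ K) :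
    b.stripMatch K (Sum.inl i) = Sum.inl (b.partner i) := by simp [stripMatch, h]

theorem stripMatch_inr_of_notMem {i : Fin (2 * n)} (h : b.arcOf i ∉ K) :
    b.stripMatch K (Sum.inr i) = Sum.inr (b.partner i) := by simp [stripMatch, h]

/-- The even end above and the odd end below have the same colour, and each new vertical strand
joins one of them to the old partner of the other. -/
theorem strip_exchange (h : Finset.Adds K e K') :
    IsExchange (b.stripMatch K) (b.stripMatch K') (Sum.inl (evenEnd e)) (Sum.inr (oddEnd e)) := by
  have he : e ∈ K' := (h.2 e).2 (Or.inl rfl)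
  have h1 : b.arcOf (evenEnd e) ∉ K := by rw [arcOf_evenEnd]; exact h.1
  have h2 : b.arcOf (oddEnd e) ∉ K := by rw [arcOf_oddEnd]; exact h.1
  refine ⟨?_, ?_, ?_⟩
  · rw [stripMatch_inl_of_mem (by rwa [arcOf_evenEnd]), stripMatch_inr_of_notMem h2,
      partner_oddEnd]
  · rw [stripMatch_inr_of_mem (by rwa [arcOf_oddEnd]), stripMatch_inl_of_notMem h1,
      partner_evenEnd]
  · rw [stripMatch_inl_of_notMem h1, stripMatch_inr_of_notMem h2, partner_evenEnd, partner_oddEnd]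
    intro x k1 k2 k3 k4
    have key : ∀ i, b.arcOf i ≠ e → (b.arcOf i ∈ K' ↔ b.arcOf i ∈ K) := fun i hi => by
      rw [h.2]; tauto
    rcases x with i | i
    · have : b.arcOf i ≠ e := by
        rw [Ne, arcOf_eq_iff', not_or]
        exact ⟨fun k => k1 (k ▸ rfl), fun k => k3 (k ▸ rfl)⟩
      simp only [stripMatch, Sum.elim_inl, key i this]
    · have : b.arcOf i ≠ e := by
        rw [Ne, arcOf_eq_iff', not_or]
        exact ⟨fun k => k4 (k ▸ rfl), fun k => k2 (k ▸ rfl)⟩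
      simp only [stripMatch, Sum.elim_inr, key i this]

/-- A contracted arc under `e` would force `e` to be contracted before it. -/
theorem notMem_of_between (hK : Admissible K) (he : e ∉ K) {z : Fin (2 * n)} (h1 : e.1 ≤ z)
    (h2 : z ≤ e.right) : b.arcOf z ∉ K := fun hz => by
  by_cases h3 : b.arcOf z = e
  · exact he (h3 ▸ hz)
  · have h4 := h3
    rw [arcOf_eq_iff, not_or] at h4
    exact he (hK _ hz e (arcOf_between (lt_of_le_of_ne h1 (Ne.symm h4.1))
      (lt_of_le_of_ne h2 h4.2)))

theorem partner_between {z : Fin (2 * n)} (h1 : e.1 ≤ z) (h2 : z ≤ e.right) :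
    e.1 ≤ b.partner z ∧ b.partner z ≤ e.right := by
  have hlt := left_lt_right e
  by_cases h3 : b.arcOf z = e
  · rcases arcOf_eq_iff.1 h3 with rfl | rfl
    · exact ⟨hlt.le, le_rfl⟩
    · rw [partner_right]; exact ⟨le_rfl, hlt.le⟩
  · rw [arcOf_eq_iff, not_or] at h3
    have h5 := arcOf_between (lt_of_le_of_ne h1 (Ne.symm h3.1)) (lt_of_le_of_ne h2 h3.2)
    have h6 := left_lt_right (b.arcOf z)
    rcases arcOf_eq_iff.1 (arcOf_partner (b := b) z) with k | k <;> rw [k]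
    · exact ⟨h5.1.le, (h6.trans h5.2).le⟩
    · exact ⟨(h5.1.trans h6).le, h5.2.le⟩

/-- An arc which straddles an end point of another arc surrounds it. -/
theorem surrounds_of_straddle {f : b.Arc} {z : Fin (2 * n)} (h : f ≠ b.arcOf z) (h1 : f.1 ≤ z)
    (h2 : z ≤ f.right) : f.Surrounds (b.arcOf z) := by
  have h3 := h.symm
  rw [Ne, arcOf_eq_iff, not_or] at h3
  exact arcOf_between (lt_of_le_of_ne h1 (Ne.symm h3.1)) (lt_of_le_of_ne h2 h3.2)

theorem strip_separated_of_black (hK : Finset.Adds K e K') (h1 : Admissible K)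
    (hb : Even e.1.val) : ∃ Z : Fin (2 * n) ⊕ Fin (2 * n) → Prop,
      (∀ x, Z x → Z (b.stripMatch K x)) ∧ (∀ x, Z x → Z (Sum.map mate mate x)) ∧
      Z (Sum.inl (evenEnd e)) ∧ ¬ Z (Sum.inr (oddEnd e)) := by
  -- The points of the upper line at or under `e`. None of them has been contracted, and the white
  -- intervals at the ends lie under the arc, so nothing leaves this set.
  refine ⟨Sum.elim (fun z => e.1 ≤ z ∧ z ≤ e.right) fun _ => False, ?_, ?_, ?_, fun k => k⟩
  · rintro (z | z) hz
    · rw [stripMatch_inl_of_notMem (notMem_of_between h1 hK.1 hz.1 hz.2)]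
      exact partner_between hz.1 hz.2
    · exact hz.elim
  · rintro (z | z) hz
    · have hr := (even_right e).not.2 (not_not.2 hb)
      obtain ⟨ha, hb'⟩ := hz
      rw [Fin.le_def] at ha hb'
      rw [Nat.even_iff] at hb hr
      simp only [Sum.map_inl, Sum.elim_inl, Fin.le_def, mate]
      split_ifs with k <;> rw [Nat.even_iff] at k <;> simp only <;> omega
    · exact hz.elim
  · have hlt := left_lt_right e
    simp only [evenEnd, if_pos hb, Sum.elim_inl]
    exact ⟨le_rfl, hlt.le⟩

theorem strip_separated_of_not_black (hK : Finset.Adds K e K') (h2 : Admissible K')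
    (hb : ¬ Even e.1.val) : ∃ Z : Fin (2 * n) ⊕ Fin (2 * n) → Prop,
      (∀ x, Z x → Z (b.stripMatch K' x)) ∧ (∀ x, Z x → Z (Sum.map mate mate x)) ∧
      Z (Sum.inr (oddEnd e)) ∧ ¬ Z (Sum.inl (evenEnd e)) := by
  have he : e ∈ K' := (hK.2 e).2 (Or.inl rfl)
  have hlt := left_lt_right e
  have key : ∀ z, z ≤ e.1 → b.arcOf z ∉ K' → b.partner z ≤ e.1 := fun z hz hz' => by
    by_contra hgt
    rw [not_le] at hgt
    have h3 : b.arcOf z ≠ b.arcOf e.1 := fun k => hz' (by rwa [k, arcOf_left])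
    have hl : z < b.partner z := hz.trans_lt hgt
    have h4 : b.arcOf z = ⟨z, hl⟩ := by simp [arcOf, hl]
    refine hz' (h2 e he _ ?_)
    have := surrounds_of_straddle h3 (by rw [h4]; exact hz) (by rw [h4]; exact hgt.le)
    rwa [arcOf_left] at this
  -- The points of both lines up to the left end of `e`. Once `e` is contracted so are all arcs
  -- above it, so no arc passes over this position; it is odd, so no white interval straddles it on
  -- the right.
  refine ⟨Sum.elim (fun z => z ≤ e.1) (fun z => z ≤ e.1), ?_, ?_, ?_, ?_⟩
  · rintro (z | z) hz
    · by_cases h : b.arcOf z ∈ K'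
      · rw [stripMatch_inl_of_mem h]; exact hz
      · rw [stripMatch_inl_of_notMem h]; exact key z hz h
    · by_cases h : b.arcOf z ∈ K'
      · rw [stripMatch_inr_of_mem h]; exact hz
      · rw [stripMatch_inr_of_notMem h]; exact key z hz h
  · have mk : ∀ z : Fin (2 * n), z ≤ e.1 → mate z ≤ e.1 := fun z hz => by
      rw [Fin.le_def] at hz ⊢
      rw [Nat.even_iff] at hb
      unfold mate
      split_ifs with k <;> rw [Nat.even_iff] at k <;> simp only <;> omega
    rintro (z | z) hz
    exacts [mk z hz, mk z hz]
  · simp only [oddEnd, if_neg hb, Sum.elim_inr, le_refl]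
  · simp only [evenEnd, if_neg hb, Sum.elim_inl, not_le]
    exact hlt

theorem eq_partner_of_stripMatch {c : Fin (2 * n) ⊕ Fin (2 * n) → ZMod 2}
    (hc : ∀ x, c (b.stripMatch K x) = c x) {z : Fin (2 * n)} (h : b.arcOf z ∉ K) :
    (c ∘ Sum.inl) (b.partner z) = (c ∘ Sum.inl) z ∧
      (c ∘ Sum.inr) (b.partner z) = (c ∘ Sum.inr) z := by
  have h1 := hc (Sum.inl z)
  have h2 := hc (Sum.inr z)
  rw [stripMatch_inl_of_notMem h] at h1
  rw [stripMatch_inr_of_notMem h] at h2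
  exact ⟨h1, h2⟩

/-- At contracted points `c` agrees on the two lines because the strands are vertical, and the
remaining points to the left of `k` cancel along uncontracted arcs that do not straddle `k`. -/
theorem prefixSum_inl_eq_inr {c : Fin (2 * n) ⊕ Fin (2 * n) → ZMod 2}
    (hc : ∀ x, c (b.stripMatch K x) = c x) {k : ℕ}
    (h : ∀ e : b.Arc, e ∉ K → e.1.val < k → e.right.val < k) :
    prefixSum (c ∘ Sum.inl) k = prefixSum (c ∘ Sum.inr) k := by
  refine prefixSum_eq (b := b) (K := K) (fun z hz => ?_)
    (fun z hz => (eq_partner_of_stripMatch hc hz).1)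
    (fun z hz => (eq_partner_of_stripMatch hc hz).2) h
  have := hc (Sum.inr z)
  rw [stripMatch_inr_of_mem hz] at this
  exact this

/-- Under an uncontracted arc nothing is contracted, so the count along a line applies. At a
vertical strand all arcs passing over it are contracted, so the counts on the two lines agree. -/
theorem strip_sideWhite_inner (hK : Admissible K) {c : Fin (2 * n) ⊕ Fin (2 * n) → ZMod 2}
    (hc : ∀ x, c (b.stripMatch K x) = c x) (x : Fin (2 * n) ⊕ Fin (2 * n)) :
    b.strip.sideWhite c (b.stripMatch K x) = b.strip.sideWhite c x := by
  have hne : ∀ z, b.arcOf z ∉ K → ∀ y, (b.arcOf z).1 ≤ y → y ≤ (b.arcOf z).right →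
      b.arcOf y ∉ K := fun z hz y h1 h2 => notMem_of_between hK hz h1 h2
  have hmem : ∀ z, b.arcOf z ∈ K → leftOfWhite (c ∘ Sum.inl) z = leftOfWhite (c ∘ Sum.inr) z := by
    intro z hz
    refine prefixSum_inl_eq_inr hc fun f hf hlt => ?_
    by_contra hge
    have hne : f ≠ b.arcOf z := fun k => hf (k ▸ hz)
    have hne' := hne.symm
    rw [Ne, arcOf_eq_iff, not_or, Fin.ext_iff, Fin.ext_iff] at hne'
    exact hf (hK _ hz f (surrounds_of_straddle hne (by rw [Fin.le_def]; omega)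
      (by rw [Fin.le_def]; omega)))
  rcases x with z | z
  · by_cases hz : b.arcOf z ∈ K
    · rw [stripMatch_inl_of_mem hz]; exact (hmem z hz).symm
    · rw [stripMatch_inl_of_notMem hz]
      exact leftOfWhite_partner fun y h1 h2 =>
        (eq_partner_of_stripMatch hc (hne z hz y h1 h2)).1
  · by_cases hz : b.arcOf z ∈ K
    · rw [stripMatch_inr_of_mem hz]; exact hmem z hz
    · rw [stripMatch_inr_of_notMem hz]
      exact leftOfWhite_partner fun y h1 h2 =>
        (eq_partner_of_stripMatch hc (hne z hz y h1 h2)).2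

/-- Before the saddle the two black intervals lie outside the arc and its mirror image, on opposite
sides. The arc and the points under it cancel on the lower line, and every arc passing over the left
end surrounds `e`, hence is already contracted. -/
theorem strip_sideBlack_of_black (hK : Finset.Adds K e K') (h1 : Admissible K)
    (h2 : Admissible K') (hb : Even e.1.val) {c : Fin (2 * n) ⊕ Fin (2 * n) → ZMod 2}
    (hc : ∀ x, c (b.stripMatch K x) = c x) :
    leftOfBlack (c ∘ Sum.inl) (evenEnd e) = leftOfBlack (c ∘ Sum.inr) (oddEnd e) := by
  have he : e ∈ K' := (hK.2 e).2 (Or.inl rfl)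
  simp only [evenEnd, oddEnd, if_pos hb]
  rw [leftOfBlack_of_even hb, leftOfBlack_of_odd (by rw [even_right]; exact not_not.2 hb),
    prefixSum_closed fun z h3 h4 =>
      (eq_partner_of_stripMatch hc (notMem_of_between h1 hK.1 h3 h4)).2]
  refine prefixSum_inl_eq_inr hc fun f hf hlt => ?_
  by_contra hge
  have hne : f ≠ e := fun k => by rw [k] at hlt; omega
  have h5 := surrounds_of_straddle (f := f) (z := e.1) (by rwa [arcOf_left])
    (by rw [Fin.le_def]; omega) (by rw [Fin.le_def]; omega)
  rw [arcOf_left] at h5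
  have := (hK.2 f).1 (h2 e he f h5)
  tauto

/-- Here the black intervals lie inside the arc and the colouring is constant along the diagram
after the saddle. The points strictly under `e` are still uncontracted and cancel; no uncontracted
arc passes over the position just after the left end. -/
theorem strip_sideBlack_of_not_black (hK : Finset.Adds K e K') (h1 : Admissible K)
    (h2 : Admissible K') (hb : ¬ Even e.1.val) {c : Fin (2 * n) ⊕ Fin (2 * n) → ZMod 2}
    (hc : ∀ x, c (b.stripMatch K' x) = c x) :
    leftOfBlack (c ∘ Sum.inl) (evenEnd e) = leftOfBlack (c ∘ Sum.inr) (oddEnd e) := by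
  have he : e ∈ K' := (hK.2 e).2 (Or.inl rfl)
  simp only [evenEnd, oddEnd, if_neg hb]
  rw [leftOfBlack_of_odd hb, leftOfBlack_of_even ((even_right e).2 hb),
    prefixSum_open fun z h3 h4 => (eq_partner_of_stripMatch hc fun k => ?_).1]
  · refine prefixSum_inl_eq_inr hc fun f hf hlt => ?_
    by_contra hge
    have hne : f ≠ e := fun k => hf (k ▸ he)
    have h5 := surrounds_of_straddle (f := f) (z := e.1) (by rwa [arcOf_left])
      (by rw [Fin.le_def]; omega) (by rw [Fin.le_def]; omega)
    rw [arcOf_left] at h5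
    exact hf (h2 e he f h5)
  · refine notMem_of_between h1 hK.1 h3.le h4.le (((hK.2 _).1 k).resolve_left fun k' => ?_)
    rcases arcOf_eq_iff.1 k' with k' | k'
    · exact h3.ne k'.symm
    · exact h4.ne k'

theorem strip_isStrip (b : CrossinglessMatching n) : b.strip.IsStrip where
  inner_matching K := by
    have e1 : ∀ z, b.arcOf z ∈ K → b.arcOf (b.partner z) ∈ K := fun z h => by
      rwa [arcOf_partner]
    have e2 : ∀ z, b.arcOf z ∉ K → b.arcOf (b.partner z) ∉ K := fun z h => by
      rwa [arcOf_partner]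
    change IsParityMatching b.strip.parity (b.stripMatch K)
    constructor <;> rintro (z | z) <;> by_cases h : b.arcOf z ∈ K
    · rw [stripMatch_inl_of_mem h, stripMatch_inr_of_mem h]
    · rw [stripMatch_inl_of_notMem h, stripMatch_inl_of_notMem (e2 z h), b.partner_partner]
    · rw [stripMatch_inr_of_mem h, stripMatch_inl_of_mem h]
    · rw [stripMatch_inr_of_notMem h, stripMatch_inr_of_notMem (e2 z h), b.partner_partner]
    · rw [stripMatch_inl_of_mem h]; rfl
    · rw [stripMatch_inl_of_notMem h]; simp [strip, even_partner, -Nat.not_even_iff_odd]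
    · rw [stripMatch_inr_of_mem h]; simp [strip]
    · rw [stripMatch_inr_of_notMem h]; simp [strip, even_partner, -Nat.not_even_iff_odd]
  pairing_matching := by
    constructor <;> rintro (z | z)
    · exact congrArg Sum.inl (mate_mate z)
    · exact congrArg Sum.inr (mate_mate z)
    · simp [strip, even_mate, -Nat.not_even_iff_odd]
    · simp [strip, even_mate, -Nat.not_even_iff_odd]
  parity_tail e := by simpa [strip] using even_evenEnd e
  parity_head e := by
    have := even_evenEnd e
    rw [← partner_oddEnd, even_partner] at this
    simpa [strip] using this
  tail_ne_head e f := Sum.inl_ne_inr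
  tail_injective e f h := by
    rw [← arcOf_evenEnd e, ← arcOf_evenEnd f]
    exact congrArg _ (Sum.inl_injective h)
  exchange := strip_exchange
  adm_union {K K' L} h1 h2 h3 e he f hf := by
    rw [h3] at he ⊢
    exact he.imp (fun k => h1 e k f hf) (fun k => h2 e k f hf)
  separated_of_black hK h1 _ hb := strip_separated_of_black hK h1 hb
  separated_of_not_black hK _ h2 hb := strip_separated_of_not_black hK h2 hb
  sideWhite_eq c := by
    rintro (z | z)
    exacts [leftOfWhite_eq _ z, leftOfWhite_eq _ z]
  sideWhite_pairing c := by
    rintro (z | z)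
    exacts [leftOfWhite_mate z, leftOfWhite_mate z]
  sideWhite_inner hK hc := strip_sideWhite_inner hK hc
  sideBlack_of_black hK h1 h2 hb hc := strip_sideBlack_of_black hK h1 h2 hb hc
  sideBlack_of_not_black hK h1 h2 hb hc := strip_sideBlack_of_not_black hK h1 h2 hb hc

/-- The outer matching of `W(c)bW(b)a`. -/
def outer (c a : CrossinglessMatching n) : Fin (2 * n) ⊕ Fin (2 * n) → Fin (2 * n) ⊕ Fin (2 * n) :=
  Sum.map c.partner a.partner

theorem leftOfWhite_partner' (c : CrossinglessMatching n) {u : Fin (2 * n) → ZMod 2}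
    (h : ∀ z, u (c.partner z) = u z) (i : Fin (2 * n)) :
    leftOfWhite u (c.partner i) = leftOfWhite u i :=
  leftOfWhite_partner fun z _ _ => h z

theorem isOuter_outer (c b a : CrossinglessMatching n) : b.strip.IsOuter (outer c a) where
  matching := by
    constructor <;> rintro (z | z)
    · exact congrArg Sum.inl (c.partner_partner z)
    · exact congrArg Sum.inr (a.partner_partner z)
    · simp [strip, outer, even_partner, -Nat.not_even_iff_odd]
    · simp [strip, outer, even_partner, -Nat.not_even_iff_odd]
  side u hu := by
    rintro (z | z)
    · exact leftOfWhite_partner' c (fun y => hu (Sum.inl y)) z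
    · exact leftOfWhite_partner' a (fun y => hu (Sum.inr y)) z

/-- The outer matching of `W(d)cW(c)bW(b)a`. -/
def outer₂ (d a : CrossinglessMatching n) :
    (Fin (2 * n) ⊕ Fin (2 * n)) ⊕ (Fin (2 * n) ⊕ Fin (2 * n)) →
      (Fin (2 * n) ⊕ Fin (2 * n)) ⊕ (Fin (2 * n) ⊕ Fin (2 * n)) :=
  Sum.elim (Sum.elim (fun i => Sum.inl (Sum.inl (d.partner i))) fun i => Sum.inr (Sum.inl i))
    (Sum.elim (fun i => Sum.inl (Sum.inr i)) fun i => Sum.inr (Sum.inr (a.partner i)))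

theorem isOuter_outer₂ (d c b a : CrossinglessMatching n) :
    (c.strip.sum b.strip).IsOuter (outer₂ d a) where
  matching := by
    constructor <;> rintro ((z | z) | (z | z))
    · exact congrArg (Sum.inl ∘ Sum.inl) (d.partner_partner z)
    · rfl
    · rfl
    · exact congrArg (Sum.inr ∘ Sum.inr) (a.partner_partner z)
    · simp [strip, StripSystem.sum, outer₂, even_partner, -Nat.not_even_iff_odd]
    · simp [strip, StripSystem.sum, outer₂]
    · simp [strip, StripSystem.sum, outer₂]
    · simp [strip, StripSystem.sum, outer₂, even_partner, -Nat.not_even_iff_odd]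
  side u hu := by
    have e : u ∘ Sum.inl ∘ Sum.inr = u ∘ Sum.inr ∘ Sum.inl := funext fun z =>
      (hu (Sum.inl (Sum.inr z))).symm
    rintro ((z | z) | (z | z))
    · exact leftOfWhite_partner' d (fun y => hu (Sum.inl (Sum.inl y))) z
    · exact congrArg (leftOfWhite · z) e.symm
    · exact congrArg (leftOfWhite · z) e
    · exact leftOfWhite_partner' a (fun y => hu (Sum.inr (Sum.inr y))) z

theorem contraction_state (c a : CrossinglessMatching n) (χ : Chronology b) (K : Finset b.Arc) :
    (contraction c a χ).state K = orbitSetoid (b.stripMatch K) (outer c a) := by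
  apply le_antisymm
  · refine Setoid.eqvGen_le ?_
    intro x y h
    induction h with
    | top i => exact orbitSetoid_right _ (outer c a) (Sum.inl i)
    | bottom i => exact orbitSetoid_right _ (outer c a) (Sum.inr i)
    | arc e he =>
      have := orbitSetoid_left (b.stripMatch K) (outer c a) (Sum.inl e.1)
      rwa [stripMatch_inl_of_notMem (by rwa [arcOf_left])] at this
    | mirrorArc e he =>
      have := orbitSetoid_left (b.stripMatch K) (outer c a) (Sum.inr e.1)
      rwa [stripMatch_inr_of_notMem (by rwa [arcOf_left])] at this
    | leftStrand e he =>
      have := orbitSetoid_left (b.stripMatch K) (outer c a) (Sum.inl e.1)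
      rwa [stripMatch_inl_of_mem (by rwa [arcOf_left])] at this
    | rightStrand e he =>
      have := orbitSetoid_left (b.stripMatch K) (outer c a) (Sum.inl e.right)
      rwa [stripMatch_inl_of_mem (by rwa [arcOf_right])] at this
  · have hs := fun {x y} (h : ContractionPiece c b a K x y) =>
      (Relation.EqvGen.rel x y h : (contraction c a χ).state K x y)
    refine orbitSetoid_le ?_ ?_
    · have strand : ∀ z, b.arcOf z ∈ K →
          (contraction c a χ).state K (Sum.inl z) (Sum.inr z) := fun z hz => by
        rcases arcOf_eq_iff.1 (rfl : b.arcOf z = b.arcOf z) with k | k <;> rw [k]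
        exacts [hs (.leftStrand _ hz), hs (.rightStrand _ hz)]
      rintro (z | z) <;> by_cases hz : b.arcOf z ∈ K
      · rw [stripMatch_inl_of_mem hz]; exact strand z hz
      · rw [stripMatch_inl_of_notMem hz]
        have := hs (.arc _ hz)
        rcases arcOf_eq_iff.1 (rfl : b.arcOf z = b.arcOf z) with k | k
        · have k' : b.partner z = (b.arcOf z).right := congrArg b.partner k
          rw [k']; nth_rewrite 1 [k]; exact this
        · have k' : b.partner z = (b.arcOf z).1 := (congrArg b.partner k).trans (partner_right _)
          rw [k']; nth_rewrite 1 [k]; exact Setoid.symm' _ this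
      · rw [stripMatch_inr_of_mem hz]; exact Setoid.symm' _ (strand z hz)
      · rw [stripMatch_inr_of_notMem hz]
        have := hs (.mirrorArc _ hz)
        rcases arcOf_eq_iff.1 (rfl : b.arcOf z = b.arcOf z) with k | k
        · have k' : b.partner z = (b.arcOf z).right := congrArg b.partner k
          rw [k']; nth_rewrite 1 [k]; exact this
        · have k' : b.partner z = (b.arcOf z).1 := (congrArg b.partner k).trans (partner_right _)
          rw [k']; nth_rewrite 1 [k]; exact Setoid.symm' _ this
    · rintro (z | z)
      exacts [hs (.top z), hs (.bottom z)]

end CrossinglessMatching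


/-! ### Setoids pulled back along retractions -/

section Pullback

variable {P Q T : Type}

theorem disjointUnion_inl {r : Setoid P} {s : Setoid Q} {x y : P} :
    disjointUnion r s (Sum.inl x) (Sum.inl y) ↔ r x y := by
  change Sum.map (Quotient.mk r) (Quotient.mk s) (Sum.inl x) = Sum.map _ _ (Sum.inl y) ↔ _
  rw [Sum.map_inl, Sum.map_inl, Sum.inl.injEq, Quotient.eq]

theorem disjointUnion_inr {r : Setoid P} {s : Setoid Q} {x y : Q} :
    disjointUnion r s (Sum.inr x) (Sum.inr y) ↔ s x y := by
  change Sum.map (Quotient.mk r) (Quotient.mk s) (Sum.inr x) = Sum.map _ _ (Sum.inr y) ↔ _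
  rw [Sum.map_inr, Sum.map_inr, Sum.inr.injEq, Quotient.eq]

theorem not_disjointUnion_inl_inr {r : Setoid P} {s : Setoid Q} {x : P} {y : Q} :
    ¬ disjointUnion r s (Sum.inl x) (Sum.inr y) := fun h => Sum.inl_ne_inr h

theorem disjointUnion_le {r : Setoid P} {s : Setoid Q} {d : Setoid (P ⊕ Q)}
    (hr : r ≤ d.comap Sum.inl) (hs : s ≤ d.comap Sum.inr) : disjointUnion r s ≤ d := by
  rintro (x | x) (y | y) h
  · exact hr (disjointUnion_inl.1 h)
  · exact absurd h not_disjointUnion_inl_inr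
  · exact absurd (Setoid.symm' _ h) not_disjointUnion_inl_inr
  · exact hs (disjointUnion_inr.1 h)

theorem disjointUnion_mono {r r' : Setoid P} {s s' : Setoid Q} (hr : r ≤ r') (hs : s ≤ s') :
    disjointUnion r s ≤ disjointUnion r' s' :=
  disjointUnion_le (fun _ _ h => disjointUnion_inl.2 (hr h)) fun _ _ h => disjointUnion_inr.2 (hs h)

theorem card_quotient_disjointUnion [Finite P] [Finite Q] (r : Setoid P) (s : Setoid Q) :
    Nat.card (Quotient (disjointUnion r s)) = Nat.card (Quotient r) + Nat.card (Quotient s) := by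
  rw [← Nat.card_sum]
  refine Nat.card_congr (Setoid.quotientKerEquivOfSurjective _ ?_)
  exact Sum.map_surjective.2 ⟨Quotient.mk_surjective, Quotient.mk_surjective⟩

theorem card_quotient_comap {f : P → T} (hf : Function.Surjective f) (r : Setoid T) :
    Nat.card (Quotient (r.comap f)) = Nat.card (Quotient r) := by
  refine Nat.card_congr (Equiv.ofBijective
    (Quotient.map' (s₁ := r.comap f) (s₂ := r) f fun _ _ h => h) ⟨?_, ?_⟩)
  · rintro ⟨x⟩ ⟨y⟩ h
    have h' : Quotient.mk r (f x) = Quotient.mk r (f y) := h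
    have h'' : r (f x) (f y) := Quotient.exact h'
    exact Quotient.sound (s := r.comap f) h''
  · rintro ⟨x⟩
    obtain ⟨y, rfl⟩ := hf x
    exact ⟨Quotient.mk _ y, rfl⟩

theorem orbitSetoid_comm (f g : P → P) : orbitSetoid f g = orbitSetoid g f :=
  le_antisymm (orbitSetoid_le (orbitSetoid_right g f) (orbitSetoid_left g f))
    (orbitSetoid_le (orbitSetoid_right f g) (orbitSetoid_left f g))

theorem disjointUnion_orbitSetoid (f g : P → P) (f' g' : Q → Q) :
    disjointUnion (orbitSetoid f g) (orbitSetoid f' g') =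
      orbitSetoid (Sum.map f f') (Sum.map g g') := by
  apply le_antisymm
  · refine disjointUnion_le (orbitSetoid_le ?_ ?_) (orbitSetoid_le ?_ ?_) <;> intro x
    exacts [orbitSetoid_left (Sum.map f f') _ (Sum.inl x),
      orbitSetoid_right _ (Sum.map g g') (Sum.inl x),
      orbitSetoid_left (Sum.map f f') _ (Sum.inr x), orbitSetoid_right _ (Sum.map g g') (Sum.inr x)]
  · refine orbitSetoid_le ?_ ?_ <;> rintro (x | x)
    exacts [disjointUnion_inl.2 (orbitSetoid_left _ _ x),
      disjointUnion_inr.2 (orbitSetoid_left _ _ x), disjointUnion_inl.2 (orbitSetoid_right _ _ x),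
      disjointUnion_inr.2 (orbitSetoid_right _ _ x)]

theorem disjointUnion_sup (r r' : Setoid P) (s s' : Setoid Q) :
    disjointUnion r s ⊔ disjointUnion r' s' = disjointUnion (r ⊔ r') (s ⊔ s') := by
  apply le_antisymm
  · exact sup_le (disjointUnion_mono le_sup_left le_sup_left)
      (disjointUnion_mono le_sup_right le_sup_right)
  · have h1 : disjointUnion r s ≤ disjointUnion r s ⊔ disjointUnion r' s' := le_sup_left
    have h2 : disjointUnion r' s' ≤ disjointUnion r s ⊔ disjointUnion r' s' := le_sup_right
    exact disjointUnion_le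
      (sup_le (fun _ _ h => h1 (disjointUnion_inl.2 h)) fun _ _ h => h2 (disjointUnion_inl.2 h))
      (sup_le (fun _ _ h => h1 (disjointUnion_inr.2 h)) fun _ _ h => h2 (disjointUnion_inr.2 h))

theorem eq_comap_of_section {r : Setoid P} {s : Setoid T} {ρ : P → T} {σ : T → P}
    (h1 : r ≤ s.comap ρ) (h2 : s ≤ r.comap σ) (h3 : ∀ x, r x (σ (ρ x))) : r = s.comap ρ :=
  le_antisymm h1 fun x y h => r.trans' (h3 x) (r.trans' (h2 h) (r.symm' (h3 y)))

/-- Joins with the classes of a further matching are compatible with pulling back. -/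
theorem comap_sup_orbitSetoid {s : Setoid T} {ρ : P → T} {σ : T → P} {m : P → P} {m' : T → T}
    (h1 : ∀ x, ρ (σ x) = x) (h2 : ∀ x, ρ (m x) = m' (ρ x)) :
    s.comap ρ ⊔ orbitSetoid m m = (s ⊔ orbitSetoid m' m').comap ρ := by
  have a : s.comap ρ ≤ s.comap ρ ⊔ orbitSetoid m m := le_sup_left
  have b : orbitSetoid m m ≤ s.comap ρ ⊔ orbitSetoid m m := le_sup_right
  have c : s ≤ s ⊔ orbitSetoid m' m' := le_sup_left
  have d : orbitSetoid m' m' ≤ s ⊔ orbitSetoid m' m' := le_sup_right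
  have h3 : ∀ x, (s ⊔ orbitSetoid m' m').comap ρ x (m x) := fun x => by
    change (s ⊔ orbitSetoid m' m') (ρ x) (ρ (m x))
    rw [h2]; exact d (orbitSetoid_left _ _ _)
  have h4 : ∀ {x y}, ρ x = ρ y → (s.comap ρ ⊔ orbitSetoid m m) x y := fun {x y} h => a (by
    change s (ρ x) (ρ y); rw [h])
  have h5 : ∀ x, (s.comap ρ ⊔ orbitSetoid m m).comap σ x (m' x) := fun x =>
    Setoid.trans' (s.comap ρ ⊔ orbitSetoid m m) (y := m (σ x)) (b (orbitSetoid_left m m (σ x)))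
      (h4 (by rw [h2, h1, h1]))
  refine eq_comap_of_section (σ := σ) (sup_le (fun x y h => c h) (orbitSetoid_le h3 h3))
    (sup_le (fun x y h => a ?_) (orbitSetoid_le h5 h5)) fun x => h4 (h1 _).symm
  change s (ρ (σ x)) (ρ (σ y))
  rwa [h1, h1]

end Pullback

/-! ### Signs under inclusions of diagrams -/

section ThetaInclusion

variable {P P' Q : Type} {rk : P → ℕ} {w : Setoid P}

/-- The points of least rank in their classes. -/
def leastPoints (rk : P → ℕ) (w : Setoid P) : Set P := {x | minRank rk w x = rk x}

theorem mem_leastPoints {x : P} : x ∈ leastPoints rk w ↔ ∀ y, w x y → rk x ≤ rk y :=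
  ⟨fun h _ k => h.symm.le.trans (minRank_le k), fun h => minRank_eq (w.refl' x) h⟩

theorem exists_mem_leastPoints (rk : P → ℕ) (w : Setoid P) (x : P) :
    ∃ y ∈ leastPoints rk w, w x y ∧ rk y = minRank rk w x := by
  obtain ⟨y, h, e⟩ := exists_minRank rk w x
  exact ⟨y, (minRank_congr h).symm.trans e.symm, h, e⟩

/-- Counting points rather than ranks allows the count to be compared between diagrams with
different enumerations. -/
theorem countBelow_eq (hrk : Function.Injective rk) (w : Setoid P) (k : ℕ) :
    countBelow rk w k = ({x ∈ leastPoints rk w | rk x < k}.ncard : ZMod 2) := by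
  unfold countBelow
  rw [← Set.ncard_image_of_injective _ hrk, ← Set.ncard_coe_finset]
  congr 2
  ext v
  simp only [Finset.coe_filter, Finset.mem_range, Set.mem_ofPred_eq, Set.mem_image]
  constructor
  · rintro ⟨hv, x, rfl⟩
    obtain ⟨y, h1, -, h3⟩ := exists_mem_leastPoints rk w x
    exact ⟨y, ⟨h1, h3.trans_lt hv⟩, h3⟩
  · rintro ⟨x, ⟨h1, h2⟩, rfl⟩
    exact ⟨h2, x, h1⟩

theorem ncard_leastPoints (hrk : Function.Injective rk) (w : Setoid P) :
    (leastPoints rk w).ncard = Nat.card (Quotient w) := by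
  refine Nat.card_congr (Equiv.ofBijective (fun x => Quotient.mk w x.1) ⟨?_, ?_⟩)
  · rintro ⟨x, hx⟩ ⟨y, hy⟩ h
    have := Quotient.exact h
    exact Subtype.ext (hrk (le_antisymm (mem_leastPoints.1 hx y this)
      (mem_leastPoints.1 hy x (w.symm' this))))
  · rintro ⟨x⟩
    obtain ⟨y, h1, h2, -⟩ := exists_mem_leastPoints rk w x
    exact ⟨⟨y, h1⟩, Quotient.sound (w.symm' h2)⟩

/-- The diagram with the classes `w'` is made of two unrelated parts with the classes `w` and `v`;
the points of least rank of the classes lie in these parts. -/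
structure IsPartition (rk : P → ℕ) (rk' : P' → ℕ) (w : Setoid P) (v : Setoid Q) (w' : Setoid P')
    (inc : P → P') (extra : Q → P') : Prop where
  inc_iff : ∀ x y, w' (inc x) (inc y) ↔ w x y
  extra_iff : ∀ x y, w' (extra x) (extra y) ↔ v x y
  not_rel : ∀ x y, ¬ w' (inc x) (extra y)
  cover : ∀ y, (∃ x, w' y (inc x) ∧ rk' (inc x) ≤ rk' y) ∨
    ∃ x, w' y (extra x) ∧ rk' (extra x) ≤ rk' y
  lt_iff : ∀ x y, rk' (inc x) < rk' (inc y) ↔ rk x < rk y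

namespace IsPartition

variable {rk' : P' → ℕ} {v : Setoid Q} {w' : Setoid P'} {inc : P → P'} {extra : Q → P'}

theorem inc_mem_leastPoints (h : IsPartition rk rk' w v w' inc extra) {x : P} :
    inc x ∈ leastPoints rk' w' ↔ x ∈ leastPoints rk w := by
  rw [mem_leastPoints, mem_leastPoints]
  have hle : ∀ x y, rk' (inc x) ≤ rk' (inc y) ↔ rk x ≤ rk y := fun x y => by
    rw [← not_lt, ← not_lt, h.lt_iff]
  constructor
  · exact fun k y hy => (hle _ _).1 (k _ ((h.inc_iff _ _).2 hy))
  · intro k y hy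
    rcases h.cover y with ⟨z, h1, h2⟩ | ⟨z, h1, -⟩
    · exact ((hle _ _).2 (k z ((h.inc_iff _ _).1 (w'.trans' hy h1)))).trans h2
    · exact absurd (w'.trans' hy h1) (h.not_rel _ _)

theorem extra_mem_leastPoints (h : IsPartition rk rk' w v w' inc extra) {x : Q} :
    extra x ∈ leastPoints rk' w' ↔ x ∈ leastPoints (rk' ∘ extra) v := by
  rw [mem_leastPoints, mem_leastPoints]
  constructor
  · exact fun k y hy => k _ ((h.extra_iff _ _).2 hy)
  · intro k y hy
    rcases h.cover y with ⟨z, h1, -⟩ | ⟨z, h1, h2⟩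
    · exact absurd (w'.symm' (w'.trans' hy h1)) (h.not_rel _ _)
    · exact (k z ((h.extra_iff _ _).1 (w'.trans' hy h1))).trans h2

theorem eq_of_mem_leastPoints (h : IsPartition rk rk' w v w' inc extra)
    (hrk : Function.Injective rk') {y : P'} (hy : y ∈ leastPoints rk' w') :
    (∃ x, inc x = y) ∨ ∃ x, extra x = y := by
  rw [mem_leastPoints] at hy
  exact (h.cover y).imp
    (fun ⟨x, h1, h2⟩ => ⟨x, hrk (le_antisymm h2 (hy _ h1))⟩)
    (fun ⟨x, h1, h2⟩ => ⟨x, hrk (le_antisymm h2 (hy _ h1))⟩)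

theorem countBelow_inc (h : IsPartition rk rk' w v w' inc extra) [Finite P'] [Finite P] [Finite Q]
    (hrk : Function.Injective rk) (hrk' : Function.Injective rk') (hi : Function.Injective inc)
    (he : Function.Injective extra) (x : P) :
    countBelow rk' w' (rk' (inc x)) = countBelow rk w (rk x) +
      ({y ∈ leastPoints (rk' ∘ extra) v | rk' (extra y) < rk' (inc x)}.ncard : ZMod 2) := by
  rw [countBelow_eq hrk', countBelow_eq hrk, ← Nat.cast_add,
    ← Set.ncard_image_of_injective {y ∈ leastPoints rk w | _} hi,
    ← Set.ncard_image_of_injective {y ∈ leastPoints _ v | _} he, ← Set.ncard_union_eq]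
  · congr 2
    ext y
    simp only [Set.mem_ofPred_eq, Set.mem_union, Set.mem_image]
    constructor
    · rintro ⟨h1, h2⟩
      rcases h.eq_of_mem_leastPoints hrk' h1 with ⟨z, rfl⟩ | ⟨z, rfl⟩
      · exact Or.inl ⟨z, ⟨h.inc_mem_leastPoints.1 h1, (h.lt_iff _ _).1 h2⟩, rfl⟩
      · exact Or.inr ⟨z, ⟨h.extra_mem_leastPoints.1 h1, h2⟩, rfl⟩
    · rintro (⟨z, ⟨h1, h2⟩, rfl⟩ | ⟨z, ⟨h1, h2⟩, rfl⟩)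
      · exact ⟨h.inc_mem_leastPoints.2 h1, (h.lt_iff _ _).2 h2⟩
      · exact ⟨h.extra_mem_leastPoints.2 h1, h2⟩
  · rw [Set.disjoint_left]
    rintro _ ⟨z, -, rfl⟩ ⟨z', -, k⟩
    exact h.not_rel z z' (by rw [k])

/-- The sign exponent of a union in the first part changes by the number of classes of the second
part which precede the first part. -/
theorem theta_inc (h : IsPartition rk rk' w v w' inc extra) [Finite P'] [Finite P] [Finite Q]
    (hrk : Function.Injective rk) (hrk' : Function.Injective rk') (hi : Function.Injective inc)
    (he : Function.Injective extra) {κ : ZMod 2}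
    (hκ : ∀ x, ({y ∈ leastPoints (rk' ∘ extra) v | rk' (extra y) < rk' (inc x)}.ncard : ZMod 2) = κ)
    (p t : P) : theta rk' w' (inc p) (inc t) = theta rk w p t + κ := by
  have key : ∀ x, ∃ m, minRank rk w x = rk m ∧ minRank rk' w' (inc x) = rk' (inc m) := fun x => by
    obtain ⟨m, h1, h2, h3⟩ := exists_mem_leastPoints rk w x
    refine ⟨m, h3.symm, ?_⟩
    rw [minRank_congr ((h.inc_iff _ _).2 h2)]
    exact h.inc_mem_leastPoints.2 h1
  obtain ⟨m, e1, e2⟩ := key p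
  obtain ⟨l, e3, e4⟩ := key t
  have hm : ∃ z, max (rk m) (rk l) = rk z ∧ max (rk' (inc m)) (rk' (inc l)) = rk' (inc z) := by
    rcases lt_or_ge (rk m) (rk l) with k | k
    · exact ⟨l, max_eq_right k.le, max_eq_right ((h.lt_iff _ _).2 k).le⟩
    · exact ⟨m, max_eq_left k, max_eq_left (by rw [← not_lt, h.lt_iff, not_lt]; exact k)⟩
  obtain ⟨z, z1, z2⟩ := hm
  unfold theta
  rw [e1, e2, e3, e4, z1, z2, h.countBelow_inc hrk hrk' hi he, hκ]
  simp only [h.lt_iff]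
  ring

theorem theta_inc_of_le (h : IsPartition rk rk' w v w' inc extra) [Finite P'] [Finite P] [Finite Q]
    (hrk : Function.Injective rk) (hrk' : Function.Injective rk') (hi : Function.Injective inc)
    (he : Function.Injective extra) (hlt : ∀ x y, rk' (inc x) < rk' (extra y)) (p t : P) :
    theta rk' w' (inc p) (inc t) = theta rk w p t := by
  rw [h.theta_inc hrk hrk' hi he (κ := 0), add_zero]
  intro x
  have : {y ∈ leastPoints (rk' ∘ extra) v | rk' (extra y) < rk' (inc x)} = ∅ := by
    ext y
    simp only [Set.mem_ofPred_eq, Set.mem_empty_iff_false, iff_false, not_and]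
    exact fun _ => (hlt x y).not_gt
  rw [this, Set.ncard_empty, Nat.cast_zero]

/-- All classes of the second part come first and shift every position by their number; when they
come last they do not matter. -/
theorem theta_inc_of_ge (h : IsPartition rk rk' w v w' inc extra) [Finite P'] [Finite P] [Finite Q]
    (hrk : Function.Injective rk) (hrk' : Function.Injective rk') (hi : Function.Injective inc)
    (he : Function.Injective extra) (hlt : ∀ x y, rk' (extra y) < rk' (inc x)) (p t : P) :
    theta rk' w' (inc p) (inc t) = theta rk w p t + (Nat.card (Quotient v) : ZMod 2) := by
  rw [h.theta_inc hrk hrk' hi he]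
  intro x
  have : {y ∈ leastPoints (rk' ∘ extra) v | rk' (extra y) < rk' (inc x)} =
      leastPoints (rk' ∘ extra) v := by
    ext y
    simp only [Set.mem_ofPred_eq, and_iff_left_iff_imp]
    exact fun _ => hlt x y
  rw [this, ncard_leastPoints (hrk'.comp he)]

end IsPartition

end ThetaInclusion

/-! ### Transport of sign exponents between diagrams; counts of regions, splits and circles -/

namespace ColouredFamily

variable {E E' P P' : Type} {M : ColouredFamily E P} {M' : ColouredFamily E' P'}

open scoped Classical
open SaddleFamily

/-- The number, modulo `2`, of saddles of a list at which the number of white regions changes. -/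
noncomputable def changeCount (M : ColouredFamily E P) : Finset E → List E → ZMod 2
  | _, [] => 0
  | K, e :: L => (if M.Changes K e then 1 else 0) + M.changeCount (insert e K) L

/-- The number, modulo `2`, of saddles of a list in black regions. -/
noncomputable def blackSum (M : ColouredFamily E P) (L : List E) : ZMod 2 :=
  (L.map fun e => if M.black e then 1 else 0).sum

theorem tau_transport {K : Finset E} {e : E} {K' : Finset E'} {e' : E'} {β κ l : ZMod 2}
    (hb : M'.black e' ↔ M.black e) (hB : M'.blackBefore K' e' = M.blackBefore K e + β)
    (hC : M'.blackCount K' = M.blackCount K + κ) (hch : M'.Changes K' e' ↔ M.Changes K e)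
    (hθ : theta M'.rank (M'.cover K' e') (M'.tail e') (M'.head e') =
      theta M.rank (M.cover K e) (M.tail e) (M.head e) + l) :
    M'.tau K' e' = M.tau K e + (if M.black e then 1 else 0) * β +
      (if M.Changes K e then 1 else 0) * (κ + l) := by
  unfold tau
  simp only [hb, hch, hB, hC, hθ]
  split_ifs <;> ring

/-- A constant correction at black saddles and another one at changes of white regions add up to
multiples of the two counts. -/
theorem tauList_transport {j : E → E'} {k : Finset E → Finset E'} {β κ : ZMod 2}
    (hk : ∀ e K, k (insert e K) = insert (j e) (k K))
    (h : ∀ K e, M'.tau (k K) (j e) = M.tau K e + (if M.black e then 1 else 0) * β +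
      (if M.Changes K e then 1 else 0) * κ) (K : Finset E) (L : List E) :
    M'.tauList (k K) (L.map j) = M.tauList K L + M.blackSum L * β + M.changeCount K L * κ := by
  induction L generalizing K with
  | nil => simp [tauList, blackSum, changeCount]
  | cons e L ih =>
    rw [List.map_cons, tauList, ← hk, ih, h, tauList, changeCount, blackSum, blackSum,
      List.map_cons, List.sum_cons]
    ring

theorem after_map {j : E → E'} {k : Finset E → Finset E'}
    (hk : ∀ e K, k (insert e K) = insert (j e) (k K)) (K : Finset E) (L : List E) :
    after (k K) (L.map j) = k (after K L) := by
  induction L generalizing K with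
  | nil => rfl
  | cons e L ih => rw [List.map_cons, after, ← hk, ih, after]

theorem isPath_map {j : E → E'} {k : Finset E → Finset E'} {adm : Finset E → Prop}
    {adm' : Finset E' → Prop} (hk : ∀ e K, k (insert e K) = insert (j e) (k K))
    (hj : ∀ e K, j e ∈ k K ↔ e ∈ K) (ha : ∀ K, adm K → adm' (k K)) {K : Finset E} {L : List E}
    (h : IsPath adm K L) : IsPath adm' (k K) (L.map j) := by
  induction L generalizing K with
  | nil => exact ha _ h
  | cons e L ih =>
    refine ⟨ha _ h.1, fun k' => h.2.1 ((hj _ _).1 k'), ?_⟩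
    rw [← hk]
    exact ih h.2.2

theorem blackCount_after {adm : Finset E → Prop} {K : Finset E} {L : List E}
    (h : IsPath adm K L) : M.blackCount (after K L) = M.blackCount K + M.blackSum L := by
  induction L generalizing K with
  | nil => simp [after, blackSum]
  | cons e L ih =>
    rw [after, ih h.2.2, blackCount_insert h.2.1, blackSum, blackSum, List.map_cons, List.sum_cons,
      add_assoc]

theorem white_card {adm : Finset E → Prop} [Finite P] (hM : M.IsPlanar adm) {K : Finset E}
    {e : E} (he : e ∉ K) (h1 : adm K) (h2 : adm (insert e K)) :
    (Nat.card (Quotient (M.white (insert e K))) : ZMod 2) =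
      Nat.card (Quotient (M.white K)) + if M.Changes K e then 1 else 0 := by
  unfold Changes cover
  by_cases hb : M.black e
  · rw [hM.white_of_black he h1 h2 hb, if_pos hb]
    by_cases hc : M.white K (M.tail e) (M.head e)
    · rw [Setoid.glue_eq_self hc, if_neg (not_not.2 hc), add_zero]
    · rw [if_pos hc, ← Setoid.card_quotient_glue hc, Nat.cast_succ, add_assoc,
        CharTwo.add_self_eq_zero, add_zero]
  · rw [hM.white_of_not_black he h1 h2 hb, if_neg hb]
    by_cases hc : M.white (insert e K) (M.tail e) (M.head e)
    · rw [Setoid.glue_eq_self hc, if_neg (not_not.2 hc), add_zero]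
    · rw [if_pos hc, ← Setoid.card_quotient_glue hc, Nat.cast_succ]

/-- Each counted saddle alters the number of white regions by one, so the count telescopes and
depends only on the two ends of the path. -/
theorem changeCount_eq {adm : Finset E → Prop} [Finite P] (hM : M.IsPlanar adm) {K : Finset E}
    {L : List E} (h : IsPath adm K L) : M.changeCount K L =
      Nat.card (Quotient (M.white (after K L))) + Nat.card (Quotient (M.white K)) := by
  induction L generalizing K with
  | nil => rw [after, CharTwo.add_self_eq_zero]; rfl
  | cons e L ih =>
    rw [changeCount, ih h.2.2, after, white_card hM h.2.1 h.1 h.2.2.adm_left]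
    split_ifs
    · linear_combination (CharTwo.add_self_eq_zero (1 : ZMod 2))
    · ring

theorem changes_iff {adm : Finset E → Prop} (hM : M.IsPlanar adm) {K : Finset E}
    {e : E} (he : e ∉ K) (h1 : adm K) (h2 : adm (insert e K)) :
    M.Changes K e ↔ (M.black e ↔ ¬ M.Splits K e) := by
  unfold Changes cover
  by_cases hb : M.black e
  · rw [splits_iff_of_black hM he h1 h2 hb, if_pos hb]; tauto
  · rw [splits_iff_of_not_black hM he h1 h2 hb, if_neg hb]; tauto

/-- A saddle is a split exactly when one, and not both, of "black" and "changes the white regions"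
holds. -/
theorem numSplits_eq {adm : Finset E → Prop} (hM : M.IsPlanar adm) {K : Finset E} {L : List E}
    (h : IsPath adm K L) :
    (M.toSaddleFamily.numSplits K L : ZMod 2) = M.blackSum L + M.changeCount K L := by
  induction L generalizing K with
  | nil => simp [numSplits, blackSum, changeCount]
  | cons e L ih =>
    have hc := changes_iff hM h.2.1 h.1 h.2.2.adm_left
    have hs : ¬ M.Splits K e ↔ M.state (insert e K) (M.tail e) (M.head e) := not_not
    rw [hs] at hc
    rw [numSplits, Nat.cast_add, ih h.2.2, blackSum, blackSum, List.map_cons, List.sum_cons,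
      changeCount]
    have : ((if M.state (insert e K) (M.tail e) (M.head e) then 0 else 1 : ℕ) : ZMod 2) =
        (if M.black e then 1 else 0) + if M.Changes K e then 1 else 0 := by
      by_cases h1 : M.black e <;> by_cases h2 : M.state (insert e K) (M.tail e) (M.head e) <;>
        simp only [hc, h1, h2] <;> decide
    rw [this]
    ring

/-- A merge lowers the number of circles by one and a split raises it by one. -/
theorem card_state {adm : Finset E → Prop} [Finite P] (hM : M.IsPlanar adm) {K : Finset E}
    {L : List E} (h : IsPath adm K L) : Nat.card (Quotient (M.state (after K L))) + L.length =
      Nat.card (Quotient (M.state K)) + 2 * M.toSaddleFamily.numSplits K L := by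
  induction L generalizing K with
  | nil => rfl
  | cons e L ih =>
    have h1 := hM.surgery h.2.1 h.1 h.2.2.adm_left
    have h2 := ih h.2.2
    rw [after, numSplits, List.length_cons]
    split_ifs with hs
    · have hn : ¬ M.state K (M.tail e) (M.head e) := fun k => h1.rel_iff.1 k hs
      have := Setoid.card_quotient_glue hn
      rw [← h1.eq_glue hn] at this
      omega
    · have := Setoid.card_quotient_glue hs
      rw [← h1.eq_glue' (h1.rel_iff.2 hs)] at this
      omega

end ColouredFamily


open SaddleFamily

theorem StripSystem.whiteSetoid_eq {E P : Type} (S : StripSystem E P) (O : P → P) (K : Finset E) :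
    S.whiteSetoid O K = orbitSetoid (S.inner K) O ⊔ orbitSetoid S.pairing S.pairing := by
  have a : orbitSetoid (S.inner K) O ≤ orbitSetoid (S.inner K) O ⊔
    orbitSetoid S.pairing S.pairing := le_sup_left
  have b : orbitSetoid S.pairing S.pairing ≤ orbitSetoid (S.inner K) O ⊔
    orbitSetoid S.pairing S.pairing := le_sup_right
  exact le_antisymm (whiteSetoid_le (fun x => a (orbitSetoid_left _ _ x))
    (fun x => b (orbitSetoid_left _ _ x)) (fun x => a (orbitSetoid_right _ _ x)))
    (sup_le (orbitSetoid_le_whiteSetoid K)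
      (orbitSetoid_le (whiteSetoid_pairing K) (whiteSetoid_pairing K)))

theorem IsPartition.of_comap {P P' Q : Type} {rk : P → ℕ} {rk' : P' → ℕ} {w : Setoid P}
    {v : Setoid Q} {w' : Setoid P'} {ρ : P' → P ⊕ Q} {σ : P ⊕ Q → P'}
    (h : w' = (disjointUnion w v).comap ρ) (h1 : ∀ x, ρ (σ x) = x)
    (h2 : ∀ y, rk' (σ (ρ y)) ≤ rk' y)
    (h3 : ∀ x y, rk' (σ (Sum.inl x)) < rk' (σ (Sum.inl y)) ↔ rk x < rk y) :
    IsPartition rk rk' w v w' (σ ∘ Sum.inl) (σ ∘ Sum.inr) := by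
  have key : ∀ x y, w' x y ↔ disjointUnion w v (ρ x) (ρ y) := fun x y => by rw [h]; rfl
  refine ⟨fun x y => ?_, fun x y => ?_, fun x y => ?_, fun y => ?_, h3⟩
  · rw [key, Function.comp_apply, Function.comp_apply, h1, h1, disjointUnion_inl]
  · rw [key, Function.comp_apply, Function.comp_apply, h1, h1, disjointUnion_inr]
  · rw [key, Function.comp_apply, Function.comp_apply, h1, h1]; exact not_disjointUnion_inl_inr
  · have h4 := h2 y
    have h5 : w' y (σ (ρ y)) := by rw [key, h1]
    rcases hy : ρ y with x | x
    · rw [hy] at h4 h5; exact Or.inl ⟨x, h5, h4⟩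
    · rw [hy] at h4 h5; exact Or.inr ⟨x, h5, h4⟩

theorem IsPartition.of_comap' {P P' : Type} {rk : P → ℕ} {rk' : P' → ℕ} {w : Setoid P}
    {w' : Setoid P'} {ρ : P' → P} {σ : P → P'} (h : w' = w.comap ρ) (h1 : ∀ x, ρ (σ x) = x)
    (h2 : ∀ y, rk' (σ (ρ y)) ≤ rk' y) (h3 : ∀ x y, rk' (σ x) < rk' (σ y) ↔ rk x < rk y) :
    IsPartition rk rk' w (⊥ : Setoid Empty) w' σ Empty.elim := by
  have key : ∀ x y, w' x y ↔ w (ρ x) (ρ y) := fun x y => by rw [h]; rfl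
  refine ⟨fun x y => ?_, fun x => x.elim, fun x y => y.elim, fun y => Or.inl ⟨ρ y, ?_, h2 y⟩, h3⟩
  · rw [key, h1, h1]
  · rw [key, h1]

namespace ColouredFamily

variable {E E' P P' Q R : Type} {M : ColouredFamily E P} {M' : ColouredFamily E' P'}

open scoped Classical

theorem tau_of_isPartition {j : E → E'} {k : Finset E → Finset E'} {inc : P → P'}
    {extra : Q → P'} {v : Setoid Q} {β κ l : ZMod 2}
    (hk : ∀ e K, k (insert e K) = insert (j e) (k K)) (hb : ∀ e, M'.black (j e) ↔ M.black e)
    (hp : ∀ K, IsPartition M.rank M'.rank (M.white K) v (M'.white (k K)) inc extra)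
    (ht : ∀ e K, M'.white (k K) (M'.tail (j e)) (inc (M.tail e)))
    (hh : ∀ e K, M'.white (k K) (M'.head (j e)) (inc (M.head e)))
    (hB : ∀ K e, M'.blackBefore (k K) (j e) = M.blackBefore K e + β)
    (hC : ∀ K, M'.blackCount (k K) = M.blackCount K + κ)
    (hθ : ∀ {w w'}, IsPartition M.rank M'.rank w v w' inc extra → ∀ p t,
      theta M'.rank w' (inc p) (inc t) = theta M.rank w p t + l) (K : Finset E) (e : E) :
    M'.tau (k K) (j e) = M.tau K e + (if M.black e then 1 else 0) * β +
      (if M.Changes K e then 1 else 0) * (κ + l) := by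
  have hc : ∃ K', M.cover K e = M.white K' ∧ M'.cover (k K) (j e) = M'.white (k K') := by
    unfold cover
    simp only [hb]
    split_ifs
    exacts [⟨K, rfl, rfl⟩, ⟨insert e K, rfl, by rw [hk]⟩]
  obtain ⟨K', e1, e2⟩ := hc
  refine tau_transport (hb e) (hB K e) (hC K) ?_ ?_
  · unfold Changes
    rw [e1, e2, ← (hp K').inc_iff]
    exact not_congr ⟨fun h => Setoid.trans' _ (Setoid.symm' _ (ht e K'))
      (Setoid.trans' _ h (hh e K')), fun h => Setoid.trans' _ (ht e K')
      (Setoid.trans' _ h (Setoid.symm' _ (hh e K')))⟩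
  · rw [e1, e2, theta_congr (ht e K') (hh e K'), hθ (hp K')]

end ColouredFamily

namespace SaddleFamily

variable {E E' P P' R : Type}

open scoped Classical

theorem map_factor {N : SaddleFamily E P} {N' : SaddleFamily E' P'} {f : P → R} {f' : P' → R}
    {j : E → E'} {k : Finset E → Finset E'} (hk : ∀ e K, k (insert e K) = insert (j e) (k K))
    (hs : ∀ e K, N'.state (k K) (N'.tail (j e)) (N'.head (j e)) ↔ N.state K (N.tail e) (N.head e))
    (ht : ∀ e, f' (N'.tail (j e)) = f (N.tail e)) (hh : ∀ e, f' (N'.head (j e)) = f (N.head e))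
    (K : Finset E) (L : List E) :
    PointAlgebra.map f' (N'.factor (k K) (L.map j)) = PointAlgebra.map f (N.factor K L) := by
  induction L generalizing K with
  | nil => simp [factor]
  | cons e L ih =>
    rw [List.map_cons, factor, factor, map_mul, map_mul, ← hk, ih]
    congr 1
    unfold OF.saddleFactor
    simp only [hs]
    split_ifs
    · simp
    · simp [ht, hh]

end SaddleFamily

/-! ### Diagrams on two and on four lines of points -/

namespace CrossinglessMatching

variable {n : ℕ}

/-- The white regions of `W(b)a`. -/
def whiteCircles (b a : CrossinglessMatching n) : Setoid (Fin (2 * n)) :=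
  circleSetoid b a ⊔ orbitSetoid mate mate

/-- The number, modulo `2`, of white regions of `W(b)a`. -/
noncomputable def whiteCount (b a : CrossinglessMatching n) : ZMod 2 :=
  Nat.card (Quotient (whiteCircles b a))

/-- The enumeration of the points on two lines. -/
def rank₁ : Fin (2 * n) ⊕ Fin (2 * n) → ℕ := Sum.elim (fun i => i.val) fun i => 2 * n + i.val

theorem rank₁_injective : Function.Injective (rank₁ (n := n)) := by
  rintro (x | x) (y | y) h <;> simp only [rank₁, Sum.elim_inl, Sum.elim_inr] at h
  · exact congrArg Sum.inl (Fin.ext h)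
  · have := x.2; omega
  · have := y.2; omega
  · exact congrArg Sum.inr (Fin.ext (by omega))

theorem rank₁_lt (x : Fin (2 * n) ⊕ Fin (2 * n)) : rank₁ x < 4 * n := by
  rcases x with x | x <;> simp only [rank₁, Sum.elim_inl, Sum.elim_inr] <;> have := x.2 <;> omega

/-- The enumeration of the points on four lines. -/
def rank₂ : (Fin (2 * n) ⊕ Fin (2 * n)) ⊕ (Fin (2 * n) ⊕ Fin (2 * n)) → ℕ :=
  Sum.elim rank₁ fun x => 4 * n + rank₁ x

theorem rank₂_injective : Function.Injective (rank₂ (n := n)) := by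
  rintro (x | x) (y | y) h <;> simp only [rank₂, Sum.elim_inl, Sum.elim_inr] at h
  · exact congrArg Sum.inl (rank₁_injective h)
  · have := rank₁_lt x; omega
  · have := rank₁_lt y; omega
  · exact congrArg Sum.inr (rank₁_injective (by omega))

/-- The coloured family of the contractions of the arcs of `b` in `W(c)bW(b)a`. -/
noncomputable def family (c b a : CrossinglessMatching n) :
    ColouredFamily b.Arc (Fin (2 * n) ⊕ Fin (2 * n)) :=
  b.strip.toFamily (outer c a) rank₁ fun e => e.1.val

/-- The coloured family of the contractions of the arcs of `c` and `b` in `W(d)cW(c)bW(b)a`. -/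
noncomputable def family₂ (d c b a : CrossinglessMatching n) :
    ColouredFamily (c.Arc ⊕ b.Arc) ((Fin (2 * n) ⊕ Fin (2 * n)) ⊕ (Fin (2 * n) ⊕ Fin (2 * n))) :=
  (c.strip.sum b.strip).toFamily (outer₂ d a) rank₂
    (Sum.elim (fun e => 2 * n + e.1.val) fun e => e.1.val)

theorem family_isPlanar (c b a : CrossinglessMatching n) :
    (family c b a).IsPlanar Admissible :=
  StripSystem.toFamily_isPlanar b.strip_isStrip (isOuter_outer c b a) rank₁_injective
    fun _ _ h => Subtype.ext (Fin.ext h)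

theorem family₂_isPlanar (d c b a : CrossinglessMatching n) :
    (family₂ d c b a).IsPlanar (c.strip.sum b.strip).adm := by
  refine StripSystem.toFamily_isPlanar (c.strip_isStrip.sum b.strip_isStrip)
    (isOuter_outer₂ d c b a) rank₂_injective ?_
  rintro (x | x) (y | y) h <;> simp only [Sum.elim_inl, Sum.elim_inr] at h
  · exact congrArg Sum.inl (Subtype.ext (Fin.ext (by omega)))
  · have := y.1.2; omega
  · have := x.1.2; omega
  · exact congrArg Sum.inr (Subtype.ext (Fin.ext h))

theorem family_white (c b a : CrossinglessMatching n) (K : Finset b.Arc) :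
    (family c b a).white K =
      (family c b a).state K ⊔ orbitSetoid (Sum.map mate mate) (Sum.map mate mate) :=
  StripSystem.whiteSetoid_eq _ _ _

theorem family₂_white (d c b a : CrossinglessMatching n) (K : Finset (c.Arc ⊕ b.Arc)) :
    (family₂ d c b a).white K = (family₂ d c b a).state K ⊔
      orbitSetoid (Sum.map (Sum.map mate mate) (Sum.map mate mate))
        (Sum.map (Sum.map mate mate) (Sum.map mate mate)) :=
  StripSystem.whiteSetoid_eq _ _ _

theorem family_state_empty (c b a : CrossinglessMatching n) :
    (family c b a).state ∅ = disjointUnion (circleSetoid c b) (circleSetoid b a) := by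
  have h : b.stripMatch ∅ = Sum.map b.partner b.partner := by
    funext x
    rcases x with x | x
    exacts [stripMatch_inl_of_notMem (Finset.notMem_empty _),
      stripMatch_inr_of_notMem (Finset.notMem_empty _)]
  change orbitSetoid (b.stripMatch ∅) (Sum.map c.partner a.partner) =
    disjointUnion (orbitSetoid c.partner b.partner) (orbitSetoid b.partner a.partner)
  rw [h, orbitSetoid_comm c.partner, disjointUnion_orbitSetoid]

theorem stripMatch_univ (b : CrossinglessMatching n) (x : Fin (2 * n) ⊕ Fin (2 * n)) :
    b.stripMatch Finset.univ x = x.swap := by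
  rcases x with x | x
  exacts [stripMatch_inl_of_mem (Finset.mem_univ _), stripMatch_inr_of_mem (Finset.mem_univ _)]

/-- When every arc is contracted, the two lines are joined by vertical strands and may be
identified. -/
theorem family_state_univ (c b a : CrossinglessMatching n) :
    (family c b a).state Finset.univ =
      (circleSetoid c a).comap ChronologyChoice.collapse := by
  have hl := orbitSetoid_left (b.stripMatch Finset.univ) (outer c a)
  have hr := orbitSetoid_right (b.stripMatch Finset.univ) (outer c a)
  have ht := fun {x y z} => ((family c b a).state Finset.univ).trans' (x := x) (y := y) (z := z)
  have hs : ∀ i, (family c b a).state Finset.univ (Sum.inl i) (Sum.inr i) := fun i => by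
    have := hl (Sum.inl i)
    rwa [stripMatch_univ] at this
  refine eq_comap_of_section (σ := Sum.inl) (orbitSetoid_le ?_ ?_) (orbitSetoid_le ?_ ?_) ?_
  · intro x
    change (circleSetoid c a) (ChronologyChoice.collapse x)
      (ChronologyChoice.collapse (b.stripMatch Finset.univ x))
    rw [stripMatch_univ]
    rcases x with x | x <;> exact Setoid.refl' _ _
  · rintro (x | x)
    exacts [orbitSetoid_left c.partner a.partner x, orbitSetoid_right c.partner a.partner x]
  · exact fun x => hr (Sum.inl x)
  · exact fun x => ht (hs x) (ht (hr (Sum.inr x)) (Setoid.symm' _ (hs (a.partner x))))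
  · rintro (x | x)
    exacts [Setoid.refl' _ _, Setoid.symm' _ (hs x)]

theorem collapse_surjective : Function.Surjective (ChronologyChoice.collapse (n := n)) :=
  fun x => ⟨Sum.inl x, rfl⟩

theorem card_white_empty (c b a : CrossinglessMatching n) :
    (Nat.card (Quotient ((family c b a).white ∅)) : ZMod 2) = whiteCount c b + whiteCount b a := by
  rw [family_white, family_state_empty, ← disjointUnion_orbitSetoid, disjointUnion_sup,
    card_quotient_disjointUnion, Nat.cast_add]
  rfl

theorem card_white_univ (c b a : CrossinglessMatching n) :
    (Nat.card (Quotient ((family c b a).white Finset.univ)) : ZMod 2) = whiteCount c a := by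
  rw [family_white, family_state_univ,
    comap_sup_orbitSetoid (σ := Sum.inl) (m' := mate) (fun _ => rfl) (by rintro (x | x) <;> rfl),
    card_quotient_comap collapse_surjective]
  rfl

section Reductions

variable (d c b a : CrossinglessMatching n)

theorem family₂_state_disjSum (K : Finset c.Arc) (K' : Finset b.Arc) :
    (family₂ d c b a).state (K.disjSum K') =
      orbitSetoid (Sum.map (c.stripMatch K) (b.stripMatch K')) (outer₂ d a) := by
  change orbitSetoid (Sum.map (c.stripMatch (K.disjSum K').toLeft)
    (b.stripMatch (K.disjSum K').toRight)) _ = _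
  rw [Finset.toLeft_disjSum, Finset.toRight_disjSum]

/-- Before the contraction of `b`, the last line of `W(d)cW(c)bW(b)a` is separate. -/
def separateLast : (Fin (2 * n) ⊕ Fin (2 * n)) ⊕ (Fin (2 * n) ⊕ Fin (2 * n)) →
    (Fin (2 * n) ⊕ Fin (2 * n)) ⊕ Fin (2 * n) :=
  Sum.elim Sum.inl (Sum.elim (fun i => Sum.inl (Sum.inr i)) Sum.inr)

def separateLastSection : (Fin (2 * n) ⊕ Fin (2 * n)) ⊕ Fin (2 * n) →
    (Fin (2 * n) ⊕ Fin (2 * n)) ⊕ (Fin (2 * n) ⊕ Fin (2 * n)) :=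
  Sum.elim Sum.inl fun i => Sum.inr (Sum.inr i)

/-- Before the contraction of `c`, the first line of `W(d)cW(c)bW(b)a` is separate. -/
def separateFirst : (Fin (2 * n) ⊕ Fin (2 * n)) ⊕ (Fin (2 * n) ⊕ Fin (2 * n)) →
    (Fin (2 * n) ⊕ Fin (2 * n)) ⊕ Fin (2 * n) :=
  Sum.elim (Sum.elim Sum.inr fun i => Sum.inl (Sum.inl i)) Sum.inl

def separateFirstSection : (Fin (2 * n) ⊕ Fin (2 * n)) ⊕ Fin (2 * n) →
    (Fin (2 * n) ⊕ Fin (2 * n)) ⊕ (Fin (2 * n) ⊕ Fin (2 * n)) :=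
  Sum.elim (Sum.elim (fun i => Sum.inl (Sum.inr i)) fun i => Sum.inr (Sum.inr i))
    fun i => Sum.inl (Sum.inl i)

/-- The contraction of `c` identifies the first three lines of `W(d)cW(c)bW(b)a`. -/
def collapseFirst : (Fin (2 * n) ⊕ Fin (2 * n)) ⊕ (Fin (2 * n) ⊕ Fin (2 * n)) →
    Fin (2 * n) ⊕ Fin (2 * n) :=
  Sum.elim (fun x => Sum.inl (ChronologyChoice.collapse x)) id

def collapseFirstSection : Fin (2 * n) ⊕ Fin (2 * n) →
    (Fin (2 * n) ⊕ Fin (2 * n)) ⊕ (Fin (2 * n) ⊕ Fin (2 * n)) :=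
  Sum.elim (fun i => Sum.inl (Sum.inl i)) fun i => Sum.inr (Sum.inr i)

/-- The contraction of `b` identifies the last three lines of `W(d)cW(c)bW(b)a`. -/
def collapseLast : (Fin (2 * n) ⊕ Fin (2 * n)) ⊕ (Fin (2 * n) ⊕ Fin (2 * n)) →
    Fin (2 * n) ⊕ Fin (2 * n) :=
  Sum.elim id fun x => Sum.inr (ChronologyChoice.collapse x)

variable {d c b a}

theorem comap_of_eq {P T : Type} {s : Setoid T} {ρ : P → T} {x y : P} (h : ρ x = ρ y) :
    s.comap ρ x y := by
  change s (ρ x) (ρ y)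
  rw [h]

theorem outer_rel {f : (Fin (2 * n) ⊕ Fin (2 * n)) ⊕ (Fin (2 * n) ⊕ Fin (2 * n)) →
    (Fin (2 * n) ⊕ Fin (2 * n)) ⊕ (Fin (2 * n) ⊕ Fin (2 * n))} (i : Fin (2 * n)) :
    orbitSetoid f (outer₂ d a) (Sum.inl (Sum.inr i)) (Sum.inr (Sum.inl i)) :=
  orbitSetoid_right _ (outer₂ d a) (Sum.inl (Sum.inr i))

/-- While the arcs of `b` are untouched, the upper strip is closed up by `d` and `b`, and the
circles of `W(b)a` stand apart. The third line is a copy of the second one, joined to it by strands.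
-/
theorem family₂_state_left (K : Finset c.Arc) : (family₂ d c b a).state (K.disjSum ∅) =
    (disjointUnion ((family d c b).state K) (circleSetoid b a)).comap separateLast := by
  rw [family₂_state_disjSum]
  have hl := orbitSetoid_left (Sum.map (c.stripMatch K) (b.stripMatch ∅)) (outer₂ d a)
  have hr := orbitSetoid_right (Sum.map (c.stripMatch K) (b.stripMatch ∅)) (outer₂ d a)
  have ht := fun {x y z} => (orbitSetoid (Sum.map (c.stripMatch K) (b.stripMatch ∅)) (outer₂ d a)).trans' (x := x) (y := y) (z := z)
  have hb : ∀ x, b.stripMatch ∅ x = Sum.map b.partner b.partner x := by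
    rintro (x | x)
    exacts [stripMatch_inl_of_notMem (Finset.notMem_empty _),
      stripMatch_inr_of_notMem (Finset.notMem_empty _)]
  refine eq_comap_of_section (σ := separateLastSection) (orbitSetoid_le ?_ ?_)
    (disjointUnion_le (orbitSetoid_le ?_ ?_) (orbitSetoid_le ?_ ?_)) ?_
  · rintro (x | x)
    · exact disjointUnion_inl.2 (orbitSetoid_left (c.stripMatch K) (outer d b) x)
    · change disjointUnion _ _ (separateLast (Sum.inr x)) (separateLast (Sum.inr _))
      rw [hb]
      rcases x with x | x
      · exact disjointUnion_inl.2 (orbitSetoid_right (c.stripMatch K) (outer d b) (Sum.inr x))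
      · exact disjointUnion_inr.2 (orbitSetoid_left b.partner a.partner x)
  · rintro ((x | x) | (x | x))
    · exact disjointUnion_inl.2 (orbitSetoid_right (c.stripMatch K) (outer d b) (Sum.inl x))
    · exact comap_of_eq rfl
    · exact comap_of_eq rfl
    · exact disjointUnion_inr.2 (orbitSetoid_right b.partner a.partner x)
  · exact fun x => hl (Sum.inl x)
  · rintro (x | x)
    · exact hr (Sum.inl (Sum.inl x))
    · refine ht (outer_rel x) (ht (hl (Sum.inr (Sum.inl x))) ?_)
      rw [Sum.map_inr, hb]
      exact Setoid.symm' _ (outer_rel (b.partner x))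
  · intro x
    have := hl (Sum.inr (Sum.inr x))
    rwa [Sum.map_inr, hb] at this
  · exact fun x => hr (Sum.inr (Sum.inr x))
  · rintro ((x | x) | (x | x))
    exacts [Setoid.refl' _ _, Setoid.refl' _ _, Setoid.symm' _ (outer_rel x), Setoid.refl' _ _]

theorem family₂_state_right (K : Finset b.Arc) :
    (family₂ d c b a).state ((∅ : Finset c.Arc).disjSum K) =
      (disjointUnion ((family c b a).state K) (circleSetoid d c)).comap separateFirst := by
  rw [family₂_state_disjSum]
  have hl := orbitSetoid_left (Sum.map (c.stripMatch ∅) (b.stripMatch K)) (outer₂ d a)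
  have hr := orbitSetoid_right (Sum.map (c.stripMatch ∅) (b.stripMatch K)) (outer₂ d a)
  have ht := fun {x y z} => (orbitSetoid (Sum.map (c.stripMatch ∅) (b.stripMatch K)) (outer₂ d a)).trans' (x := x) (y := y) (z := z)
  have hc : ∀ x, c.stripMatch ∅ x = Sum.map c.partner c.partner x := by
    rintro (x | x)
    exacts [stripMatch_inl_of_notMem (Finset.notMem_empty _),
      stripMatch_inr_of_notMem (Finset.notMem_empty _)]
  have h3 : ∀ y, orbitSetoid (Sum.map (c.stripMatch ∅) (b.stripMatch K)) (outer₂ d a) y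
      (separateFirstSection (separateFirst y)) := by
    rintro ((x | x) | (x | x))
    exacts [Setoid.refl' _ _, Setoid.refl' _ _, Setoid.symm' _ (outer_rel x), Setoid.refl' _ _]
  refine eq_comap_of_section (σ := separateFirstSection) (orbitSetoid_le ?_ ?_)
    (disjointUnion_le (orbitSetoid_le ?_ ?_) (orbitSetoid_le ?_ ?_)) h3
  · rintro (x | x)
    · change disjointUnion _ _ (separateFirst (Sum.inl x)) (separateFirst (Sum.inl _))
      rw [hc]
      rcases x with x | x
      · exact disjointUnion_inr.2 (orbitSetoid_right d.partner c.partner x)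
      · exact disjointUnion_inl.2 (orbitSetoid_right (b.stripMatch K) (outer c a) (Sum.inl x))
    · exact disjointUnion_inl.2 (orbitSetoid_left (b.stripMatch K) (outer c a) x)
  · rintro ((x | x) | (x | x))
    · exact disjointUnion_inr.2 (orbitSetoid_left d.partner c.partner x)
    · exact comap_of_eq rfl
    · exact comap_of_eq rfl
    · exact disjointUnion_inl.2 (orbitSetoid_right (b.stripMatch K) (outer c a) (Sum.inr x))
  · exact fun x => ht (Setoid.symm' _ (h3 (Sum.inr x)))
      (ht (hl (Sum.inr x)) (h3 (Sum.inr (b.stripMatch K x))))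
  · rintro (x | x)
    · have := hl (Sum.inl (Sum.inr x))
      rwa [Sum.map_inl, hc] at this
    · exact hr (Sum.inr (Sum.inr x))
  · exact fun x => hr (Sum.inl (Sum.inl x))
  · intro x
    have := hl (Sum.inl (Sum.inl x))
    rwa [Sum.map_inl, hc] at this

/-- The contracted strip of `c` consists of vertical strands, so the first three lines are copies of
one another. -/
theorem family₂_state_left_univ (K : Finset b.Arc) :
    (family₂ d c b a).state ((Finset.univ : Finset c.Arc).disjSum K) =
      ((family d b a).state K).comap collapseFirst := by
  rw [family₂_state_disjSum]
  have hl := orbitSetoid_left (Sum.map (c.stripMatch Finset.univ) (b.stripMatch K)) (outer₂ d a)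
  have hr := orbitSetoid_right (Sum.map (c.stripMatch Finset.univ) (b.stripMatch K)) (outer₂ d a)
  have ht := fun {x y z} => (orbitSetoid (Sum.map (c.stripMatch Finset.univ) (b.stripMatch K)) (outer₂ d a)).trans' (x := x) (y := y) (z := z)
  have h2 : ∀ i, orbitSetoid (Sum.map (c.stripMatch Finset.univ) (b.stripMatch K)) (outer₂ d a)
      (Sum.inl (Sum.inr i)) (Sum.inl (Sum.inl i)) := fun i => by
    have := hl (Sum.inl (Sum.inr i))
    rwa [Sum.map_inl, stripMatch_univ] at this
  have h3 : ∀ y, orbitSetoid (Sum.map (c.stripMatch Finset.univ) (b.stripMatch K)) (outer₂ d a) y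
      (collapseFirstSection (collapseFirst y)) := by
    rintro ((x | x) | (x | x))
    exacts [Setoid.refl' _ _, h2 x, ht (Setoid.symm' _ (outer_rel x)) (h2 x),
      Setoid.refl' _ _]
  refine eq_comap_of_section (σ := collapseFirstSection) (orbitSetoid_le ?_ ?_)
    (orbitSetoid_le ?_ ?_) h3
  · rintro (x | x)
    · change (family d b a).state K (collapseFirst (Sum.inl x)) (collapseFirst (Sum.inl _))
      rw [stripMatch_univ]
      rcases x with x | x <;> exact Setoid.refl' _ _
    · exact orbitSetoid_left (b.stripMatch K) (outer d a) x
  · rintro ((x | x) | (x | x))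
    · exact orbitSetoid_right (b.stripMatch K) (outer d a) (Sum.inl x)
    · exact comap_of_eq rfl
    · exact comap_of_eq rfl
    · exact orbitSetoid_right (b.stripMatch K) (outer d a) (Sum.inr x)
  · exact fun x => ht (Setoid.symm' _ (h3 (Sum.inr x)))
      (ht (hl (Sum.inr x)) (h3 (Sum.inr (b.stripMatch K x))))
  · rintro (x | x)
    exacts [hr (Sum.inl (Sum.inl x)), hr (Sum.inr (Sum.inr x))]

theorem family₂_state_right_univ (K : Finset c.Arc) :
    (family₂ d c b a).state (K.disjSum (Finset.univ : Finset b.Arc)) =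
      ((family d c a).state K).comap collapseLast := by
  rw [family₂_state_disjSum]
  have hl := orbitSetoid_left (Sum.map (c.stripMatch K) (b.stripMatch Finset.univ)) (outer₂ d a)
  have hr := orbitSetoid_right (Sum.map (c.stripMatch K) (b.stripMatch Finset.univ)) (outer₂ d a)
  have ht := fun {x y z} => (orbitSetoid (Sum.map (c.stripMatch K) (b.stripMatch Finset.univ)) (outer₂ d a)).trans' (x := x) (y := y) (z := z)
  have h2 : ∀ i, orbitSetoid (Sum.map (c.stripMatch K) (b.stripMatch Finset.univ)) (outer₂ d a)
      (Sum.inr (Sum.inr i)) (Sum.inr (Sum.inl i)) := fun i => by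
    have := hl (Sum.inr (Sum.inr i))
    rwa [Sum.map_inr, stripMatch_univ] at this
  have h3 : ∀ y, orbitSetoid (Sum.map (c.stripMatch K) (b.stripMatch Finset.univ)) (outer₂ d a) y
      (Sum.inl (collapseLast y)) := by
    rintro ((x | x) | (x | x))
    exacts [Setoid.refl' _ _, Setoid.refl' _ _, Setoid.symm' _ (outer_rel x),
      ht (h2 x) (Setoid.symm' _ (outer_rel x))]
  refine eq_comap_of_section (σ := Sum.inl) (orbitSetoid_le ?_ ?_) (orbitSetoid_le ?_ ?_) h3
  · rintro (x | x)
    · exact orbitSetoid_left (c.stripMatch K) (outer d a) x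
    · change (family d c a).state K (collapseLast (Sum.inr x)) (collapseLast (Sum.inr _))
      rw [stripMatch_univ]
      rcases x with x | x <;> exact Setoid.refl' _ _
  · rintro ((x | x) | (x | x))
    · exact orbitSetoid_right (c.stripMatch K) (outer d a) (Sum.inl x)
    · exact comap_of_eq rfl
    · exact comap_of_eq rfl
    · exact orbitSetoid_right (c.stripMatch K) (outer d a) (Sum.inr x)
  · exact fun x => hl (Sum.inl x)
  · rintro (x | x)
    · exact hr (Sum.inl (Sum.inl x))
    · exact ht (Setoid.symm' _ (h3 (Sum.inr (Sum.inr x))))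
        (ht (hr (Sum.inr (Sum.inr x))) (h3 (Sum.inr (Sum.inr (a.partner x)))))

end Reductions

end CrossinglessMatching


/-! ### The sign exponents of the two composites -/

open SaddleFamily ColouredFamily

section

variable {E E' : Type}

theorem Finset.mem_insert_iff [DecidableEq E] {K : Finset E} {x e : E} :
    x ∈ insert e K ↔ x = e ∨ x ∈ K := Finset.mem_insert

open scoped Classical

/-- The decidability instance in the insertion is the classical one, to match the definitions of
paths and factors. -/
theorem Finset.insert_disjSum' (K : Finset E) (K' : Finset E') (e : E) :
    (insert e K).disjSum K' = @insert _ _ (@Finset.instInsert _ fun x y =>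
      Classical.propDecidable (x = y)) (Sum.inl e) (K.disjSum K') := by
  ext (x | x) <;> rw [@Finset.mem_insert_iff _ fun x y => Classical.propDecidable (x = y)] <;> simp

theorem Finset.disjSum_insert' (K : Finset E) (K' : Finset E') (e : E') :
    K.disjSum (insert e K') = @insert _ _ (@Finset.instInsert _ fun x y =>
      Classical.propDecidable (x = y)) (Sum.inr e) (K.disjSum K') := by
  ext (x | x) <;> rw [@Finset.mem_insert_iff _ fun x y => Classical.propDecidable (x = y)] <;> simp

/-- An element related to `e` by `S` cannot come after `e`, so it is present once `e` is added. -/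
theorem ColouredFamily.isPath_of_pairwise {S : E → E → Prop} {K : Finset E} {L : List E}
    (h1 : ∀ e, e ∈ K ∨ e ∈ L) (h2 : ∀ e ∈ L, e ∉ K) (h3 : L.Nodup)
    (h4 : L.Pairwise fun e e' => ¬ S e' e) (hK : ∀ e ∈ K, ∀ f, S f e → f ∈ K) :
    IsPath (fun K => ∀ e ∈ K, ∀ f, S f e → f ∈ K) K L := by
  induction L generalizing K with
  | nil => exact hK
  | cons e L ih =>
    rw [List.nodup_cons] at h3
    rw [List.pairwise_cons] at h4
    refine ⟨hK, h2 e List.mem_cons_self, ih (fun x => ?_) (fun x hx => ?_) h3.2 h4.2 ?_⟩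
    · have := h1 x
      rw [List.mem_cons] at this
      rw [Finset.mem_insert]; tauto
    · rw [Finset.mem_insert, not_or]
      exact ⟨fun k => h3.1 (k ▸ hx), h2 x (List.mem_cons_of_mem _ hx)⟩
    · intro x hx f hf
      rw [Finset.mem_insert] at hx ⊢
      rcases hx with rfl | hx
      · have := h1 f
        rw [List.mem_cons] at this
        rcases this with k | k | k
        exacts [Or.inr k, Or.inl k, absurd hf (h4.1 f k)]
      · exact Or.inr (hK x hx f hf)

end

namespace CrossinglessMatching

variable {n : ℕ} {d c b a : CrossinglessMatching n}

section White

theorem family₂_white_left (K : Finset c.Arc) : (family₂ d c b a).white (K.disjSum ∅) =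
    (disjointUnion ((family d c b).white K) (whiteCircles b a)).comap separateLast := by
  rw [family₂_white, family₂_state_left, comap_sup_orbitSetoid (σ := separateLastSection)
    (m' := Sum.map (Sum.map mate mate) mate), ← disjointUnion_orbitSetoid, disjointUnion_sup,
    ← family_white]
  · rfl
  · rintro ((x | x) | x) <;> rfl
  · rintro ((x | x) | (x | x)) <;> rfl

theorem family₂_white_right (K : Finset b.Arc) :
    (family₂ d c b a).white ((∅ : Finset c.Arc).disjSum K) =
      (disjointUnion ((family c b a).white K) (whiteCircles d c)).comap separateFirst := by
  rw [family₂_white, family₂_state_right, comap_sup_orbitSetoid (σ := separateFirstSection)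
    (m' := Sum.map (Sum.map mate mate) mate), ← disjointUnion_orbitSetoid, disjointUnion_sup,
    ← family_white]
  · rfl
  · rintro ((x | x) | x) <;> rfl
  · rintro ((x | x) | (x | x)) <;> rfl

theorem family₂_white_left_univ (K : Finset b.Arc) :
    (family₂ d c b a).white ((Finset.univ : Finset c.Arc).disjSum K) =
      ((family d b a).white K).comap collapseFirst := by
  rw [family₂_white, family₂_state_left_univ, comap_sup_orbitSetoid (σ := collapseFirstSection)
    (m' := Sum.map mate mate), ← family_white]
  · rintro (x | x) <;> rfl
  · rintro ((x | x) | (x | x)) <;> rfl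

theorem family₂_white_right_univ (K : Finset c.Arc) :
    (family₂ d c b a).white (K.disjSum (Finset.univ : Finset b.Arc)) =
      ((family d c a).white K).comap collapseLast := by
  rw [family₂_white, family₂_state_right_univ, comap_sup_orbitSetoid (σ := Sum.inl)
    (m' := Sum.map mate mate), ← family_white]
  · exact fun x => rfl
  · rintro ((x | x) | (x | x)) <;> rfl

end White

section BlackCounts

open scoped Classical

/-- The number, modulo `2`, of the arcs contracted in black regions. -/
noncomputable def blackArcs (b : CrossinglessMatching n) : ZMod 2 :=
  (family b b b).blackCount Finset.univ

theorem family₂_blackCount (K : Finset c.Arc) (K' : Finset b.Arc) :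
    (family₂ d c b a).blackCount (K.disjSum K') =
      (family d c b).blackCount K + (family c b a).blackCount K' := by
  simp only [blackCount, Finset.card_filter, Finset.sum_disjSum, Nat.cast_add]
  rfl

/-- In the list of black saddles on four lines the arcs of `b` come before those of `c`, so the
contracted black arcs of `b` all count here, whereas those of `c` do not count for an arc of `b`. -/
theorem family₂_blackBefore_inl (K : Finset c.Arc) (K' : Finset b.Arc) (e : c.Arc) :
    (family₂ d c b a).blackBefore (K.disjSum K') (Sum.inl e) =
      (family d c b).blackBefore K e + (family c b a).blackCount K' := by
  simp only [blackBefore, blackCount, Finset.card_filter, Finset.sum_disjSum, Nat.cast_add]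
  congr 2
  · refine Finset.sum_congr rfl fun x _ => if_congr (and_congr Iff.rfl ?_) rfl rfl
    change 2 * n + x.1.val < 2 * n + e.1.val ↔ x.1.val < e.1.val
    omega
  · refine Finset.sum_congr rfl fun x _ => if_congr (and_iff_left ?_) rfl rfl
    change x.1.val < 2 * n + e.1.val
    have := x.1.2; omega

theorem family₂_blackBefore_inr (K : Finset c.Arc) (K' : Finset b.Arc) (e : b.Arc) :
    (family₂ d c b a).blackBefore (K.disjSum K') (Sum.inr e) =
      (family c b a).blackBefore K' e := by
  simp only [blackBefore, Finset.card_filter, Finset.sum_disjSum, Nat.cast_add]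
  rw [Finset.sum_eq_zero, Nat.cast_zero, zero_add]
  · rfl
  · intro x _
    refine if_neg fun h => ?_
    have h2 : 2 * n + x.1.val < e.1.val := h.2
    have := e.1.2; omega

end BlackCounts

open scoped Classical

/-- No correction: nothing of `b` is contracted, and the white regions of `W(b)a` come last in the
enumeration. -/
theorem tau_left (K : Finset c.Arc) (e : c.Arc) :
    (family₂ d c b a).tau (K.disjSum ∅) (Sum.inl e) = (family d c b).tau K e +
      (if (family d c b).black e then 1 else 0) * 0 +
      (if (family d c b).Changes K e then 1 else 0) * (0 + 0) := by
  refine tau_of_isPartition (M' := family₂ d c b a) (M := family d c b) (j := Sum.inl)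
    (k := fun K => K.disjSum ∅) (v := whiteCircles b a)
    (inc := separateLastSection ∘ Sum.inl) (extra := separateLastSection ∘ Sum.inr)
    (fun e K => Finset.insert_disjSum' K ∅ e) (fun _ => Iff.rfl)
    (fun K => IsPartition.of_comap (family₂_white_left K) ?_ ?_ ?_)
    (fun _ _ => Setoid.refl' _ _) (fun _ _ => Setoid.refl' _ _) (fun K e => ?_) (fun K => ?_)
    (fun h p t => ?_) K e
  · rintro ((x | x) | x) <;> rfl
  · rintro ((x | x) | (x | x)) <;>
      simp [separateLast, separateLastSection, family₂, StripSystem.toFamily, rank₂, rank₁]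
    omega
  · exact fun _ _ => Iff.rfl
  · exact family₂_blackBefore_inl K ∅ e
  · exact family₂_blackCount K ∅
  · rw [add_zero]
    refine h.theta_inc_of_le rank₁_injective rank₂_injective
      (fun x y h => Sum.inl_injective h) (fun x y h => Sum.inr_injective (Sum.inr_injective h)) ?_ p t
    intro x y
    have := rank₁_lt x
    change rank₁ x < 4 * n + (2 * n + y.val)
    omega

/-- The black arcs of `c`, contracted earlier, enter through the Koszul sign at each change of white
regions. -/
theorem tau_left_univ (K : Finset b.Arc) (e : b.Arc) :
    (family₂ d c b a).tau ((Finset.univ : Finset c.Arc).disjSum K) (Sum.inr e) =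
      (family d b a).tau K e + (if (family d b a).black e then 1 else 0) * 0 +
      (if (family d b a).Changes K e then 1 else 0) * (blackArcs c + 0) := by
  have hr : ∀ {x y}, collapseFirst x = collapseFirst y → ∀ K : Finset b.Arc,
      (family₂ d c b a).white ((Finset.univ : Finset c.Arc).disjSum K) x y := fun h K => by
    rw [family₂_white_left_univ]; exact comap_of_eq h
  refine tau_of_isPartition (M' := family₂ d c b a) (M := family d b a) (j := Sum.inr)
    (k := fun K => Finset.univ.disjSum K) (inc := collapseFirstSection) (extra := Empty.elim)
    (fun e K => Finset.disjSum_insert' _ K e) (fun _ => Iff.rfl)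
    (fun K => IsPartition.of_comap' (family₂_white_left_univ K) ?_ ?_ ?_)
    (fun _ K => hr (by rfl) K) (fun _ K => hr (by rfl) K) (fun K e => ?_) (fun K => ?_)
    (fun h p t => ?_) K e
  · rintro (x | x) <;> rfl
  · rintro ((x | x) | (x | x)) <;>
      simp [collapseFirst, collapseFirstSection, family₂, StripSystem.toFamily, rank₂, rank₁,
        ChronologyChoice.collapse]
  · rintro (x | x) (y | y) <;>
      simp only [collapseFirstSection, family₂, family, StripSystem.toFamily, rank₂, rank₁,
        Sum.elim_inl, Sum.elim_inr] <;> omega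
  · exact (family₂_blackBefore_inr _ K e).trans (add_zero _).symm
  · exact (family₂_blackCount _ K).trans (add_comm _ _)
  · rw [add_zero]
    refine h.theta_inc_of_le rank₁_injective rank₂_injective ?_ (fun x => x.elim)
      (fun _ x => x.elim) p t
    rintro (x | x) (y | y) h
    exacts [congrArg Sum.inl (Sum.inl_injective (Sum.inl_injective h)), (nomatch h), (nomatch h),
      congrArg Sum.inr (Sum.inr_injective (Sum.inr_injective h))]

/-- The white regions of `W(d)c` come first in the enumeration and shift every position. -/
theorem tau_right (K : Finset b.Arc) (e : b.Arc) :
    (family₂ d c b a).tau ((∅ : Finset c.Arc).disjSum K) (Sum.inr e) = (family c b a).tau K e +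
      (if (family c b a).black e then 1 else 0) * 0 +
      (if (family c b a).Changes K e then 1 else 0) * (0 + whiteCount d c) := by
  have hr : ∀ {x y}, separateFirst x = separateFirst y → ∀ K : Finset b.Arc,
      (family₂ d c b a).white ((∅ : Finset c.Arc).disjSum K) x y := fun h K => by
    rw [family₂_white_right]; exact comap_of_eq h
  refine tau_of_isPartition (M' := family₂ d c b a) (M := family c b a) (j := Sum.inr)
    (k := fun K => (∅ : Finset c.Arc).disjSum K) (v := whiteCircles d c)
    (inc := separateFirstSection ∘ Sum.inl) (extra := separateFirstSection ∘ Sum.inr)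
    (fun e K => Finset.disjSum_insert' _ K e) (fun _ => Iff.rfl)
    (fun K => IsPartition.of_comap (family₂_white_right K) ?_ ?_ ?_)
    (fun _ K => hr (by rfl) K) (fun _ K => hr (by rfl) K) (fun K e => ?_) (fun K => ?_)
    (fun h p t => ?_) K e
  · rintro ((x | x) | x) <;> rfl
  · rintro ((x | x) | (x | x)) <;>
      simp [separateFirst, separateFirstSection, family₂, StripSystem.toFamily, rank₂, rank₁]
    omega
  · rintro (x | x) (y | y) <;>
      simp only [separateFirstSection, family₂, family, StripSystem.toFamily, rank₂, rank₁,
        Sum.elim_inl, Sum.elim_inr] <;> omega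
  · exact (family₂_blackBefore_inr _ K e).trans (add_zero _).symm
  · exact (family₂_blackCount _ K).trans (add_comm _ _)
  · refine h.theta_inc_of_ge rank₁_injective rank₂_injective ?_
      (fun x y h => Sum.inl_injective (Sum.inl_injective h)) ?_ p t
    · rintro (x | x) (y | y) h
      exacts [congrArg Sum.inl (Sum.inr_injective (Sum.inl_injective h)), (nomatch h), (nomatch h),
        congrArg Sum.inr (Sum.inr_injective (Sum.inr_injective h))]
    · rintro (x | x) y <;>
        simp only [separateFirstSection, family₂, StripSystem.toFamily, rank₂, rank₁,
          Sum.elim_inl, Sum.elim_inr, Function.comp_apply] <;> have := y.2 <;> omega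

/-- The contracted black arcs of `b` count twice: as predecessors of each black arc of `c`, and in
the Koszul sign at each change of white regions. -/
theorem tau_right_univ (K : Finset c.Arc) (e : c.Arc) :
    (family₂ d c b a).tau (K.disjSum (Finset.univ : Finset b.Arc)) (Sum.inl e) =
      (family d c a).tau K e + (if (family d c a).black e then 1 else 0) * blackArcs b +
      (if (family d c a).Changes K e then 1 else 0) * (blackArcs b + 0) := by
  have hr : ∀ {x y}, collapseLast x = collapseLast y → ∀ K : Finset c.Arc,
      (family₂ d c b a).white (K.disjSum (Finset.univ : Finset b.Arc)) x y := fun h K => by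
    rw [family₂_white_right_univ]; exact comap_of_eq h
  refine tau_of_isPartition (M' := family₂ d c b a) (M := family d c a) (j := Sum.inl)
    (k := fun K => K.disjSum Finset.univ) (inc := Sum.inl) (extra := Empty.elim)
    (fun e K => Finset.insert_disjSum' K _ e) (fun _ => Iff.rfl)
    (fun K => IsPartition.of_comap' (family₂_white_right_univ K) ?_ ?_ ?_)
    (fun _ K => hr (by rfl) K) (fun _ K => hr (by rfl) K) (fun K e => ?_) (fun K => ?_)
    (fun h p t => ?_) K e
  · exact fun x => rfl
  · rintro ((x | x) | (x | x)) <;>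
      simp [collapseLast, family₂, StripSystem.toFamily, rank₂, rank₁,
        ChronologyChoice.collapse]
    omega
  · exact fun _ _ => Iff.rfl
  · exact family₂_blackBefore_inl K _ e
  · exact family₂_blackCount K _
  · rw [add_zero]
    exact h.theta_inc_of_le rank₁_injective rank₂_injective Sum.inl_injective (fun x => x.elim)
      (fun _ x => x.elim) p t

section Paths

theorem _root_.Chronology.isPath (χ : Chronology b) : IsPath Admissible ∅ χ.order :=
  isPath_of_pairwise (fun e => Or.inr (χ.mem_order e)) (fun _ _ => Finset.notMem_empty _) χ.nodup
    χ.not_surrounds fun _ h => absurd h (Finset.notMem_empty _)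

theorem _root_.Chronology.after_eq (χ : Chronology b) : after ∅ χ.order = Finset.univ := by
  ext e; rw [mem_after]; simp [χ.mem_order e]

theorem blackSum_eq (χ : Chronology b) : (family c b a).blackSum χ.order = blackArcs b := by
  have := blackCount_after (M := family c b a) χ.isPath
  rw [χ.after_eq] at this
  refine Eq.trans ?_ this.symm
  simp [blackCount]

theorem changeCount_order (χ : Chronology b) : (family c b a).changeCount ∅ χ.order =
    whiteCount c a + (whiteCount c b + whiteCount b a) := by
  rw [changeCount_eq (family_isPlanar c b a) χ.isPath, χ.after_eq, card_white_empty,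
    card_white_univ]

/-- The sign exponent of a sequence of contractions. -/
noncomputable def orderSign (c a : CrossinglessMatching n) (χ : Chronology b) : ZMod 2 :=
  (family c b a).tauList ∅ χ.order

/-- The factor of a sequence of contractions, in terms of the points of one line. -/
noncomputable def orderFactor (c a : CrossinglessMatching n) (χ : Chronology b) :
    PointAlgebra (Fin (2 * n)) :=
  PointAlgebra.map ChronologyChoice.collapse ((family c b a).factor ∅ χ.order)

/-- The four lines are collapsed to one. -/
def collapse₂ : (Fin (2 * n) ⊕ Fin (2 * n)) ⊕ (Fin (2 * n) ⊕ Fin (2 * n)) → Fin (2 * n) :=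
  Sum.elim ChronologyChoice.collapse ChronologyChoice.collapse

variable (d a) in
theorem map_factor_left (χ : Chronology c) : PointAlgebra.map collapse₂
    ((family₂ d c b a).factor ((∅ : Finset c.Arc).disjSum ∅) (χ.order.map Sum.inl)) =
      orderFactor d b χ :=
  map_factor (k := fun K => K.disjSum ∅) (fun e K => Finset.insert_disjSum' K ∅ e)
    (fun e K => by rw [family₂_state_left]; exact disjointUnion_inl) (fun _ => rfl) (fun _ => rfl)
    ∅ χ.order

variable (d a) in
theorem map_factor_left_univ (χ : Chronology b) : PointAlgebra.map collapse₂
    ((family₂ d c b a).factor ((Finset.univ : Finset c.Arc).disjSum ∅) (χ.order.map Sum.inr)) =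
      orderFactor d a χ :=
  map_factor (k := fun K => (Finset.univ : Finset c.Arc).disjSum K)
    (fun e K => Finset.disjSum_insert' _ K e)
    (fun e K => by rw [family₂_state_left_univ]; exact Iff.rfl) (fun _ => rfl) (fun _ => rfl)
    ∅ χ.order

variable (d a) in
theorem map_factor_right (χ : Chronology b) : PointAlgebra.map collapse₂
    ((family₂ d c b a).factor ((∅ : Finset c.Arc).disjSum ∅) (χ.order.map Sum.inr)) =
      orderFactor c a χ :=
  map_factor (k := fun K => (∅ : Finset c.Arc).disjSum K) (fun e K => Finset.disjSum_insert' _ K e)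
    (fun e K => by rw [family₂_state_right]; exact disjointUnion_inl) (fun _ => rfl) (fun _ => rfl)
    ∅ χ.order

variable (d a) in
theorem map_factor_right_univ (χ : Chronology c) : PointAlgebra.map collapse₂
    ((family₂ d c b a).factor ((∅ : Finset c.Arc).disjSum (Finset.univ : Finset b.Arc))
      (χ.order.map Sum.inl)) = orderFactor d a χ :=
  map_factor (k := fun K => K.disjSum Finset.univ) (fun e K => Finset.insert_disjSum' K _ e)
    (fun e K => by rw [family₂_state_right_univ]; exact Iff.rfl) (fun _ => rfl) (fun _ => rfl)
    ∅ χ.order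

theorem adm_disjSum {K : Finset c.Arc} {K' : Finset b.Arc} (h : Admissible K)
    (h' : Admissible K') : (c.strip.sum b.strip).adm (K.disjSum K') := by
  change Admissible (K.disjSum K').toLeft ∧ Admissible (K.disjSum K').toRight
  rw [Finset.toLeft_disjSum, Finset.toRight_disjSum]
  exact ⟨h, h'⟩

theorem admissible_empty : Admissible (∅ : Finset b.Arc) :=
  fun _ h => absurd h (Finset.notMem_empty _)

theorem admissible_univ : Admissible (Finset.univ : Finset b.Arc) :=
  fun _ _ _ _ => Finset.mem_univ _

theorem family₂_state_univ : (family₂ d c b a).state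
    ((Finset.univ : Finset c.Arc).disjSum (Finset.univ : Finset b.Arc)) =
      (circleSetoid d a).comap collapse₂ := by
  rw [family₂_state_left_univ, family_state_univ]
  ext x y
  change circleSetoid d a _ _ ↔ circleSetoid d a _ _
  rcases x with (x | x) | (x | x) <;> rcases y with (y | y) | (y | y) <;> rfl

/-- The products of the factors along the two ways of composing contractions agree up to sign. -/
theorem signed_orderFactor (χ₁ : Chronology c) (χ₂ χ₃ : Chronology b) (χ₄ : Chronology c) :
    signOf (orderSign d b χ₁ + (orderSign d a χ₂ +
        (whiteCount d a + (whiteCount d b + whiteCount b a)) * blackArcs c)) •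
      PointAlgebra.proj (circleSetoid d a) (orderFactor d a χ₂ * orderFactor d b χ₁) =
    signOf (orderSign c a χ₃ + (whiteCount c a + (whiteCount c b + whiteCount b a)) *
        whiteCount d c + (orderSign d a χ₄ + blackArcs c * blackArcs b +
        (whiteCount d a + (whiteCount d c + whiteCount c a)) * blackArcs b)) •
      PointAlgebra.proj (circleSetoid d a) (orderFactor d a χ₄ * orderFactor c a χ₃) := by
  have hM := family₂_isPlanar d c b a
  have afterL : after ((∅ : Finset c.Arc).disjSum (∅ : Finset b.Arc)) (χ₁.order.map Sum.inl) =
      Finset.univ.disjSum ∅ := by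
    rw [after_map (k := fun K => K.disjSum (∅ : Finset b.Arc)) (fun e K => Finset.insert_disjSum' K ∅ e),
      χ₁.after_eq]
  have afterR : after ((∅ : Finset c.Arc).disjSum (∅ : Finset b.Arc)) (χ₃.order.map Sum.inr) =
      Finset.disjSum ∅ Finset.univ := by
    rw [after_map (k := fun K => (∅ : Finset c.Arc).disjSum K) (fun e K => Finset.disjSum_insert' _ K e),
      χ₃.after_eq]
  have afterLU : after ((Finset.univ : Finset c.Arc).disjSum (∅ : Finset b.Arc))
      (χ₂.order.map Sum.inr) = Finset.univ.disjSum Finset.univ := by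
    rw [after_map (k := fun K => (Finset.univ : Finset c.Arc).disjSum K)
      (fun e K => Finset.disjSum_insert' _ K e), χ₂.after_eq]
  have h1 : IsPath (c.strip.sum b.strip).adm ((∅ : Finset c.Arc).disjSum (∅ : Finset b.Arc))
      (χ₁.order.map Sum.inl ++ χ₂.order.map Sum.inr) := by
    refine (isPath_map (k := fun K => K.disjSum ∅) (fun e K => Finset.insert_disjSum' K ∅ e)
      (by simp) (fun K hK => adm_disjSum hK admissible_empty) χ₁.isPath).append ?_
    rw [afterL]
    exact isPath_map (k := fun K => Finset.univ.disjSum K) (fun e K => Finset.disjSum_insert' _ K e)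
      (by simp) (fun K hK => adm_disjSum admissible_univ hK) χ₂.isPath
  have h2 : IsPath (c.strip.sum b.strip).adm ((∅ : Finset c.Arc).disjSum (∅ : Finset b.Arc))
      (χ₃.order.map Sum.inr ++ χ₄.order.map Sum.inl) := by
    refine (isPath_map (k := fun K => Finset.disjSum ∅ K) (fun e K => Finset.disjSum_insert' _ K e)
      (by simp) (fun K hK => adm_disjSum admissible_empty hK) χ₃.isPath).append ?_
    rw [afterR]
    exact isPath_map (k := fun K => K.disjSum Finset.univ) (fun e K => Finset.insert_disjSum' K _ e)
      (by simp) (fun K hK => adm_disjSum hK admissible_univ) χ₄.isPath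
  have hp : (χ₁.order.map Sum.inl ++ χ₂.order.map Sum.inr).Perm
      (χ₃.order.map Sum.inr ++ χ₄.order.map Sum.inl) := by
    have nd : ∀ (χ : Chronology c) (χ' : Chronology b),
        (χ.order.map (Sum.inl : c.Arc → c.Arc ⊕ b.Arc) ++ χ'.order.map Sum.inr).Nodup := by
      intro χ χ'
      refine List.nodup_append.2 ⟨χ.nodup.map Sum.inl_injective, χ'.nodup.map Sum.inr_injective, ?_⟩
      simp
    refine ((List.perm_ext_iff_of_nodup (nd _ _) (nd χ₄ χ₃)).2 ?_).trans List.perm_append_comm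
    rintro (x | x) <;> simp [Chronology.mem_order]
  -- On four lines both composites are orders of the same set of saddles. What follows rewrites the
  -- exponents of the four segments through the diagrams on two lines.
  have key := signed_eq_of_perm hM h1 h2 hp
    (F := (Finset.univ : Finset c.Arc).disjSum (Finset.univ : Finset b.Arc))
    (by rw [after_append, afterL, afterLU])
  have e1 : (family₂ d c b a).tauList ((∅ : Finset c.Arc).disjSum ∅) (χ₁.order.map Sum.inl) =
      orderSign d b χ₁ := by
    rw [tauList_transport (M := family d c b) (k := fun K => K.disjSum ∅)
      (fun e K => Finset.insert_disjSum' K ∅ e) tau_left ∅ χ₁.order, orderSign]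
    ring
  have e2 : (family₂ d c b a).tauList ((Finset.univ : Finset c.Arc).disjSum ∅)
      (χ₂.order.map Sum.inr) = orderSign d a χ₂ +
        (whiteCount d a + (whiteCount d b + whiteCount b a)) * blackArcs c := by
    rw [tauList_transport (M := family d b a) (k := fun K => (Finset.univ : Finset c.Arc).disjSum K)
      (fun e K => Finset.disjSum_insert' _ K e) tau_left_univ ∅ χ₂.order, orderSign, changeCount_order]
    ring
  have e3 : (family₂ d c b a).tauList ((∅ : Finset c.Arc).disjSum ∅)
      (χ₃.order.map Sum.inr) = orderSign c a χ₃ +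
        (whiteCount c a + (whiteCount c b + whiteCount b a)) * whiteCount d c := by
    rw [tauList_transport (M := family c b a) (k := fun K => (∅ : Finset c.Arc).disjSum K)
      (fun e K => Finset.disjSum_insert' _ K e) tau_right ∅ χ₃.order, orderSign, changeCount_order]
    ring
  have e4 : (family₂ d c b a).tauList ((∅ : Finset c.Arc).disjSum (Finset.univ : Finset b.Arc))
      (χ₄.order.map Sum.inl) = orderSign d a χ₄ + blackArcs c * blackArcs b +
        (whiteCount d a + (whiteCount d c + whiteCount c a)) * blackArcs b := by
    rw [tauList_transport (M := family d c a) (k := fun K => K.disjSum Finset.univ)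
      (fun e K => Finset.insert_disjSum' K _ e) tau_right_univ ∅ χ₄.order, orderSign, changeCount_order,
      blackSum_eq]
    ring
  rw [tauList_append, tauList_append, factor_append, factor_append, afterL, afterR, e1, e2, e3, e4,
    ← map_zsmul, ← map_zsmul] at key
  have hle := (family₂_state_univ (d := d) (c := c) (b := b) (a := a)).le
  have := PointAlgebra.proj_map_eq hle key
  simpa only [map_zsmul, map_mul, map_factor_left, map_factor_left_univ, map_factor_right,
    map_factor_right_univ] using this

end Paths

end CrossinglessMatching


/-! ### Contractions as multiplications, and the sign of the change of chronology -/

open SaddleFamily ColouredFamily CrossinglessMatching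

namespace CrossinglessMatching

variable {n : ℕ} {c b a : CrossinglessMatching n}

/-- Every arc has exactly one end at an even position. -/
theorem length_order (χ : Chronology b) : χ.order.length = n := by
  classical
  have h1 : χ.order.toFinset = Finset.univ := by ext e; simp [χ.mem_order e]
  rw [← List.toFinset_card_of_nodup χ.nodup, h1, Finset.card_univ, ← Nat.card_eq_fintype_card]
  refine Eq.trans ?_ (Nat.card_eq_fintype_card.trans (card_even n))
  refine Nat.card_congr (Equiv.ofBijective (fun e => ⟨evenEnd e, even_evenEnd e⟩) ⟨?_, ?_⟩)
  · intro e f h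
    rw [← arcOf_evenEnd e, ← arcOf_evenEnd f]
    exact congrArg (fun x : {i : Fin (2 * n) // Even i.val} => b.arcOf x) h
  · rintro ⟨i, hi⟩
    refine ⟨b.arcOf i, Subtype.ext ?_⟩
    rcases arcOf_eq_iff'.1 (rfl : b.arcOf i = b.arcOf i) with h | h
    · exact h.symm
    · rw [h, ← partner_evenEnd, even_partner] at hi
      exact absurd (even_evenEnd _) hi

theorem numCircles_self (b : CrossinglessMatching n) : numCircles b b = n := by
  have h : evenPerm b b = 1 := by ext x; simp [evenPerm, b.partner_partner]
  rw [← card_evenPerm_orbits, h]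
  refine Eq.trans (Nat.card_congr (Equiv.ofBijective
    (Quotient.mk (Equiv.Perm.SameCycle.setoid (1 : Equiv.Perm {i : Fin (2 * n) // Even i.val})))
    ⟨?_, Quotient.mk_surjective⟩)).symm (Nat.card_eq_fintype_card.trans (card_even n))
  intro x y h
  obtain ⟨k, hk⟩ := Quotient.exact h
  simpa using hk

end CrossinglessMatching

section Contraction

variable {n : ℕ} {c b a : CrossinglessMatching n} (χ : Chronology b)

theorem contraction_state_eq (K : Finset b.Arc) :
    (contraction c a χ).state K = (family c b a).state K :=
  contraction_state c a χ K

theorem contraction_ends (e : b.Arc) :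
    (contraction c a χ).tail e = Sum.inl (evenEnd e) ∧
      (contraction c a χ).head e = Sum.inl (oddEnd e) ∨
    (contraction c a χ).tail e = Sum.inl (oddEnd e) ∧
      (contraction c a χ).head e = Sum.inl (evenEnd e) := by
  unfold contraction evenEnd oddEnd
  by_cases h1 : χ.leftToRight e <;> by_cases h2 : Even e.1.val <;> simp [h1, h2]

theorem family_state_odd {K : Finset b.Arc} {e : b.Arc} (h : e ∈ K) :
    (family c b a).state K (Sum.inl (oddEnd e)) (Sum.inr (oddEnd e)) := by
  have := orbitSetoid_left (b.stripMatch K) (outer c a) (Sum.inl (oddEnd e))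
  rwa [stripMatch_inl_of_mem (by rwa [arcOf_oddEnd])] at this

/-- A chronology orients the saddle along the upper line, whereas the coloured family orients it
from the upper even end to the lower odd end. Once `e` is contracted the two odd ends lie on one
strand, so the arrows agree up to reversal. -/
theorem contraction_glue {K : Finset b.Arc} {e : b.Arc} (h : e ∈ K) :
    ((family c b a).state K).glue ((contraction c a χ).tail e) ((contraction c a χ).head e) =
      ((family c b a).state K).glue ((family c b a).tail e) ((family c b a).head e) := by
  have h1 : ((family c b a).state K).glue ((family c b a).tail e) ((family c b a).head e) =
      ((family c b a).state K).glue (Sum.inl (evenEnd e)) (Sum.inl (oddEnd e)) :=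
    Setoid.glue_congr (Setoid.refl' _ _) (Setoid.symm' _ (family_state_odd h))
  rcases contraction_ends (c := c) (a := a) χ e with ⟨e1, e2⟩ | ⟨e1, e2⟩
  · rw [h1, e1, e2]
  · rw [h1, e1, e2, Setoid.glue_swap]

theorem contraction_rel_iff {K : Finset b.Arc} {e : b.Arc} (h : e ∈ K) :
    (contraction c a χ).state K ((contraction c a χ).tail e) ((contraction c a χ).head e) ↔
      (family c b a).state K ((family c b a).tail e) ((family c b a).head e) := by
  have h1 := family_state_odd (c := c) (a := a) h
  rw [contraction_state_eq]
  change _ ↔ (family c b a).state K (Sum.inl (evenEnd e)) (Sum.inr (oddEnd e))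
  rcases contraction_ends (c := c) (a := a) χ e with ⟨e1, e2⟩ | ⟨e1, e2⟩ <;> rw [e1, e2]
  · exact ⟨fun k => Setoid.trans' _ k h1, fun k => Setoid.trans' _ k (Setoid.symm' _ h1)⟩
  · exact ⟨fun k => Setoid.trans' _ (Setoid.symm' _ k) h1,
      fun k => Setoid.symm' _ (Setoid.trans' _ k (Setoid.symm' _ h1))⟩

end Contraction

namespace SaddleFamily

variable {E P P' R : Type}

open scoped Classical

/-- Two families of saddles with the same states, whose arrows join the same strands. -/
theorem IsGluing.congr {N N' : SaddleFamily E P} (hs : ∀ K, N'.state K = N.state K)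
    (h : ∀ e K, e ∈ K → (N.state K).glue (N'.tail e) (N'.head e) =
      (N.state K).glue (N.tail e) (N.head e)) {K : Finset E} {L : List E} (hN : N.IsGluing K L) :
    N'.IsGluing K L := by
  induction L generalizing K with
  | nil => trivial
  | cons e L ih =>
    refine ⟨?_, ih hN.2⟩
    rw [hs, hs, h e _ (Finset.mem_insert_self _ _)]
    exact hN.1

theorem numSplits_congr {N : SaddleFamily E P} {N' : SaddleFamily E P'}
    (h : ∀ e K, e ∈ K → (N'.state K (N'.tail e) (N'.head e) ↔ N.state K (N.tail e) (N.head e)))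
    (K : Finset E) (L : List E) : N'.numSplits K L = N.numSplits K L := by
  induction L generalizing K with
  | nil => rfl
  | cons e L ih =>
    rw [numSplits, numSplits, ih]
    simp only [h e _ (Finset.mem_insert_self _ _)]

/-- Reversing arrows changes the factor by a sign. -/
theorem exists_map_factor_eq {N N' : SaddleFamily E P} {f : P → R}
    (h : ∀ e K, e ∈ K → (N'.state K (N'.tail e) (N'.head e) ↔ N.state K (N.tail e) (N.head e)))
    (hf : ∀ e, f (N'.tail e) = f (N.tail e) ∧ f (N'.head e) = f (N.head e) ∨
      f (N'.tail e) = f (N.head e) ∧ f (N'.head e) = f (N.tail e)) (K : Finset E) (L : List E) :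
    ∃ ε : ZMod 2, PointAlgebra.map f (N'.factor K L) =
      signOf ε • PointAlgebra.map f (N.factor K L) := by
  induction L generalizing K with
  | nil => exact ⟨0, by rw [signOf_zero, one_smul, factor, factor]⟩
  | cons e L ih =>
    obtain ⟨ε, hε⟩ := ih (insert e K)
    have key : ∃ δ : ZMod 2, PointAlgebra.map f
        (OF.saddleFactor (N'.state (insert e K)) (N'.tail e) (N'.head e)) = signOf δ •
          PointAlgebra.map f (OF.saddleFactor (N.state (insert e K)) (N.tail e) (N.head e)) := by
      unfold OF.saddleFactor
      rw [if_congr (h e _ (Finset.mem_insert_self _ _)) rfl rfl]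
      split_ifs
      · exact ⟨0, by rw [signOf_zero, one_smul]⟩
      · rcases hf e with ⟨h1, h2⟩ | ⟨h1, h2⟩
        · exact ⟨0, by rw [signOf_zero, one_smul]; simp [h1, h2]⟩
        · exact ⟨1, by rw [signOf_one, neg_one_smul]; simp [h1, h2]⟩
    obtain ⟨δ, hδ⟩ := key
    refine ⟨ε + δ, ?_⟩
    rw [factor, factor, map_mul, map_mul, hε, hδ, signOf_add, smul_mul_smul_comm]

theorem factor_eq_one {N : SaddleFamily E P} {K : Finset E} {L : List E}
    (h : N.numSplits K L = 0) : N.factor K L = 1 := by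
  induction L generalizing K with
  | nil => rfl
  | cons e L ih =>
    rw [numSplits, Nat.add_eq_zero_iff] at h
    rw [factor, ih h.2, one_mul]
    unfold OF.saddleFactor
    rw [if_pos]
    by_contra hn
    simp [hn] at h

theorem factor_mem (N : SaddleFamily E P) (K : Finset E) (L : List E) :
    N.factor K L ∈ ⋀[ℤ]^(N.numSplits K L) (P →₀ ℤ) := by
  induction L generalizing K with
  | nil => rw [factor, numSplits, ExteriorAlgebra.exteriorPower, pow_zero]; exact Submodule.one_le.1 le_rfl
  | cons e L ih =>
    rw [factor, numSplits, add_comm, ExteriorAlgebra.exteriorPower, pow_add]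
    refine Submodule.mul_mem_mul (ih _) ?_
    unfold OF.saddleFactor
    split_ifs
    · rw [pow_zero]; exact Submodule.one_le.1 le_rfl
    · rw [pow_one, PointAlgebra.pt, PointAlgebra.pt, ← map_sub]
      exact LinearMap.mem_range_self _ _

theorem besideId_isGluing {Q : Type} {N : SaddleFamily E P} (u : Setoid Q) {K : Finset E}
    {L : List E} (h : N.IsGluing K L) : (N.besideId u).IsGluing K L := by
  induction L generalizing K with
  | nil => trivial
  | cons e L ih =>
    refine ⟨disjointUnion_le (fun x y k => ?_) (fun x y k => ?_), ih h.2⟩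
    · exact (h.1 k).imp disjointUnion_inl.2
        (Or.imp (And.imp disjointUnion_inl.2 disjointUnion_inl.2)
          (And.imp disjointUnion_inl.2 disjointUnion_inl.2))
    · exact Or.inl (disjointUnion_inr.2 k)

theorem idBeside_isGluing {Q : Type} {N : SaddleFamily E P} (u : Setoid Q) {K : Finset E}
    {L : List E} (h : N.IsGluing K L) : (idBeside u N).IsGluing K L := by
  induction L generalizing K with
  | nil => trivial
  | cons e L ih =>
    refine ⟨disjointUnion_le (fun x y k => ?_) (fun x y k => ?_), ih h.2⟩
    · exact Or.inl (disjointUnion_inl.2 k)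
    · exact (h.1 k).imp disjointUnion_inr.2
        (Or.imp (And.imp disjointUnion_inr.2 disjointUnion_inr.2)
          (And.imp disjointUnion_inr.2 disjointUnion_inr.2))

theorem besideId_factor {Q : Type} (N : SaddleFamily E P) (u : Setoid Q) (K : Finset E)
    (L : List E) : (N.besideId u).factor K L = PointAlgebra.map Sum.inl (N.factor K L) := by
  have := map_factor (N := N) (N' := N.besideId u) (f := Sum.inl) (f' := id) (j := id) (k := id)
    (fun _ _ => rfl) (fun _ _ => disjointUnion_inl) (fun _ => rfl) (fun _ => rfl) K L
  rwa [List.map_id, PointAlgebra.map_id] at this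

theorem idBeside_factor {Q : Type} (N : SaddleFamily E P) (u : Setoid Q) (K : Finset E)
    (L : List E) : (idBeside u N).factor K L = PointAlgebra.map Sum.inr (N.factor K L) := by
  have := map_factor (N := N) (N' := idBeside u N) (f := Sum.inr) (f' := id) (j := id) (k := id)
    (fun _ _ => rfl) (fun _ _ => disjointUnion_inr) (fun _ => rfl) (fun _ => rfl) K L
  rwa [List.map_id, PointAlgebra.map_id] at this

end SaddleFamily

theorem PointAlgebra.map_mem {P Q : Type} (f : P → Q) {m : ℕ} {x : PointAlgebra P}
    (hx : x ∈ ⋀[ℤ]^m (P →₀ ℤ)) : PointAlgebra.map f x ∈ ⋀[ℤ]^m (Q →₀ ℤ) := by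
  have h : (⋀[ℤ]^m (P →₀ ℤ)).map (PointAlgebra.map f).toLinearMap ≤ ⋀[ℤ]^m (Q →₀ ℤ) := by
    rw [ExteriorAlgebra.exteriorPower, ExteriorAlgebra.exteriorPower, Submodule.map_pow]
    refine pow_le_pow_left' ?_ m
    rintro _ ⟨_, ⟨v, rfl⟩, rfl⟩
    exact ⟨Finsupp.lmapDomain ℤ ℤ f v, (ExteriorAlgebra.map_apply_ι _ _).symm⟩
  exact h ⟨x, hx, rfl⟩

theorem PointAlgebra.map_proj {P : Type} (r : Setoid P) (m : ℕ) :
    (⋀[ℤ]^m (P →₀ ℤ)).map (PointAlgebra.proj r).toLinearMap = ⋀[ℤ]^m (Quotient r →₀ ℤ) := by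
  rw [ExteriorAlgebra.exteriorPower, ExteriorAlgebra.exteriorPower, Submodule.map_pow]
  congr 1
  ext x
  constructor
  · rintro ⟨_, ⟨v, rfl⟩, rfl⟩
    exact ⟨Finsupp.lmapDomain ℤ ℤ (Quotient.mk r) v, (ExteriorAlgebra.map_apply_ι _ _).symm⟩
  · rintro ⟨v, rfl⟩
    obtain ⟨v, rfl⟩ := Finsupp.mapDomain_surjective Quotient.mk_surjective v
    exact ⟨_, ⟨v, rfl⟩, ExteriorAlgebra.map_apply_ι _ _⟩

namespace ChronologyChoice

variable {n : ℕ} (C : ChronologyChoice n) (d c b a : CrossinglessMatching n)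

/-- The factor of the contraction `C_{cba}`, in terms of the points of one line. -/
noncomputable def factor : PointAlgebra (Fin (2 * n)) :=
  PointAlgebra.map collapse ((contraction c a (C c b a)).factor ∅ (C c b a).order)

theorem exists_factor_eq : ∃ ε : ZMod 2,
    C.factor c b a = signOf ε • orderFactor c a (C c b a) := by
  refine exists_map_factor_eq (fun e K h => contraction_rel_iff _ h) (fun e => ?_) _ _
  rcases contraction_ends (c := c) (a := a) (C c b a) e with ⟨e1, e2⟩ | ⟨e1, e2⟩ <;> rw [e1, e2]
  exacts [Or.inl ⟨rfl, rfl⟩, Or.inr ⟨rfl, rfl⟩]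

/-- The sign exponent of `C_{cba}`. -/
noncomputable def sign : ZMod 2 :=
  (C.exists_factor_eq c b a).choose + orderSign c a (C c b a)

theorem signOf_sign_smul_factor : signOf (C.sign c b a) • C.factor c b a =
    signOf (orderSign c a (C c b a)) • orderFactor c a (C c b a) := by
  have h := (C.exists_factor_eq c b a).choose_spec
  rw [sign]
  generalize (C.exists_factor_eq c b a).choose = ε at h
  rw [h, smul_smul, ← signOf_add]
  congr 2
  linear_combination CharTwo.add_self_eq_zero ε

theorem isGluing : (contraction c a (C c b a)).IsGluing ∅ (C c b a).order :=
  ((C c b a).isPath.isGluing (family_isPlanar c b a)).congr (contraction_state_eq _)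
    fun _ _ h => contraction_glue _ h

theorem state_after : (contraction c a (C c b a)).state (after ∅ (C c b a).order) =
    (circleSetoid c a).comap collapse := by
  rw [Chronology.after_eq, contraction_state_eq, family_state_univ]

theorem contract_proj (x : PointAlgebra (Fin (2 * n) ⊕ Fin (2 * n))) :
    C.contract c b a (PointAlgebra.proj _ x) =
      PointAlgebra.proj _ (C.factor c b a * PointAlgebra.map collapse x) := by
  rw [contract, LinearMap.comp_apply, AlgHom.toLinearMap_apply, PointAlgebra.relabel_proj,
    PointAlgebra.map_id, eval_proj (C.isGluing c b a) (C.state_after c b a).le, map_mul, factor]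
  rw [contraction_state_eq, family_state_empty]
  exact fun _ _ h => h

theorem contractId_proj (x : PointAlgebra ((Fin (2 * n) ⊕ Fin (2 * n)) ⊕ Fin (2 * n))) :
    C.contractId d c b a (PointAlgebra.proj _ x) = PointAlgebra.proj _
      (PointAlgebra.map Sum.inl (C.factor d c b) *
        PointAlgebra.map (Sum.map collapse id) x) := by
  rw [contractId, LinearMap.comp_apply, AlgHom.toLinearMap_apply, PointAlgebra.relabel_proj,
    PointAlgebra.map_id, eval_proj (besideId_isGluing _ (C.isGluing d c b)), map_mul,
    besideId_factor, PointAlgebra.map_map, factor, PointAlgebra.map_map]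
  · rfl
  · change disjointUnion _ _ ≤ _
    rw [state_after]
    exact disjointUnion_le (fun _ _ h => disjointUnion_inl.2 h) fun _ _ h => disjointUnion_inr.2 h
  · change _ ≤ disjointUnion _ _
    rw [contraction_state_eq, family_state_empty]

theorem idContract_proj (x : PointAlgebra ((Fin (2 * n) ⊕ Fin (2 * n)) ⊕ Fin (2 * n))) :
    C.idContract d c b a (PointAlgebra.proj _ x) = PointAlgebra.proj _
      (PointAlgebra.map Sum.inr (C.factor c b a) *
        PointAlgebra.map (Sum.map id collapse ∘ Equiv.sumAssoc _ _ _) x) := by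
  rw [idContract, LinearMap.comp_apply, AlgHom.toLinearMap_apply, PointAlgebra.relabel_proj,
    eval_proj (idBeside_isGluing _ (C.isGluing c b a)), map_mul,
    idBeside_factor, PointAlgebra.map_map, PointAlgebra.map_map, factor, PointAlgebra.map_map]
  · rfl
  · change disjointUnion _ _ ≤ _
    rw [state_after]
    exact disjointUnion_le (fun _ _ h => disjointUnion_inl.2 h) fun _ _ h => disjointUnion_inr.2 h
  · change _ ≤ (disjointUnion _ _).comap _
    rw [contraction_state_eq, family_state_empty]
    refine disjointUnion_le (disjointUnion_le ?_ ?_) ?_ <;> intro x y h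
    exacts [disjointUnion_inl.2 h, disjointUnion_inr.2 (disjointUnion_inl.2 h),
      disjointUnion_inr.2 (disjointUnion_inr.2 h)]

/-- The argument is collapsed to one line in the same way for both composites, so they differ only
in the product of factors. -/
theorem leftComposite_proj (x : PointAlgebra ((Fin (2 * n) ⊕ Fin (2 * n)) ⊕ Fin (2 * n))) :
    C.leftComposite d c b a (PointAlgebra.proj _ x) = PointAlgebra.proj _
      (C.factor d b a * C.factor d c b * PointAlgebra.map (Sum.elim collapse id) x) := by
  rw [leftComposite, LinearMap.comp_apply, contractId_proj, contract_proj, map_mul (PointAlgebra.map _),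
    PointAlgebra.map_map, PointAlgebra.map_map, mul_assoc]
  congr 3
  · exact PointAlgebra.map_id _
  · congr 2
    funext y
    rcases y with (y | y) | y <;> rfl

theorem rightComposite_proj (x : PointAlgebra ((Fin (2 * n) ⊕ Fin (2 * n)) ⊕ Fin (2 * n))) :
    C.rightComposite d c b a (PointAlgebra.proj _ x) = PointAlgebra.proj _
      (C.factor d c a * C.factor c b a * PointAlgebra.map (Sum.elim collapse id) x) := by
  rw [rightComposite, LinearMap.comp_apply, idContract_proj, contract_proj, map_mul (PointAlgebra.map _),
    PointAlgebra.map_map, PointAlgebra.map_map, mul_assoc]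
  congr 3
  · exact PointAlgebra.map_id _
  · congr 2
    funext y
    rcases y with (y | y) | y <;> rfl

/-- A sign exponent of the change of chronology and orientations between the two composites. -/
noncomputable def changeSign : ZMod 2 :=
  C.sign d c b + C.sign d b a + C.sign c b a + C.sign d c a +
    blackArcs c * (whiteCount d a + whiteCount d b + whiteCount b a) +
    whiteCount d c * (whiteCount c a + whiteCount c b + whiteCount b a) +
    blackArcs b * blackArcs c +
    blackArcs b * (whiteCount d a + whiteCount d c + whiteCount c a)

/-- The comparison of signed products is made with the arrows of the coloured family; `sign`
restores the arrows of the choice. The exponents of the individual orders then occur twice and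
cancel. -/
theorem proj_factor_mul_factor :
    PointAlgebra.proj (circleSetoid d a) (C.factor d b a * C.factor d c b) =
      signOf (C.changeSign d c b a) •
        PointAlgebra.proj (circleSetoid d a) (C.factor d c a * C.factor c b a) := by
  have key := signed_orderFactor (d := d) (a := a) (C d c b) (C d b a) (C c b a) (C d c a)
  have fac : ∀ c b a, orderFactor c a (C c b a) =
      signOf (C.sign c b a + orderSign c a (C c b a)) • C.factor c b a := fun c b a => by
    have := congrArg (signOf (orderSign c a (C c b a)) • ·) (C.signOf_sign_smul_factor c b a)
    simp only [smul_smul, ← signOf_add] at this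
    rw [CharTwo.add_self_eq_zero, signOf_zero, one_smul] at this
    rw [← this, add_comm]
  rw [fac, fac, fac, fac, smul_mul_smul_comm, smul_mul_smul_comm, map_zsmul, map_zsmul, smul_smul,
    smul_smul, ← signOf_add, ← signOf_add, ← signOf_add, ← signOf_add] at key
  have cancel : ∀ {s t u : ZMod 2} {x y : OF (circleSetoid d a)}, signOf s • x = signOf t • y →
      u = s + t → x = signOf u • y := by
    rintro s t _ x y h rfl
    rw [signOf_add, mul_smul, ← h, smul_smul, ← signOf_add, CharTwo.add_self_eq_zero, signOf_zero,
      one_smul]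
  refine cancel key ?_
  unfold changeSign
  generalize orderSign d b (C d c b) = t₁
  generalize orderSign d a (C d b a) = t₂
  generalize orderSign c a (C c b a) = t₃
  generalize orderSign d a (C d c a) = t₄
  have two : (2 : ZMod 2) = 0 := rfl
  linear_combination (-(t₁ + t₂ + t₃ + t₄)) * two

theorem isChronologyChangeSign : C.IsChronologyChangeSign C.changeSign := by
  intro d c b a
  refine LinearMap.ext fun x => ?_
  obtain ⟨x, rfl⟩ := PointAlgebra.proj_surjective _ x
  rw [LinearMap.smul_apply, leftComposite_proj, rightComposite_proj,
    map_mul (PointAlgebra.proj _), map_mul (PointAlgebra.proj _) (_ * _), proj_factor_mul_factor, smul_mul_assoc]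
  rfl

end ChronologyChoice


/-! ### Numbers of splits, and the coboundary and normalisation of the sign -/

open SaddleFamily ColouredFamily CrossinglessMatching

namespace ChronologyChoice

variable {n : ℕ} (C : ChronologyChoice n) (e d c b a : CrossinglessMatching n)

theorem splits_eq : C.splits c b a =
    (family c b a).toSaddleFamily.numSplits ∅ (C c b a).order :=
  numSplits_congr (fun _ _ h => contraction_rel_iff _ h) _ _

/-- The `n` saddles change the number of circles by splits minus merges. -/
theorem two_mul_splits :
    2 * C.splits c b a + numCircles c b + numCircles b a = n + numCircles c a := by
  have h := card_state (family_isPlanar c b a) (C c b a).isPath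
  rw [Chronology.after_eq, family_state_univ, family_state_empty,
    card_quotient_comap collapse_surjective, card_quotient_disjointUnion, length_order,
    ← splits_eq] at h
  unfold numCircles
  omega

/-- This expresses the splits through the same counts as `changeSign`, so that its coboundary can be
compared with products of numbers of splits. -/
theorem splits_mod_two : (C.splits c b a : ZMod 2) =
    blackArcs b + (whiteCount c a + (whiteCount c b + whiteCount b a)) := by
  rw [splits_eq, numSplits_eq (family_isPlanar c b a) (C c b a).isPath, blackSum_eq,
    changeCount_order]

theorem splits_left_self : C.splits b b a = 0 := by
  have := C.two_mul_splits b b a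
  rw [numCircles_self] at this
  omega

theorem splits_right_self : C.splits c b b = 0 := by
  have := C.two_mul_splits c b b
  rw [numCircles_self] at this
  omega

theorem splits_cocycle :
    C.splits d b a + C.splits d c b = C.splits c b a + C.splits d c a := by
  have h1 := C.two_mul_splits d b a
  have h2 := C.two_mul_splits d c b
  have h3 := C.two_mul_splits c b a
  have h4 := C.two_mul_splits d c a
  omega

theorem factor_left_self : C.factor b b a = 1 := by
  rw [factor, factor_eq_one (C.splits_left_self b a), map_one]

theorem factor_right_self : C.factor c b b = 1 := by
  rw [factor, factor_eq_one (C.splits_right_self c b), map_one]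

theorem factor_mem : C.factor c b a ∈ ⋀[ℤ]^(C.splits c b a) (Fin (2 * n) →₀ ℤ) :=
  PointAlgebra.map_mem _ (SaddleFamily.factor_mem _ _ _)

/-- The coboundary of the sign exponent of the changes of chronology. -/
theorem changeSign_coboundary :
    C.changeSign d c b a + C.changeSign e d b a + C.changeSign e d c b =
      C.changeSign e c b a + C.changeSign e d c a +
        (C.splits e d c : ZMod 2) * (C.splits c b a : ZMod 2) := by
  rw [splits_mod_two, splits_mod_two]
  unfold changeSign
  -- The exponents `s` enter as a coboundary and cancel; the rest is a polynomial identity over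
  -- `ZMod 2` in the white counts and the black arcs.
  generalize C.sign = s
  generalize blackArcs b = yb
  generalize blackArcs c = yc
  generalize blackArcs d = yd
  generalize whiteCount e d = w1
  generalize whiteCount e c = w2
  generalize whiteCount e b = w3
  generalize whiteCount e a = w4
  generalize whiteCount d c = w5
  generalize whiteCount d b = w6
  generalize whiteCount d a = w7
  generalize whiteCount c b = w8
  generalize whiteCount c a = w9
  generalize whiteCount b a = w10
  grind

theorem changeSign_eq_zero_of_splits (h1 : C.splits d b a = 0) (h2 : C.splits d c b = 0)
    (h3 : C.splits c b a = 0) (h4 : C.splits d c a = 0) : C.changeSign d c b a = 0 := by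
  have h := C.proj_factor_mul_factor d c b a
  rw [factor, factor, factor, factor, factor_eq_one h1, factor_eq_one h2, factor_eq_one h3,
    factor_eq_one h4] at h
  simp only [map_one, mul_one] at h
  generalize C.changeSign d c b a = φ at h
  -- Without splits all factors are `1`. Taking the constant term turns `1 = ±1` into an equation of
  -- integers, so the sign is positive.
  have h' := congrArg ExteriorAlgebra.algebraMapInv h
  rw [map_zsmul, map_one] at h'
  clear h
  revert h'
  revert φ
  decide

/-- Comparing the two composites directly is inconclusive when their value is zero. The explicit
formula reduces the exponent to three cases without splits, where the value cannot vanish. -/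
theorem changeSign_self : C.changeSign d b b a = 0 := by
  have h1 := C.changeSign_eq_zero_of_splits d b b b (C.splits_right_self d b)
    (C.splits_right_self d b) (C.splits_left_self b b) (C.splits_right_self d b)
  have h2 := C.changeSign_eq_zero_of_splits b b b a (C.splits_left_self b a)
    (C.splits_left_self b b) (C.splits_left_self b a) (C.splits_left_self b a)
  have h3 := C.changeSign_eq_zero_of_splits b b b b (C.splits_left_self b b)
    (C.splits_left_self b b) (C.splits_left_self b b) (C.splits_left_self b b)
  have h4 : C.changeSign d b b a =
      C.changeSign d b b b + C.changeSign b b b a + C.changeSign b b b b := by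
    unfold changeSign
    generalize C.sign = s
    generalize blackArcs b = yb
    generalize whiteCount = w
    grind
  rw [h4, h1, h2, h3]
  rfl

end ChronologyChoice

/-! ### The quasialgebra -/

theorem ExteriorAlgebra.mul_comm_of_mem {R M : Type*} [CommRing R] [AddCommGroup M] [Module R M]
    {m t : ℕ} {x y : ExteriorAlgebra R M} (hx : x ∈ ⋀[R]^m M) (hy : y ∈ ⋀[R]^t M) :
    x * y = (-1 : ℤ) ^ (m * t) • (y * x) := by
  have key : ∀ (v : M) {t : ℕ} {y : ExteriorAlgebra R M}, y ∈ ⋀[R]^t M →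
      ExteriorAlgebra.ι R v * y = (-1 : ℤ) ^ t • (y * ExteriorAlgebra.ι R v) := by
    intro v t y hy
    refine Submodule.pow_induction_on_left' _ (C := fun t y _ =>
      ExteriorAlgebra.ι R v * y = (-1 : ℤ) ^ t • (y * ExteriorAlgebra.ι R v)) ?_ ?_ ?_ hy
    · intro r
      rw [pow_zero, one_smul, Algebra.commutes]
    · intro x y i _ _ h1 h2
      rw [mul_add, add_mul, smul_add, h1, h2]
    · rintro _ ⟨u, rfl⟩ i x _ h
      have anti : ExteriorAlgebra.ι R v * ExteriorAlgebra.ι R u =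
          - (ExteriorAlgebra.ι R u * ExteriorAlgebra.ι R v) :=
        eq_neg_of_add_eq_zero_left (ExteriorAlgebra.ι_add_mul_swap v u)
      rw [← mul_assoc, anti, neg_mul, mul_assoc, h, mul_smul_comm, pow_succ, mul_neg_one, neg_smul,
        mul_assoc]
  refine Submodule.pow_induction_on_left' _ (C := fun m x _ =>
    x * y = (-1 : ℤ) ^ (m * t) • (y * x)) ?_ ?_ ?_ hx
  · intro r
    rw [zero_mul, pow_zero, one_smul, Algebra.commutes]
  · intro x x' i _ _ h1 h2
    rw [mul_add, add_mul, smul_add, h1, h2]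
  · rintro _ ⟨u, rfl⟩ i x _ h
    rw [mul_assoc, h, mul_smul_comm, ← mul_assoc, key u hy, smul_mul_assoc, smul_smul, ← pow_add,
      Nat.succ_mul, mul_assoc]

/-- An order on the circles gives a basis of the exterior algebra, so the group is free and has no
torsion. -/
theorem OF.smul_eq_zero_iff {P : Type} {r : Setoid P} {k : ℤ} {x : OF r} :
    k • x = 0 ↔ k = 0 ∨ x = 0 := by
  classical
  let _ : LinearOrder (Quotient r) := linearOrderOfSTO WellOrderingRel
  let B := (Finsupp.basisSingleOne (R := ℤ) (ι := Quotient r)).ExteriorAlgebra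
  constructor
  · intro h
    refine or_iff_not_imp_left.2 fun hk => B.repr.injective ?_
    ext i
    have h' : k • B.repr x i = 0 := by
      rw [← Finsupp.smul_apply, ← map_zsmul, h, map_zero, Finsupp.zero_apply]
    rw [map_zero, Finsupp.zero_apply]
    exact (mul_eq_zero.1 h').resolve_left hk
  · rintro (rfl | rfl) <;> simp

section QuantumPart

variable {n : ℕ} {P : Type} {r : Setoid P} {k : ℤ} {x : OF r}

/-- The shift is fixed by the diagram, so at most one exterior power has a given quantum degree. -/
theorem quantumPart_eq {m : ℕ} (h : 2 * (m : ℤ) - Nat.card (Quotient r) + n = k) :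
    quantumPart n r k = ⋀[ℤ]^m (Quotient r →₀ ℤ) := by
  refine le_antisymm (iSup₂_le fun m' h' => ?_) (le_iSup₂_of_le m h le_rfl)
  have : m' = m := by omega
  rw [this]

theorem quantumPart_eq_bot (h : ∀ m : ℕ, 2 * (m : ℤ) - Nat.card (Quotient r) + n ≠ k) :
    quantumPart n r k = ⊥ :=
  eq_bot_iff.2 (iSup₂_le fun m h' => absurd h' (h m))

theorem quantumPart_cases (hx : x ∈ quantumPart n r k) :
    x = 0 ∨ ∃ m : ℕ, 2 * (m : ℤ) - Nat.card (Quotient r) + n = k ∧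
      x ∈ ⋀[ℤ]^m (Quotient r →₀ ℤ) := by
  by_cases h : ∃ m : ℕ, 2 * (m : ℤ) - Nat.card (Quotient r) + n = k
  · obtain ⟨m, hm⟩ := h
    rw [quantumPart_eq hm] at hx
    exact Or.inr ⟨m, hm, hx⟩
  · rw [quantumPart_eq_bot (not_exists.1 h)] at hx
    exact Or.inl hx

theorem iSupIndep_quantumPart (n : ℕ) (r : Setoid P) : iSupIndep (quantumPart n r) := by
  have hi : iSupIndep fun m : ℕ => ⋀[ℤ]^m (Quotient r →₀ ℤ) :=
    DirectSum.IsInternal.submodule_iSupIndep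
      (DirectSum.Decomposition.isInternal fun m : ℕ => ⋀[ℤ]^m (Quotient r →₀ ℤ))
  intro k
  by_cases h : ∃ m : ℕ, 2 * (m : ℤ) - Nat.card (Quotient r) + n = k
  · obtain ⟨m, hm⟩ := h
    rw [quantumPart_eq hm]
    refine (hi m).mono_right (iSup₂_le fun k' hk' => iSup₂_le fun m' hm' => ?_)
    refine le_iSup₂_of_le m' ?_ le_rfl
    rintro rfl
    exact hk' (hm'.symm.trans hm)
  · rw [quantumPart_eq_bot (not_exists.1 h)]
    exact disjoint_bot_left

theorem mem_iSup_exteriorPower (x : OF r) : x ∈ ⨆ m : ℕ, ⋀[ℤ]^m (Quotient r →₀ ℤ) := by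
  rw [DirectSum.IsInternal.submodule_iSup_eq_top
    (DirectSum.Decomposition.isInternal fun m : ℕ => ⋀[ℤ]^m (Quotient r →₀ ℤ))]
  trivial

end QuantumPart

/-! ### Products of blocks and the grading of the odd arc algebra -/

namespace OddArcAlgebra

variable {n : ℕ} {C : ChronologyChoice n} {d c b a : CrossinglessMatching n}

theorem blockMul_proj (x y : PointAlgebra (Fin (2 * n))) :
    blockMul C c b a (PointAlgebra.proj _ x) (PointAlgebra.proj _ y) =
      PointAlgebra.proj _ (C.factor c b a * (x * y)) := by
  rw [blockMul, PointAlgebra.relabel_proj fun _ _ h => disjointUnion_inl.2 h,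
    PointAlgebra.relabel_proj fun _ _ h => disjointUnion_inr.2 h,
    ← map_mul (PointAlgebra.proj _), ChronologyChoice.contract_proj, map_mul (PointAlgebra.map _),
    PointAlgebra.map_map, PointAlgebra.map_map]
  congr 3
  · exact PointAlgebra.map_id x
  · exact PointAlgebra.map_id y

theorem blockMul_zero_left (y : OF (circleSetoid b a)) : blockMul C c b a 0 y = 0 := by
  simp [blockMul]

theorem blockMul_zero_right (x : OF (circleSetoid c b)) : blockMul C c b a x 0 = 0 := by
  simp [blockMul]

theorem one_blockMul (y : OF (circleSetoid b a)) : blockMul C b b a 1 y = y := by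
  obtain ⟨y, rfl⟩ := PointAlgebra.proj_surjective _ y
  rw [← map_one (PointAlgebra.proj _), blockMul_proj, C.factor_left_self, one_mul, one_mul]

theorem blockMul_one (x : OF (circleSetoid c b)) : blockMul C c b b x 1 = x := by
  obtain ⟨x, rfl⟩ := PointAlgebra.proj_surjective _ x
  rw [← map_one (PointAlgebra.proj _), blockMul_proj, C.factor_right_self, one_mul, mul_one]

/-- On one line of points both sides are the product `x * y * z` multiplied by two factors. In
`x(yz)` the factor of `C_{cba}` stands behind `x`, and graded commutativity moves it to the front;
the other part of the sign is the change of chronology. -/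
theorem blockMul_assoc {m : ℕ} {x : OF (circleSetoid d c)}
    (hx : x ∈ ⋀[ℤ]^m (Quotient (circleSetoid d c) →₀ ℤ)) (y : OF (circleSetoid c b))
    (z : OF (circleSetoid b a)) :
    blockMul C d b a (blockMul C d c b x y) z =
      signOf (C.changeSign d c b a + m * C.splits c b a) •
        blockMul C d c a x (blockMul C c b a y z) := by
  rw [← PointAlgebra.map_proj] at hx
  obtain ⟨x, hx, rfl⟩ := hx
  obtain ⟨y, rfl⟩ := PointAlgebra.proj_surjective _ y
  obtain ⟨z, rfl⟩ := PointAlgebra.proj_surjective _ z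
  change blockMul C d b a (blockMul C d c b (PointAlgebra.proj _ x) _) _ =
    _ • blockMul C d c a (PointAlgebra.proj _ x) _
  rw [blockMul_proj, blockMul_proj, blockMul_proj, blockMul_proj]
  have h1 : C.factor d b a * (C.factor d c b * (x * y) * z) =
      C.factor d b a * C.factor d c b * (x * y * z) := by simp only [mul_assoc]
  have h2 : C.factor d c a * (x * (C.factor c b a * (y * z))) =
      (-1 : ℤ) ^ (m * C.splits c b a) • (C.factor d c a * C.factor c b a * (x * y * z)) := by
    rw [← mul_assoc x, ExteriorAlgebra.mul_comm_of_mem hx (C.factor_mem c b a), smul_mul_assoc,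
      mul_smul_comm]
    simp only [mul_assoc]
  have h3 : (-1 : ℤ) ^ (m * C.splits c b a) = signOf (m * C.splits c b a) := by
    rw [← Nat.cast_mul]
    generalize m * C.splits c b a = k
    rcases Nat.even_or_odd k with hk | hk
    · rw [hk.neg_one_pow, (ZMod.natCast_eq_zero_iff_even).2 hk, signOf_zero]
    · rw [hk.neg_one_pow, (ZMod.natCast_eq_one_iff_odd).2 hk, signOf_one]
  rw [h1, h2, h3, map_zsmul, map_mul (PointAlgebra.proj _) (_ * _),
    map_mul (PointAlgebra.proj _) (_ * _) (_ * _ * _), C.proj_factor_mul_factor, smul_smul, ← signOf_add, smul_mul_assoc, add_assoc,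
    CharTwo.add_self_eq_zero, add_zero]

theorem blockMul_mem {k l : ℤ} {x : OF (circleSetoid c b)} {y : OF (circleSetoid b a)}
    (hx : x ∈ quantumPart n (circleSetoid c b) k) (hy : y ∈ quantumPart n (circleSetoid b a) l) :
    blockMul C c b a x y ∈ quantumPart n (circleSetoid c a) (k + l) := by
  rcases quantumPart_cases hx with rfl | ⟨m, hm, hx⟩
  · rw [blockMul_zero_left]; exact zero_mem _
  rcases quantumPart_cases hy with rfl | ⟨m', hm', hy⟩
  · rw [blockMul_zero_right]; exact zero_mem _
  have hs := C.two_mul_splits c b a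
  unfold numCircles at hs
  -- The exterior degree grows by the number of splits, and `two_mul_splits` says that the shifts by
  -- numbers of circles compensate for exactly this.
  rw [quantumPart_eq (m := C.splits c b a + (m + m')) (by push_cast; omega)]
  rw [← PointAlgebra.map_proj] at hx hy ⊢
  obtain ⟨x, hx', rfl⟩ := hx
  obtain ⟨y, hy', rfl⟩ := hy
  refine ⟨C.factor c b a * (x * y), ?_, (blockMul_proj x y).symm⟩
  rw [ExteriorAlgebra.exteriorPower, pow_add, pow_add]
  exact Submodule.mul_mem_mul (C.factor_mem c b a) (Submodule.mul_mem_mul hx' hy')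

theorem mul_apply_of_left {x y : OddArcAlgebra C}
    (hx : ∀ d' c', ¬ (d' = d ∧ c' = c) → x d' c' = 0) (a : CrossinglessMatching n) :
    (x * y) d a = blockMul C d c a (x d c) (y c a) := by
  rw [mul_apply]
  refine Finset.sum_eq_single c (fun b _ hb => ?_) fun h => absurd (Finset.mem_univ _) h
  rw [hx d b fun k => hb k.2, blockMul_zero_left]

theorem mul_apply_eq_zero_of_left {x y : OddArcAlgebra C} (hx : ∀ c, x d c = 0) :
    (x * y) d a = 0 := by
  rw [mul_apply]
  exact Finset.sum_eq_zero fun b _ => by rw [hx, blockMul_zero_left]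

theorem mul_apply_eq_zero_of_right {x y : OddArcAlgebra C} (hy : ∀ c, y c a = 0) :
    (x * y) d a = 0 := by
  rw [mul_apply]
  exact Finset.sum_eq_zero fun b _ => by rw [hy, blockMul_zero_right]

/-- The unit of the odd arc algebra. -/
noncomputable def unit (C : ChronologyChoice n) : OddArcAlgebra C :=
  fun b a => if b = a then 1 else 0

theorem unit_apply_self : unit C a a = 1 := if_pos rfl

theorem unit_apply_of_ne (h : b ≠ a) : unit C b a = 0 := if_neg h

theorem exists_unit (C : ChronologyChoice n) :
    ∃ u : OddArcAlgebra C, ∀ x : OddArcAlgebra C, u * x = x ∧ x * u = x := by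
  refine ⟨unit C, fun x => ⟨?_, ?_⟩⟩ <;> funext c a <;> rw [mul_apply]
  · rw [Finset.sum_eq_single c]
    · rw [unit_apply_self, one_blockMul]
    · intro b _ hb
      rw [unit_apply_of_ne hb.symm, blockMul_zero_left]
    · exact fun h => absurd (Finset.mem_univ _) h
  · rw [Finset.sum_eq_single a]
    · rw [unit_apply_self, blockMul_one]
    · intro b _ hb
      rw [unit_apply_of_ne hb, blockMul_zero_right]
    · exact fun h => absurd (Finset.mem_univ _) h

/-- The value of an element at a block. -/
noncomputable def eval (C : ChronologyChoice n) (b a : CrossinglessMatching n) :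
    OddArcAlgebra C →ₗ[ℤ] OF (circleSetoid b a) where
  toFun x := x b a
  map_add' _ _ := rfl
  map_smul' _ _ := rfl

/-- The inclusion of a block. -/
noncomputable def block (C : ChronologyChoice n) (b a : CrossinglessMatching n) :
    OF (circleSetoid b a) →ₗ[ℤ] OddArcAlgebra C :=
  LinearMap.single ℤ (fun b => (a : CrossinglessMatching n) → OF (circleSetoid b a)) b ∘ₗ
    LinearMap.single ℤ (fun a => OF (circleSetoid b a)) a

theorem block_apply_self (x : OF (circleSetoid b a)) : block C b a x b a = x := by
  change Pi.single (M := fun b => (a : CrossinglessMatching n) → OF (circleSetoid b a)) b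
    (Pi.single (M := fun a => OF (circleSetoid b a)) a x) b a = x
  rw [Pi.single_eq_same, Pi.single_eq_same]

theorem block_apply_of_ne (x : OF (circleSetoid b a)) {b' a' : CrossinglessMatching n}
    (h : ¬ (b' = b ∧ a' = a)) : block C b a x b' a' = 0 := by
  change Pi.single (M := fun b => (a : CrossinglessMatching n) → OF (circleSetoid b a)) b
    (Pi.single (M := fun a => OF (circleSetoid b a)) a x) b' a' = 0
  by_cases hb : b' = b
  · subst hb
    rw [Pi.single_eq_same, Pi.single_eq_of_ne fun k => h ⟨rfl, k⟩]
  · rw [Pi.single_eq_of_ne hb]; rfl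

theorem sum_block (x : OddArcAlgebra C) : ∑ b, ∑ a, block C b a (x b a) = x := by
  suffices h : ∀ b a, eval C b a (∑ b, ∑ a, block C b a (x b a)) = x b a by
    funext b a
    exact h b a
  intro b a
  rw [map_sum, Finset.sum_eq_single b, map_sum, Finset.sum_eq_single a]
  · exact block_apply_self (C := C) _
  · exact fun a' _ h => block_apply_of_ne (C := C) _ fun k => h k.2.symm
  · exact fun h => absurd (Finset.mem_univ _) h
  · intro b' _ h
    rw [map_sum]
    exact Finset.sum_eq_zero fun a' _ => block_apply_of_ne (C := C) _ fun k => h k.1.symm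
  · exact fun h => absurd (Finset.mem_univ _) h

open CategoryTheory in
theorem exists_quantumDegree_eq (b a : ArcQuantumGroupoid n) (m : ℕ) :
    ∃ g : a ⟶ b, ArcQuantumGroupoid.quantumDegree g =
      2 * (m : ℤ) - numCircles (n := n) b a + n :=
  ⟨⟨2 * (m : ℤ) - numCircles (n := n) b a + n, by
    simp only [Int.even_iff, Nat.ModEq]; omega⟩, rfl⟩

open CategoryTheory in
theorem block_mem_grading {b a : ArcQuantumGroupoid n} (g : a ⟶ b)
    {y : OF (circleSetoid (n := n) b a)}
    (hy : y ∈ quantumPart n (circleSetoid (n := n) b a) (ArcQuantumGroupoid.quantumDegree g)) :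
    block C b a y ∈ grading C g := by
  have h : block C b a y b a = y := block_apply_self (C := C) y
  exact ⟨h.symm ▸ hy, fun b' a' h => block_apply_of_ne _ h⟩

open CategoryTheory in
open scoped Classical in
theorem grading_isInternal (C : ChronologyChoice n) : DirectSum.IsInternal
    fun g : (Σ a b : ArcQuantumGroupoid n, (a ⟶ b)) => grading C g.2.2 := by
  refine DirectSum.isInternal_submodule_of_iSupIndep_of_iSup_eq_top ?_ ?_
  · rintro ⟨a, b, g⟩
    rw [Submodule.disjoint_def]
    intro x hx hx'
    have h0 : x b a = 0 := by
      refine Submodule.disjoint_def.1 (iSupIndep_quantumPart n (circleSetoid (n := n) b a)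
        (ArcQuantumGroupoid.quantumDegree g)) _ hx.1 ?_
      -- At the block of `g`, an element of another part vanishes unless it belongs to the same
      -- block with a different quantum degree, so independence is reduced to one block.
      have hle : (⨆ (h : (Σ a b : ArcQuantumGroupoid n, (a ⟶ b))) (_ : h ≠ ⟨a, b, g⟩),
          grading C h.2.2) ≤ (⨆ (k : ℤ) (_ : k ≠ ArcQuantumGroupoid.quantumDegree g),
            quantumPart n (circleSetoid (n := n) b a) k).comap (eval C b a) := by
        refine iSup₂_le ?_
        rintro ⟨a', b', g'⟩ hne y hy
        by_cases h : b = b' ∧ a = a'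
        · obtain ⟨rfl, rfl⟩ := h
          refine (le_iSup₂_of_le (ArcQuantumGroupoid.quantumDegree g') ?_ le_rfl :
            quantumPart n (circleSetoid (n := n) b a) (ArcQuantumGroupoid.quantumDegree g') ≤ _) hy.1
          intro k
          exact hne (by rw [Subtype.ext k])
        · have : eval C b a y = 0 := hy.2 b a h
          exact Submodule.mem_comap.2 (this.symm ▸ zero_mem _)
      exact hle hx'
    funext b' a'
    by_cases h : b' = b ∧ a' = a
    · obtain ⟨rfl, rfl⟩ := h
      exact h0
    · exact hx.2 b' a' h
  · refine eq_top_iff.2 fun x _ => ?_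
    rw [← sum_block x]
    refine Submodule.sum_mem _ fun b _ => Submodule.sum_mem _ fun a _ => ?_
    have hle : (⨆ m : ℕ, ⋀[ℤ]^m (Quotient (circleSetoid b a) →₀ ℤ)) ≤
        (⨆ g : (Σ a b : ArcQuantumGroupoid n, (a ⟶ b)), grading C g.2.2).comap (block C b a) := by
      refine iSup_le fun m y hy => ?_
      obtain ⟨g, hg⟩ := exists_quantumDegree_eq (n := n) b a m
      refine Submodule.mem_iSup_of_mem ⟨a, b, g⟩ (block_mem_grading g ?_)
      rw [quantumPart_eq hg.symm]
      exact hy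
    exact hle (mem_iSup_exteriorPower _)

open CategoryTheory in
theorem grading_mul_mem ⦃a b c : ArcQuantumGroupoid n⦄ (g : b ⟶ c) (h : a ⟶ b)
    (x y : OddArcAlgebra C) (hx : x ∈ grading C g) (hy : y ∈ grading C h) :
    x * y ∈ grading C (h ≫ g) := by
  refine ⟨?_, fun b' a' hne => ?_⟩
  · have hxy := mul_apply_of_left (d := c) (c := b) (y := y) hx.2 a
    exact hxy.symm ▸ blockMul_mem hx.1 hy.1
  · by_cases hb : b' = c
    · exact mul_apply_eq_zero_of_right fun c' => hy.2 c' a' fun k => hne ⟨hb, k.2⟩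
    · exact mul_apply_eq_zero_of_left fun c' => hx.2 b' c' fun k => hb k.1

open CategoryTheory in
theorem grading_mul_eq_zero ⦃a b b' c : ArcQuantumGroupoid n⦄ (g : b' ⟶ c) (h : a ⟶ b)
    (x y : OddArcAlgebra C) (hne : b' ≠ b) (hx : x ∈ grading C g) (hy : y ∈ grading C h) :
    x * y = 0 := by
  funext d e
  rw [mul_apply]
  refine Finset.sum_eq_zero fun m _ => ?_
  by_cases hm : m = b'
  · rw [hy.2 m e fun k => hne (hm.symm.trans k.1), blockMul_zero_right]
  · rw [hx.2 d m fun k => hm k.2, blockMul_zero_left]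

end OddArcAlgebra

/-! ### The associator is a normalised cocycle, and the quasialgebra -/

namespace ChronologyChoice

open CategoryTheory

variable {n : ℕ} (C : ChronologyChoice n)

/-- For homogeneous elements of a block the parity is the exterior degree, and a product acquires
one additional factor for every split. -/
theorem parity_comp {c d e : ArcQuantumGroupoid n} (g : d ⟶ e) (h : c ⟶ d) :
    ArcQuantumGroupoid.parity (h ≫ g) =
      ArcQuantumGroupoid.parity g + ArcQuantumGroupoid.parity h + C.splits e d c := by
  have hs := C.two_mul_splits e d c
  have h1 := g.2
  have h2 := h.2
  have h3 : ArcQuantumGroupoid.quantumDegree (h ≫ g) =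
    ArcQuantumGroupoid.quantumDegree g + ArcQuantumGroupoid.quantumDegree h := rfl
  unfold ArcQuantumGroupoid.parity
  rw [h3]
  unfold ArcQuantumGroupoid.quantumDegree
  simp only [Int.even_iff, Nat.ModEq] at h1 h2
  omega

theorem isNormalizedThreeCocycle : IsNormalizedThreeCocycle (C.associator C.changeSign) := by
  have hadd : ∀ s t : ZMod 2, ((-1 : ℤˣ) ^ s * (-1 : ℤˣ) ^ t : ℤˣ) = (-1) ^ (s + t) := by decide
  refine ⟨fun a b c d e g h k l => ?_, fun a b c h l => ?_⟩
  · unfold associator commutationTerm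
    rw [hadd, hadd, hadd]
    congr 1
    have h1 := C.changeSign_coboundary e d c b a
    have h2 : (C.splits d b a : ZMod 2) + C.splits d c b = C.splits c b a + C.splits d c a := by
      exact_mod_cast congrArg (Nat.cast : ℕ → ZMod 2) (C.splits_cocycle d c b a)
    rw [C.parity_comp g h]
    push_cast
    -- The correction in the parity of a composition contributes the product of numbers of splits
    -- that cancels the one in `changeSign_coboundary`. The terms linear in the parity of `g` cancel
    -- because the number of splits is a cocycle.
    linear_combination h1 + (ArcQuantumGroupoid.parity g : ZMod 2) * h2
  · unfold associator commutationTerm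
    have h1 : C.splits b b a = 0 := C.splits_left_self b a
    have h2 : C.changeSign c b b a = 0 := C.changeSign_self c b a
    rw [h1, h2]
    simp

end ChronologyChoice

theorem OddArcAlgebra.isQuasialgebra {n : ℕ} (C : ChronologyChoice n) :
    IsQuasialgebra (OddArcAlgebra.grading C) (C.associator C.changeSign) where
  exists_unit := OddArcAlgebra.exists_unit C
  grading := ⟨OddArcAlgebra.grading_isInternal C, OddArcAlgebra.grading_mul_mem,
    OddArcAlgebra.grading_mul_eq_zero⟩
  cocycle := C.isNormalizedThreeCocycle
  assoc a b c d g h k x y z hx hy hz := by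
    have hxy := OddArcAlgebra.grading_mul_mem g h x y hx hy
    have hyz := OddArcAlgebra.grading_mul_mem h k y z hy hz
    have hl := OddArcAlgebra.grading_mul_mem _ k _ z hxy hz
    have hr := OddArcAlgebra.grading_mul_mem g _ x _ hx hyz
    funext d' a'
    change _ = (C.associator C.changeSign g h k : ℤ) • (x * (y * z)) d' a'
    by_cases hd : d' = d ∧ a' = a
    · obtain ⟨rfl, rfl⟩ := hd
      have e1 := OddArcAlgebra.mul_apply_of_left (d := d') (c := b) (y := z) hxy.2 a'
      have e2 := OddArcAlgebra.mul_apply_of_left (d := d') (c := c) (y := y * z) hx.2 a'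
      have e3 := OddArcAlgebra.mul_apply_of_left (d := d') (c := c) (y := y) hx.2 b
      have e4 := OddArcAlgebra.mul_apply_of_left (d := c) (c := b) (y := z) hy.2 a'
      refine (e1.trans (congrArg (OddArcAlgebra.blockMul C d' b a' · (z b a')) e3)).trans ?_
      refine Eq.trans ?_ (congrArg ((C.associator C.changeSign g h k : ℤ) • ·)
        (e2.trans (congrArg (OddArcAlgebra.blockMul C d' c a' (x d' c)) e4))).symm
      -- Either no exterior power has the degree of `g`, and `x` vanishes at its block, or `x` has
      -- an exterior degree `m` there, which is the parity of `g`.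
      rcases quantumPart_cases hx.1 with h0 | ⟨m, hm, hm'⟩
      · rw [h0]
        refine (congrArg (OddArcAlgebra.blockMul C d' b a' · (z b a'))
          (OddArcAlgebra.blockMul_zero_left _)).trans ?_
        refine (OddArcAlgebra.blockMul_zero_left _).trans ?_
        refine Eq.trans ?_ (congrArg ((C.associator C.changeSign g h k : ℤ) • ·)
          (OddArcAlgebra.blockMul_zero_left _)).symm
        exact (smul_zero _).symm
      · refine (OddArcAlgebra.blockMul_assoc hm' _ _).trans ?_
        have hp : ArcQuantumGroupoid.parity g = m := by
          unfold ArcQuantumGroupoid.parity numCircles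
          omega
        unfold ChronologyChoice.associator ChronologyChoice.commutationTerm signOf
        rw [hp]
        push_cast
        rfl
    · rw [hl.2 d' a' hd, hr.2 d' a' hd, smul_zero]

/-- If two exponents differ, the composite is its own negative, and it vanishes since its target has
no torsion. -/
theorem ChronologyChoice.IsChronologyChangeSign.unique {n : ℕ} {C : ChronologyChoice n}
    {φ φ' : (d c b a : CrossinglessMatching n) → ZMod 2} (h : C.IsChronologyChangeSign φ)
    (h' : C.IsChronologyChangeSign φ') {d c b a : CrossinglessMatching n}
    (hne : C.leftComposite d c b a ≠ 0) : φ' d c b a = φ d c b a := by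
  by_contra hn
  apply hne
  have h1 := h d c b a
  have h2 := h' d c b a
  have key : ∀ s t : ZMod 2, t ≠ s →
      (((-1 : ℤˣ) ^ t : ℤˣ) : ℤ) = -(((-1 : ℤˣ) ^ s : ℤˣ) : ℤ) := by decide
  rw [key _ _ hn, neg_smul, ← h1] at h2
  refine LinearMap.ext fun x => ?_
  have h3 : (2 : ℤ) • C.leftComposite d c b a x = 0 := by
    have := congrArg (fun f => f x) h2
    simp only [LinearMap.neg_apply] at this
    rw [two_smul]
    nth_rewrite 2 [this]
    exact add_neg_cancel _
  exact (OF.smul_eq_zero_iff.1 h3).resolve_left two_ne_zero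

theorem mainTheorem3 (n : ℕ) (C : ChronologyChoice n) :
    ∃ φch : (d c b a : CrossinglessMatching n) → ZMod 2,
      C.IsChronologyChangeSign φch ∧
      (∀ φ' : (d c b a : CrossinglessMatching n) → ZMod 2, C.IsChronologyChangeSign φ' →
        ∀ d c b a, C.leftComposite d c b a ≠ 0 → φ' d c b a = φch d c b a) ∧
      IsQuasialgebra (OddArcAlgebra.grading C) (C.associator φch) :=
  ⟨C.changeSign, C.isChronologyChangeSign,
    fun _ h _ _ _ _ hne => C.isChronologyChangeSign.unique h hne, OddArcAlgebra.isQuasialgebra C⟩
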